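/- **Setting.** For a positive measure $\nu$ on $\mathbb R_+^d$, a random vector $X$ in $\mathbb R_+^d$ has the generalized Gamma convolution law $\mathcal G_d(\nu)$ with Thorin measure $\nu$ if its cumulant generating function $K(t)=\ln\mathbb E\,e^{\langle t,X\rangle}$ is $K(t)=-\int\ln(1-\langle t,s\rangle)\,\nu(ds)$ for all $t\in\mathbb C^d$ with $\mathrm{Re}\,t_i\le 0$ for all $i$; its Lebesgue density, if it exists, is denoted $f_\nu$. Call $\nu$ *well-behaved* if $\nu=\sum_{i=1}^n\alpha_i\delta_{s_i}$ is finitely atomic with $\alpha_i>0$, $s_i\in\mathbb R_+^d\setminus\{0\}$ and $\sum_i\alpha_i\ge 1$, and if, writing $S(s)$ for the ray from $0$ through $s$, for every $J\subseteq\{1,\dots,n\}$ with $\nu\big(\bigcup_{i\in J}S(s_i)\big)>\nu\big(\bigcup_{i\notin J}S(s_i)\big)$ the only $x\in\mathbb R^d$ with $\langle s_i,x\rangle=0$ for all $i\in J$ is $x=0$. Let $I\subset\mathbb N^d$ be a finite, non-empty, downward closed index set, $|k|=k_1+\dots+k_d$, $k!=\prod_i k_i!$, with the convention $(|k|-1)!=1$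 for $k=0$. The Thorin moments of $\nu$ are $\tau(\nu)=\big(K^{(k)}(-\mathbf 1)/(|k|-1)!\big)_{k\in I}$. Let $B:\mathbb R^I\to\mathbb R^I$ send $\tau$ to $\big(M^{(k)}(-\mathbf 1)\big)_{k\in I}$, where $M=e^{K}$ and $K(t)=\sum_{j\in I}\tau_j\frac{(|j|-1)!}{j!}(t+\mathbf 1)^j$; it is a bijection onto $\{\mu:\mu_0>0\}$. Let $A$ be the $I\times I$ matrix with entries $A_{k,j}=\sqrt2^{\,d}\binom{k}{j}\frac{(-2)^{|j|}}{j!}$, where $\binom kj=\prod_i\binom{k_i}{j_i}$. For data $\mathcal X=(X_1,\dots,X_N)$ put $\hat\mu(\mathcal X)=\big(\frac1N\sum_{n=1}^N X_n^k e^{-|X_n|}\big)_{k\in I}$ and $\hat\tau(\mathcal X)=B^{-1}(\hat\mu(\mathcal X))$, let $\nabla(\mathcal X)$ be the Jacobian of $\tau\mapsto AB(\tau)$ at $\hat\tau(\mathcal X)$, and define the linearized loss $$\widehat{\mathcal L}_I(\mathcal X,\nu)=\|\hat\tau(\mathcal X)-\tau(\nu)\|^2_{\nabla(\mathcal X)}=\|\nabla(\mathcal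 X)(\hat\tau(\mathcal X)-\tau(\nu))\|_2^2 .$$ **Statement (consistency of $\widehat{\mathcal L}$).** Let $X_1,X_2,\dots$ be i.i.d. random vectors whose common density $f\in L^2$ is the density of $\mathcal G_d(\nu)$ for a well-behaved $\nu$, and let $\hat\nu=\hat\nu_{N,I}$ denote a global minimizer of $\widehat{\mathcal L}_I\big((X_1,\dots,X_N),\cdot\big)$ over all well-behaved Thorin measures. Then, almost surely, $\|f-f_{\hat\nu}\|_2^2\to0$ as $N\to\infty$ and then $I\to\mathbb N^d$. That is, almost surely, for every $\varepsilon>0$ there is a finite $I_0\subset\mathbb N^d$ such that for every finite, non-empty, downward closed $I\supseteq I_0$ there is $N_0$ such that for all $N\ge N_0$ every global minimizer $\hat\nu_{N,I}$ has a density, and $\|f-f_{\hat\nu_{N,I}}\|_2^2\le\varepsilon$. -/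

import Mathlib

open MeasureTheory ProbabilityTheory Filter Topology
open scoped ENNReal Nat Matrix

noncomputable section

namespace Thorin

variable {d : ℕ}

/-- The mixed partial derivative `∂^{|k|} f / ∂t₁^{k₁} ⋯ ∂t_d^{k_d}` of a function on `ℝ^d`,
for a multi-index `k`. -/
def mixedDeriv (k : Fin d → ℕ) (f : (Fin d → ℝ) → ℝ) : (Fin d → ℝ) → ℝ :=
  (List.finRange d).foldr
    (fun i g => (fun (h : (Fin d → ℝ) → ℝ) t => lineDeriv ℝ h t (Pi.single i 1))^[k i] g) f

/-- The cumulant generating function `K(t) = - ∫ ln (1 - ⟨t, s⟩) ν(ds)` attached to a Thorin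
measure `ν`; it is used for `t` with nonpositive real parts only, where `1 - ⟨t, s⟩` has real
part at least `1` and the principal logarithm is the continuous branch. -/
def cgf (ν : Measure (Fin d → ℝ)) (t : Fin d → ℂ) : ℂ :=
  -∫ s, Complex.log (1 - ∑ i, t i * (s i : ℂ)) ∂ν

/-- `P` is the generalized Gamma convolution `𝒢_d(ν)` with Thorin measure `ν`: it is a
probability measure on `ℝ_+^d` whose cumulant generating function `ln E exp ⟨t, X⟩` is
`- ∫ ln (1 - ⟨t, s⟩) ν(ds)`, for all `t ∈ ℂ^d` with nonpositive real parts. -/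
structure IsGammaConvolution (P ν : Measure (Fin d → ℝ)) : Prop where
  isProbabilityMeasure : IsProbabilityMeasure P
  nonneg : ∀ᵐ x ∂P, 0 ≤ x
  thorin_nonneg : ∀ᵐ s ∂ν, 0 ≤ s
  integrable_log : ∀ t : Fin d → ℂ, (∀ i, (t i).re ≤ 0) →
    Integrable (fun s : Fin d → ℝ => Complex.log (1 - ∑ i, t i * (s i : ℂ))) ν
  laplace : ∀ t : Fin d → ℂ, (∀ i, (t i).re ≤ 0) →
    ∫ x, Complex.exp (∑ i, t i * (x i : ℂ)) ∂P = Complex.exp (cgf ν t)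

/-- `f` is a (Lebesgue) density of `𝒢_d(ν)`. -/
structure IsGammaConvolutionDensity (f : (Fin d → ℝ) → ℝ) (ν : Measure (Fin d → ℝ)) : Prop where
  aemeasurable : AEMeasurable f volume
  nonneg : ∀ᵐ x, 0 ≤ f x
  isGammaConvolution :
    IsGammaConvolution (volume.withDensity fun x => ENNReal.ofReal (f x)) ν

/-- The ray from the origin through `s`. -/
def ray (s : Fin d → ℝ) : Set (Fin d → ℝ) := {x | ∃ r : ℝ, 0 ≤ r ∧ x = r • s}

/-- Well-behaved Thorin measures: `ν = ∑ αᵢ δ_{sᵢ}` is finitely atomic of total mass at least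
`1`, and each family `(sᵢ)_{i ∈ J}` whose rays carry strictly more mass than the rays of the
complementary family has trivial kernel, as the matrix with rows `sᵢ`. Atoms sit at nonzero points
of `ℝ_+^d`, so that each of them determines a ray. -/
def IsWellBehaved (ν : Measure (Fin d → ℝ)) : Prop :=
  ∃ (n : ℕ) (α : Fin n → ℝ) (s : Fin n → Fin d → ℝ),
    (∀ i, 0 < α i) ∧ (∀ i, 0 ≤ s i ∧ s i ≠ 0) ∧
    ν = ∑ i, ENNReal.ofReal (α i) • Measure.dirac (s i) ∧
    1 ≤ ∑ i, α i ∧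
    ∀ J : Finset (Fin n),
      ν (⋃ i ∈ Jᶜ, ray (s i)) < ν (⋃ i ∈ J, ray (s i)) →
      ∀ x : Fin d → ℝ, (∀ i ∈ J, ∑ j, s i j * x j = 0) → x = 0

/-- The normalizing constant `(|k| - 1)!`, with value `1` at `k = 0`. -/
def thorinFactor (k : Fin d → ℕ) : ℝ := ((∑ i, k i - 1)! : ℕ)

/-- The Thorin moments `τ_k(ν) = K^{(k)}(-1) / (|k| - 1)!` of `𝒢_d(ν)`, for `k ∈ I`. -/
def thorinMoment (I : Finset (Fin d → ℕ)) (ν : Measure (Fin d → ℝ)) : I → ℝ := fun k =>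
  mixedDeriv k.1 (fun t => (cgf ν fun i => (t i : ℂ)).re) (-1) / thorinFactor k.1

/-- The function `B` that maps Thorin moments to shifted moments. If
`K(t) = ∑_{j ∈ I} τ_j (|j| - 1)! / j! (t + 1)^j`, then `B(τ)_k` is the `k`-th derivative
of `M = exp K` at `-1`; for `k` in the (downward closed) set `I`, indices outside `I` do not
contribute to this derivative. -/
def B (I : Finset (Fin d → ℕ)) (τ : I → ℝ) : I → ℝ := fun k =>
  mixedDeriv k.1
    (fun t => Real.exp (∑ j : I, τ j * thorinFactor j.1 / (∏ i, ((j.1 i)! : ℝ)) *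
      ∏ i, (t i + 1) ^ j.1 i)) (-1)

/-- The matrix `A` that maps shifted moments to Laguerre coefficients:
`a_k = √2^d ∑_{j ≤ k} binom(k, j) (-2)^{|j|} / j! μ_j`
(the binomial coefficients vanish unless `j ≤ k`). -/
def A (I : Finset (Fin d → ℕ)) : Matrix I I ℝ := Matrix.of fun k j =>
  √2 ^ d * (∏ i, ((k.1 i).choose (j.1 i) : ℝ)) * (-2) ^ (∑ i, j.1 i) / ∏ i, ((j.1 i)! : ℝ)

/-- The empirical shifted moments `N⁻¹ ∑ X_n^k exp (-|X_n|)` of a data set. -/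
def empiricalMoment (I : Finset (Fin d → ℕ)) {N : ℕ} (x : Fin N → Fin d → ℝ) : I → ℝ := fun k =>
  (N : ℝ)⁻¹ * ∑ n, (∏ i, x n i ^ k.1 i) * Real.exp (-∑ i, x n i)

/-- The empirical Thorin moments `B⁻¹` of the empirical shifted moments. (`B` is a bijection from
`ℝ^I` onto the vectors with positive entry at `0`.) -/
def empiricalThorinMoment (I : Finset (Fin d → ℕ)) {N : ℕ} (x : Fin N → Fin d → ℝ) : I → ℝ :=
  Function.invFun (B I) (empiricalMoment I x)

/-- The Jacobian of `τ ↦ A B(τ)` at the empirical Thorin moments. -/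
def jacobian (I : Finset (Fin d → ℕ)) {N : ℕ} (x : Fin N → Fin d → ℝ) : (I → ℝ) →L[ℝ] (I → ℝ) :=
  fderiv ℝ (fun τ => A I *ᵥ B I τ) (empiricalThorinMoment I x)

/-- The linearized loss `‖∇(X) (τ̂(X) - τ(ν))‖₂²`. -/
def linearizedLoss (I : Finset (Fin d → ℕ)) {N : ℕ} (x : Fin N → Fin d → ℝ)
    (ν : Measure (Fin d → ℝ)) : ℝ :=
  ∑ k, (jacobian I x (empiricalThorinMoment I x - thorinMoment I ν) k) ^ 2

/-- `ν` is a global minimizer of the linearized loss over the well-behaved Thorin measures. -/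
def IsGlobalMinimizer (I : Finset (Fin d → ℕ)) {N : ℕ} (x : Fin N → Fin d → ℝ)
    (ν : Measure (Fin d → ℝ)) : Prop :=
  IsWellBehaved ν ∧ ∀ ν', IsWellBehaved ν' → linearizedLoss I x ν ≤ linearizedLoss I x ν'

end Thorin

end

/-!
The estimator is controlled through its Thorin moments, and the density depends continuously on the
Thorin moments, at every well-behaved Thorin measure whose density is in `L²`.

*From data to Thorin moments.* Differentiation under the integral sign identifies
`B (thorinMoment I ν)` with the shifted moments of the law (`IsGammaConvolution.B_thorinMoment`), to
which the empirical moments converge by the strong law. On a downward closed index set `B` is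
injective with injective derivative, so `B⁻¹` is continuous by the inverse function theorem, and `A`
is triangular. Hence the Jacobian stays bounded below, while the loss at `ν` itself tends to `0`, so
the Thorin moments of any minimizer are close to those of `ν`
(`eventually_thorinMoment_minimizer`).

*From Thorin moments to measures.* In the coordinates `u = x / (1 + |x|)`, the Thorin moments of
positive order are the monomial moments of `ν`, and by Stone–Weierstrass they determine the limits
of `∑ a |u| G(u)` for every continuous `G` on the simplex. The Thorin moment of order `0` is the
total of `log (1 + |x|)`, up to the sign; its convergence excludes a loss of mass at the origin and
at infinity, which the characteristic functions would detect. So the characteristic functions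
converge pointwise (`ThorinTendsto.tendsto_sum_log`), and near each atom of `ν` at
least the mass of that atom is present in the limit (`ThorinTendsto.eventually_nearMass`).

*From measures to densities.* By Plancherel's identity it suffices that the characteristic
functions converge in `L²`, for which tightness of their squares
`exp (-logMod S a t) = ∏ (1 + ⟨x, t⟩²) ^ (-a x)` is needed. If the square of the characteristic
function of `ν` is integrable, then the mass outside the span of every independent set `b` of atoms
exceeds `(d - |b|) / 2` (`lt_massOffSpan`). This is a strict, finite set of inequalities, hence it
leaves room for a perturbation of size `ε`. The greedy algorithm (`exists_basis_mul_sum_le`) turns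
it into a bound by products over bases of atoms with exponents larger than `1 / 2`, and Jensen's
inequality makes the bound uniform over all measures with enough mass near the atoms of `ν`
(`lintegral_weight_mul_exp_neg_logMod_le`). Dominated convergence on balls concludes.

Every well-behaved measure has spanning atoms, so its gamma convolution is the image of a product of
gamma laws under a surjective linear map and has a density (`IsAtomic.exists_density`).
-/

noncomputable section

namespace Thorin

/-! ### Iterated directional derivatives -/

section DirectionalDerivatives

open Set
open scoped ContDiff

variable {W : Type*} [NormedAddCommGroup W] [NormedSpace ℝ W] {U : Set W} {f g : W → ℝ}
  {v w : W} {d : ℕ} {e : Fin d → W}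

/-- The directional derivative along `v`, as an operator on functions. -/
def dirDeriv (v : W) (f : W → ℝ) : W → ℝ := fun x => lineDeriv ℝ f x v

lemma dirDeriv_congr (hU : IsOpen U) (h : EqOn f g U) : EqOn (dirDeriv v f) (dirDeriv v g) U :=
  fun _ hx => (h.eventuallyEq_of_mem (hU.mem_nhds hx)).lineDeriv_eq

lemma differentiableAt_of_smooth (hU : IsOpen U) (hf : ContDiffOn ℝ ∞ f U) {x : W} (hx : x ∈ U) :
    DifferentiableAt ℝ f x :=
  (hf.contDiffAt (hU.mem_nhds hx)).differentiableAt (by simp)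

lemma dirDeriv_eq_fderiv (hU : IsOpen U) (hf : ContDiffOn ℝ ∞ f U) :
    EqOn (dirDeriv v f) (fun x => fderiv ℝ f x v) U :=
  fun _ hx => (differentiableAt_of_smooth hU hf hx).lineDeriv_eq_fderiv

lemma ContDiffOn.dirDeriv (hU : IsOpen U) (hf : ContDiffOn ℝ ∞ f U) :
    ContDiffOn ℝ ∞ (dirDeriv v f) U :=
  (((contDiffOn_infty_iff_fderiv_of_isOpen hU).1 hf).2.clm_apply contDiffOn_const).congr
    (dirDeriv_eq_fderiv hU hf)

lemma dirDeriv_comm (hU : IsOpen U) (hf : ContDiffOn ℝ ∞ f U) :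
    EqOn (dirDeriv v (dirDeriv w f)) (dirDeriv w (dirDeriv v f)) U := by
  have hd := ((contDiffOn_infty_iff_fderiv_of_isOpen hU).1 hf).2
  have key : ∀ v w : W, ∀ x ∈ U,
      dirDeriv v (dirDeriv w f) x = fderiv ℝ (fderiv ℝ f) x v w := by
    intro v w x hx
    rw [dirDeriv_congr hU (dirDeriv_eq_fderiv hU hf) hx, dirDeriv_eq_fderiv hU
      (hd.clm_apply contDiffOn_const) hx]
    have h1 : DifferentiableAt ℝ (fderiv ℝ f) x :=
      (hd.contDiffAt (hU.mem_nhds hx)).differentiableAt (by simp)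
    simp [fderiv_clm_apply h1 (differentiableAt_const w)]
  intro x hx
  rw [key v w x hx, key w v x hx]
  exact (hf.contDiffAt (hU.mem_nhds hx)).isSymmSndFDerivAt
    (by simp; exact WithTop.coe_le_coe.2 le_top) v w

lemma dirDeriv_mul (hU : IsOpen U) (hf : ContDiffOn ℝ ∞ f U) (hg : ContDiffOn ℝ ∞ g U) :
    EqOn (dirDeriv v (fun x => f x * g x))
      (fun x => dirDeriv v f x * g x + f x * dirDeriv v g x) U := by
  intro x hx
  rw [dirDeriv_eq_fderiv hU (hf.mul hg) hx]
  simp only [dirDeriv_eq_fderiv hU hf hx, dirDeriv_eq_fderiv hU hg hx]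
  rw [fderiv_fun_mul (differentiableAt_of_smooth hU hf hx) (differentiableAt_of_smooth hU hg hx)]
  simp only [add_apply, smul_apply, smul_eq_mul]
  ring

lemma dirDeriv_exp (hU : IsOpen U) (hf : ContDiffOn ℝ ∞ f U) :
    EqOn (dirDeriv v (fun x => Real.exp (f x)))
      (fun x => dirDeriv v f x * Real.exp (f x)) U := by
  intro x hx
  rw [dirDeriv_eq_fderiv hU hf.exp hx]
  simp only [dirDeriv_eq_fderiv hU hf hx]
  rw [fderiv_exp (differentiableAt_of_smooth hU hf hx)]
  simp only [smul_apply, smul_eq_mul]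
  ring

lemma dirDeriv_sum {ι : Type*} (hU : IsOpen U) {s : Finset ι} {c : ι → ℝ} {F : ι → W → ℝ}
    (hF : ∀ j ∈ s, ContDiffOn ℝ ∞ (F j) U) :
    EqOn (dirDeriv v (fun x => ∑ j ∈ s, c j * F j x))
      (fun x => ∑ j ∈ s, c j * dirDeriv v (F j) x) U := by
  intro x hx
  rw [dirDeriv_eq_fderiv hU (ContDiffOn.sum fun j hj => contDiffOn_const.mul (hF j hj)) hx]
  have hd := fun j hj => differentiableAt_of_smooth hU (hF j hj) hx
  beta_reduce
  rw [fderiv_fun_sum (fun j hj => (hd j hj).const_mul _)]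
  simp only [sum_apply]
  refine Finset.sum_congr rfl fun j hj => ?_
  rw [fderiv_const_mul (hd j hj), dirDeriv_eq_fderiv hU (hF j hj) hx]
  simp

/-- The iterated directional derivative `∏_{i ∈ l} ∂_{e i}^{k i}`, the head of `l` outermost. -/
def listDeriv (e : Fin d → W) (l : List (Fin d)) (k : Fin d → ℕ) (f : W → ℝ) : W → ℝ :=
  l.foldr (fun i g => (dirDeriv (e i))^[k i] g) f

lemma iterate_dirDeriv_congr (hU : IsOpen U) (n : ℕ) (h : EqOn f g U) :
    EqOn ((dirDeriv v)^[n] f) ((dirDeriv v)^[n] g) U := by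
  induction n with
  | zero => exact h
  | succ n ih => simp only [Function.iterate_succ_apply']; exact dirDeriv_congr hU ih

lemma ContDiffOn.iterate_dirDeriv (hU : IsOpen U) (n : ℕ) (hf : ContDiffOn ℝ ∞ f U) :
    ContDiffOn ℝ ∞ ((Thorin.dirDeriv v)^[n] f) U := by
  induction n with
  | zero => exact hf
  | succ n ih => simp only [Function.iterate_succ_apply']; exact ContDiffOn.dirDeriv hU ih

lemma dirDeriv_iterate_comm (hU : IsOpen U) (n : ℕ) (hf : ContDiffOn ℝ ∞ f U) :
    EqOn (dirDeriv v ((dirDeriv w)^[n] f)) ((dirDeriv w)^[n] (dirDeriv v f)) U := by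
  induction n with
  | zero => exact fun x _ => rfl
  | succ n ih =>
    simp only [Function.iterate_succ_apply']
    exact (dirDeriv_comm hU (ContDiffOn.iterate_dirDeriv hU n hf)).trans (dirDeriv_congr hU ih)

lemma listDeriv_congr (hU : IsOpen U) (l : List (Fin d)) (k : Fin d → ℕ) (h : EqOn f g U) :
    EqOn (listDeriv e l k f) (listDeriv e l k g) U := by
  induction l with
  | nil => exact h
  | cons i l ih => exact iterate_dirDeriv_congr hU (k i) ih

lemma ContDiffOn.listDeriv (hU : IsOpen U) (l : List (Fin d)) (k : Fin d → ℕ)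
    (hf : ContDiffOn ℝ ∞ f U) : ContDiffOn ℝ ∞ (listDeriv e l k f) U := by
  induction l with
  | nil => exact hf
  | cons i l ih => exact ContDiffOn.iterate_dirDeriv hU (k i) ih

lemma dirDeriv_listDeriv_comm (hU : IsOpen U) (l : List (Fin d)) (k : Fin d → ℕ)
    (hf : ContDiffOn ℝ ∞ f U) :
    EqOn (dirDeriv v (listDeriv e l k f)) (listDeriv e l k (dirDeriv v f)) U := by
  induction l with
  | nil => exact fun x _ => rfl
  | cons i l ih =>
    exact (dirDeriv_iterate_comm hU (k i) (ContDiffOn.listDeriv hU l k hf)).trans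
      (iterate_dirDeriv_congr hU (k i) ih)

lemma listDeriv_add_single_of_notMem {l : List (Fin d)} {i : Fin d} (hi : i ∉ l)
    (k : Fin d → ℕ) : listDeriv e l (k + Pi.single i 1) f = listDeriv e l k f := by
  induction l with
  | nil => rfl
  | cons a l ih =>
    simp only [List.mem_cons, not_or] at hi
    simp only [listDeriv, List.foldr_cons] at ih ⊢
    rw [ih hi.2]
    simp [Ne.symm hi.1]

lemma listDeriv_add_single {l : List (Fin d)} (hl : l.Nodup) {i : Fin d} (hi : i ∈ l)
    (hU : IsOpen U) (k : Fin d → ℕ) (hf : ContDiffOn ℝ ∞ f U) :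
    EqOn (listDeriv e l (k + Pi.single i 1) f) (listDeriv e l k (dirDeriv (e i) f)) U := by
  induction l with
  | nil => simp at hi
  | cons a l ih =>
    rw [List.nodup_cons] at hl
    by_cases hai : a = i
    · subst hai
      have h1 := listDeriv_add_single_of_notMem (e := e) (f := f) hl.1 k
      simp only [listDeriv, List.foldr_cons] at h1 ⊢
      rw [h1]
      simp only [Pi.add_apply, Pi.single_eq_same, Function.iterate_succ_apply]
      exact iterate_dirDeriv_congr hU _ (dirDeriv_listDeriv_comm hU l k hf)
    · have hil : i ∈ l := by simpa [Ne.symm hai] using hi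
      have h1 := ih hl.2 hil
      simp only [listDeriv, List.foldr_cons] at h1 ⊢
      have h2 : (k + Pi.single i 1 : Fin d → ℕ) a = k a := by simp [hai]
      rw [h2]
      exact iterate_dirDeriv_congr hU _ h1

/-- The iterated directional derivative `∏ᵢ ∂_{e i}^{k i}`. For the standard basis of `ℝ^d` this is
`mixedDeriv`. -/
def multiDeriv (e : Fin d → W) (k : Fin d → ℕ) (f : W → ℝ) : W → ℝ :=
  listDeriv e (List.finRange d) k f

lemma multiDeriv_congr (hU : IsOpen U) (k : Fin d → ℕ) (h : EqOn f g U) :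
    EqOn (multiDeriv e k f) (multiDeriv e k g) U := listDeriv_congr hU _ k h

lemma ContDiffOn.multiDeriv (hU : IsOpen U) (k : Fin d → ℕ) (hf : ContDiffOn ℝ ∞ f U) :
    ContDiffOn ℝ ∞ (multiDeriv e k f) U := ContDiffOn.listDeriv hU _ k hf

lemma dirDeriv_multiDeriv_comm (hU : IsOpen U) (k : Fin d → ℕ) (hf : ContDiffOn ℝ ∞ f U) :
    EqOn (dirDeriv v (multiDeriv e k f)) (multiDeriv e k (dirDeriv v f)) U :=
  dirDeriv_listDeriv_comm hU _ k hf

lemma multiDeriv_zero : multiDeriv e 0 f = f := by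
  have : ∀ l : List (Fin d), listDeriv e l 0 f = f := by
    intro l
    induction l with
    | nil => rfl
    | cons a l ih => exact ih
  exact this _

lemma multiDeriv_add_single (hU : IsOpen U) (k : Fin d → ℕ) (i : Fin d)
    (hf : ContDiffOn ℝ ∞ f U) :
    EqOn (multiDeriv e (k + Pi.single i 1) f) (multiDeriv e k (dirDeriv (e i) f)) U :=
  listDeriv_add_single (List.nodup_finRange d) (List.mem_finRange i) hU k hf

lemma multiDeriv_add_single' (hU : IsOpen U) (k : Fin d → ℕ) (i : Fin d)
    (hf : ContDiffOn ℝ ∞ f U) :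
    EqOn (multiDeriv e (k + Pi.single i 1) f) (dirDeriv (e i) (multiDeriv e k f)) U :=
  (multiDeriv_add_single hU k i hf).trans (dirDeriv_multiDeriv_comm hU k hf).symm

/-- Induction on a multi-index, one unit at a time. -/
lemma multiIndex_induction {p : (Fin d → ℕ) → Prop} (zero : p 0)
    (add_single : ∀ k i, p k → p (k + Pi.single i 1)) (k : Fin d → ℕ) : p k := by
  induction hn : ∑ i, k i generalizing k with
  | zero =>
    have : k = 0 := by
      ext i
      simpa using (Finset.sum_eq_zero_iff.1 hn) i (Finset.mem_univ i)
    exact this ▸ zero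
  | succ n ih =>
    obtain ⟨i, -, hi⟩ : ∃ i ∈ Finset.univ, k i ≠ 0 := by
      by_contra! h
      rw [Finset.sum_eq_zero h] at hn
      omega
    have hk : k = (k - Pi.single i 1) + Pi.single i 1 := by
      ext j
      by_cases hj : j = i
      · subst hj; simp; omega
      · simp [hj]
    rw [hk]
    refine add_single _ i (ih _ ?_)
    rw [hk] at hn
    simp only [Pi.add_apply, Finset.sum_add_distrib, Finset.sum_pi_single', Finset.mem_univ,
      if_true] at hn
    omega

lemma multiDeriv_sum {ι : Type*} (hU : IsOpen U) {s : Finset ι} {c : ι → ℝ} {F : ι → W → ℝ}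
    (hF : ∀ j ∈ s, ContDiffOn ℝ ∞ (F j) U) (k : Fin d → ℕ) :
    EqOn (multiDeriv e k (fun x => ∑ j ∈ s, c j * F j x))
      (fun x => ∑ j ∈ s, c j * multiDeriv e k (F j) x) U := by
  induction k using multiIndex_induction generalizing F with
  | zero => simp only [multiDeriv_zero]; exact fun x _ => rfl
  | add_single k i ih =>
    intro x hx
    rw [multiDeriv_add_single hU k i
        (ContDiffOn.sum fun j hj => contDiffOn_const.mul (hF j hj)) hx,
      multiDeriv_congr hU k (dirDeriv_sum hU hF) hx,
      ih (fun j hj => ContDiffOn.dirDeriv hU (hF j hj)) hx]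
    exact Finset.sum_congr rfl fun j hj => by rw [multiDeriv_add_single hU k i (hF j hj) hx]

lemma multiDeriv_add (hU : IsOpen U) (hf : ContDiffOn ℝ ∞ f U) (hg : ContDiffOn ℝ ∞ g U)
    (k : Fin d → ℕ) :
    EqOn (multiDeriv e k (fun x => f x + g x))
      (fun x => multiDeriv e k f x + multiDeriv e k g x) U := by
  have := multiDeriv_sum (e := e) hU (s := Finset.univ) (c := fun _ : Fin 2 => 1) (F := ![f, g])
    (by intro j _; fin_cases j <;> assumption) k
  simpa [Fin.sum_univ_two] using this

lemma multiDeriv_neg (hU : IsOpen U) (hf : ContDiffOn ℝ ∞ f U) (k : Fin d → ℕ) :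
    EqOn (multiDeriv e k (fun x => -f x)) (fun x => -multiDeriv e k f x) U := by
  have := multiDeriv_sum (e := e) hU (s := Finset.univ) (c := fun _ : Fin 1 => -1) (F := ![f])
    (by intro j _; fin_cases j; assumption) k
  simpa using this

/-- Agreement of the derivatives of order at most `k` at a point. On smooth functions this is
congruence modulo an ideal of germs. -/
def JetEq (e : Fin d → W) (x : W) (k : Fin d → ℕ) (f g : W → ℝ) : Prop :=
  ∀ j ≤ k, multiDeriv e j f x = multiDeriv e j g x

variable {x : W} {k : Fin d → ℕ}

lemma JetEq.mono {k' : Fin d → ℕ} (h : JetEq e x k f g) (hk : k' ≤ k) : JetEq e x k' f g :=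
  fun j hj => h j (hj.trans hk)

lemma JetEq.dirDeriv (hU : IsOpen U) (hx : x ∈ U) (hf : ContDiffOn ℝ ∞ f U)
    (hg : ContDiffOn ℝ ∞ g U) {i : Fin d} (h : JetEq e x (k + Pi.single i 1) f g) :
    JetEq e x k (dirDeriv (e i) f) (Thorin.dirDeriv (e i) g) := by
  intro j hj
  rw [← multiDeriv_add_single hU j i hf hx, ← multiDeriv_add_single hU j i hg hx]
  exact h _ (by gcongr)

lemma le_add_single (k : Fin d → ℕ) (i : Fin d) : k ≤ k + Pi.single i 1 :=
  le_add_of_nonneg_right (by simp)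

lemma JetEq.neg (hU : IsOpen U) (hx : x ∈ U) (hf : ContDiffOn ℝ ∞ f U)
    (hg : ContDiffOn ℝ ∞ g U) (h : JetEq e x k f g) :
    JetEq e x k (fun x => -f x) (fun x => -g x) := by
  intro j hj
  rw [multiDeriv_neg hU hf j hx, multiDeriv_neg hU hg j hx]
  exact congrArg Neg.neg (h j hj)

lemma JetEq.mul (hU : IsOpen U) (hx : x ∈ U) {f' g' : W → ℝ} (hf : ContDiffOn ℝ ∞ f U)
    (hg : ContDiffOn ℝ ∞ g U) (hf' : ContDiffOn ℝ ∞ f' U) (hg' : ContDiffOn ℝ ∞ g' U)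
    (h : JetEq e x k f f') (h' : JetEq e x k g g') :
    JetEq e x k (fun x => f x * g x) (fun x => f' x * g' x) := by
  suffices H : ∀ k : Fin d → ℕ, ∀ f g f' g' : W → ℝ, ContDiffOn ℝ ∞ f U → ContDiffOn ℝ ∞ g U →
      ContDiffOn ℝ ∞ f' U → ContDiffOn ℝ ∞ g' U → JetEq e x k f f' → JetEq e x k g g' →
      multiDeriv e k (fun x => f x * g x) x = multiDeriv e k (fun x => f' x * g' x) x from
    fun j hj => H j f g f' g' hf hg hf' hg' (h.mono hj) (h'.mono hj)
  clear * - hU hx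
  intro k
  induction k using multiIndex_induction with
  | zero =>
    intro f g f' g' _ _ _ _ h h'
    have h1 := h 0 le_rfl
    have h2 := h' 0 le_rfl
    simp only [multiDeriv_zero] at *
    rw [h1, h2]
  | add_single k i ih =>
    intro f g f' g' hf hg hf' hg' h h'
    have key : ∀ f g : W → ℝ, ContDiffOn ℝ ∞ f U → ContDiffOn ℝ ∞ g U →
        multiDeriv e (k + Pi.single i 1) (fun x => f x * g x) x =
        multiDeriv e k (fun x => Thorin.dirDeriv (e i) f x * g x) x +
        multiDeriv e k (fun x => f x * Thorin.dirDeriv (e i) g x) x := by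
      intro f g hf hg
      rw [multiDeriv_add_single hU k i (hf.mul hg) hx,
        multiDeriv_congr hU k (dirDeriv_mul hU hf hg) hx]
      exact multiDeriv_add hU ((ContDiffOn.dirDeriv hU hf).mul hg)
        (hf.mul (ContDiffOn.dirDeriv hU hg)) k hx
    rw [key f g hf hg, key f' g' hf' hg']
    have df := ContDiffOn.dirDeriv (v := e i) hU hf
    have dg := ContDiffOn.dirDeriv (v := e i) hU hg
    have df' := ContDiffOn.dirDeriv (v := e i) hU hf'
    have dg' := ContDiffOn.dirDeriv (v := e i) hU hg'
    rw [ih _ _ _ _ df hg df' hg' (h.dirDeriv hU hx hf hf') (h'.mono (le_add_single k i)),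
      ih _ _ _ _ hf dg hf' dg' (h.mono (le_add_single k i)) (h'.dirDeriv hU hx hg hg')]

/-- The jet of `exp f` depends only on the jet of `f`: `∂(exp f) = ∂f · exp f`, so derivatives of
higher order are determined by those of lower order. -/
lemma JetEq.exp (hU : IsOpen U) (hx : x ∈ U) (hf : ContDiffOn ℝ ∞ f U)
    (hg : ContDiffOn ℝ ∞ g U) (h : JetEq e x k f g) :
    JetEq e x k (fun x => Real.exp (f x)) (fun x => Real.exp (g x)) := by
  suffices H : ∀ k : Fin d → ℕ, JetEq e x k f g →
      multiDeriv e k (fun x => Real.exp (f x)) x = multiDeriv e k (fun x => Real.exp (g x)) x from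
    fun j hj => H j (h.mono hj)
  clear h
  intro m
  induction hn : ∑ i, m i using Nat.strong_induction_on generalizing m with
  | _ n ih =>
    intro h
    induction m using multiIndex_induction with
    | zero =>
      have h1 := h 0 le_rfl
      simp only [multiDeriv_zero] at *
      rw [h1]
    | add_single k i _ =>
      have lower : JetEq e x k (fun x => Real.exp (f x)) (fun x => Real.exp (g x)) := by
        intro j hj
        refine ih _ ?_ j rfl (h.mono (hj.trans (le_add_single k i)))
        rw [← hn]
        simp only [Pi.add_apply, Finset.sum_add_distrib, Finset.sum_pi_single', Finset.mem_univ,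
          if_true]
        exact Nat.lt_succ_of_le (Finset.sum_le_sum fun i _ => hj i)
      rw [multiDeriv_add_single hU k i hf.exp hx, multiDeriv_add_single hU k i hg.exp hx,
        multiDeriv_congr hU k (dirDeriv_exp hU hf) hx,
        multiDeriv_congr hU k (dirDeriv_exp hU hg) hx]
      exact (h.dirDeriv hU hx hf hg).mul hU hx (ContDiffOn.dirDeriv hU hf) hf.exp
        (ContDiffOn.dirDeriv hU hg) hg.exp lower k le_rfl

/-- The exponential is injective on jets: the derivatives of `f` are recovered from those of
`exp f` through `∂f = ∂(exp f) · exp (-f)`. -/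
lemma JetEq.of_exp (hU : IsOpen U) (hx : x ∈ U) (hf : ContDiffOn ℝ ∞ f U)
    (hg : ContDiffOn ℝ ∞ g U)
    (h : JetEq e x k (fun x => Real.exp (f x)) (fun x => Real.exp (g x))) : JetEq e x k f g := by
  suffices H : ∀ k : Fin d → ℕ, JetEq e x k (fun x => Real.exp (f x)) (fun x => Real.exp (g x)) →
      multiDeriv e k f x = multiDeriv e k g x from
    fun j hj => H j (h.mono hj)
  clear h
  intro m
  induction hn : ∑ i, m i using Nat.strong_induction_on generalizing m with
  | _ n ih =>
    intro h
    induction m using multiIndex_induction with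
    | zero =>
      have h1 := h 0 le_rfl
      simp only [multiDeriv_zero] at *
      exact Real.exp_injective h1
    | add_single k i _ =>
      have lower : JetEq e x k f g := by
        intro j hj
        refine ih _ ?_ j rfl (h.mono (hj.trans (le_add_single k i)))
        rw [← hn]
        simp only [Pi.add_apply, Finset.sum_add_distrib, Finset.sum_pi_single', Finset.mem_univ,
          if_true]
        exact Nat.lt_succ_of_le (Finset.sum_le_sum fun i _ => hj i)
      have key : ∀ f : W → ℝ, ContDiffOn ℝ ∞ f U → multiDeriv e (k + Pi.single i 1) f x =
          multiDeriv e k (fun x => Thorin.dirDeriv (e i) (fun x => Real.exp (f x)) x *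
            Real.exp (-f x)) x := by
        intro f hf
        rw [multiDeriv_add_single hU k i hf hx]
        refine multiDeriv_congr hU k (fun y hy => ?_) hx
        rw [dirDeriv_exp hU hf hy, mul_assoc, ← Real.exp_add]
        simp
      rw [key f hf, key g hg]
      exact (h.dirDeriv hU hx hf.exp hg.exp).mul hU hx (ContDiffOn.dirDeriv hU hf.exp) hf.neg.exp
        (ContDiffOn.dirDeriv hU hg.exp) hg.neg.exp
        ((lower.neg hU hx hf hg).exp hU hx hf.neg hg.neg) k le_rfl

end DirectionalDerivatives

/-! ### The map from Thorin moments to shifted moments -/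

section MomentMap

open Set
open scoped ContDiff

variable {d : ℕ}

lemma mixedDeriv_eq_multiDeriv (k : Fin d → ℕ) (f : (Fin d → ℝ) → ℝ) :
    mixedDeriv k f = multiDeriv (fun i => Pi.single i 1) k f := rfl

/-- The monomial `(t + 1)^j`, centred at `-1`. -/
def shiftedMonomial (j : Fin d → ℕ) (t : Fin d → ℝ) : ℝ := ∏ i, (t i + 1) ^ j i

lemma contDiff_shiftedMonomial (j : Fin d → ℕ) : ContDiff ℝ ∞ (shiftedMonomial j) := by
  unfold shiftedMonomial
  fun_prop

lemma dirDeriv_shiftedMonomial (i : Fin d) (j : Fin d → ℕ) :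
    dirDeriv (Pi.single i 1) (shiftedMonomial j) =
      fun t => (j i : ℝ) * shiftedMonomial (j - Pi.single i 1) t := by
  funext t
  have h : ∀ s : ℝ, shiftedMonomial j (t + s • Pi.single i 1) =
      (t i + s + 1) ^ j i * ∏ l ∈ Finset.univ.erase i, (t l + 1) ^ j l := by
    intro s
    rw [shiftedMonomial, ← Finset.mul_prod_erase _ _ (Finset.mem_univ i)]
    congr 1
    · simp
    · refine Finset.prod_congr rfl fun l hl => ?_
      simp [Finset.ne_of_mem_erase hl]
  have h' : shiftedMonomial (j - Pi.single i 1) t =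
      (t i + 1) ^ (j i - 1) * ∏ l ∈ Finset.univ.erase i, (t l + 1) ^ j l := by
    rw [shiftedMonomial, ← Finset.mul_prod_erase _ _ (Finset.mem_univ i)]
    congr 1
    · simp
    · refine Finset.prod_congr rfl fun l hl => ?_
      simp [Finset.ne_of_mem_erase hl]
  have hd : HasDerivAt (fun s : ℝ => (t i + s + 1) ^ j i)
      ((j i : ℝ) * (t i + 0 + 1) ^ (j i - 1) * 1) 0 :=
    (((hasDerivAt_id (0 : ℝ)).const_add (t i)).add_const 1).pow (j i)
  have := (hd.mul_const (∏ l ∈ Finset.univ.erase i, (t l + 1) ^ j l)).deriv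
  rw [dirDeriv, lineDeriv, funext h, this, h']
  ring

/-- The factorial `k! = ∏ k_i!` of a multi-index. -/
def multiFactorial (k : Fin d → ℕ) : ℝ := ∏ i, ((k i)! : ℝ)

lemma multiFactorial_pos (k : Fin d → ℕ) : 0 < multiFactorial k :=
  Finset.prod_pos fun i _ => by positivity

lemma multiFactorial_add_single (k : Fin d → ℕ) (i : Fin d) :
    multiFactorial (k + Pi.single i 1) = (k i + 1) * multiFactorial k := by
  simp only [multiFactorial]
  rw [← Finset.mul_prod_erase _ _ (Finset.mem_univ i),
    ← Finset.mul_prod_erase (a := i) _ (fun i => ((k i)! : ℝ)) (Finset.mem_univ i), ← mul_assoc]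
  congr 1
  · simp [Nat.factorial_succ]
  · refine Finset.prod_congr rfl fun l hl => ?_
    simp [Finset.ne_of_mem_erase hl]

lemma sub_single_add_single {k : Fin d → ℕ} {i : Fin d} (h : k i ≠ 0) :
    k - Pi.single i 1 + Pi.single i 1 = k := by
  ext l
  by_cases hl : l = i
  · subst hl; simp; omega
  · simp [hl]

lemma mixedDeriv_shiftedMonomial (k j : Fin d → ℕ) :
    mixedDeriv k (shiftedMonomial j) (-1) = if j = k then multiFactorial k else 0 := by
  rw [mixedDeriv_eq_multiDeriv]
  induction k using multiIndex_induction generalizing j with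
  | zero =>
    rw [multiDeriv_zero]
    split_ifs with h
    · simp [h, shiftedMonomial, multiFactorial]
    · obtain ⟨i, hi⟩ := Function.ne_iff.1 h
      exact Finset.prod_eq_zero (Finset.mem_univ i) (by simpa using hi)
  | add_single k i ih =>
    rw [multiDeriv_add_single isOpen_univ k i (contDiff_shiftedMonomial j).contDiffOn (mem_univ _),
      dirDeriv_shiftedMonomial]
    have := multiDeriv_sum (e := fun i : Fin d => Pi.single i (1 : ℝ)) isOpen_univ
      (s := (Finset.univ : Finset (Fin 1))) (c := fun _ => (j i : ℝ))
      (F := fun _ => shiftedMonomial (j - Pi.single i 1))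
      (fun _ _ => (contDiff_shiftedMonomial _).contDiffOn) k (mem_univ (-1))
    simp only [Finset.univ_unique, Finset.sum_singleton] at this
    rw [this, ih]
    by_cases hji : j i = 0
    · have : j ≠ k + Pi.single i 1 := fun h => by simp [h] at hji
      simp [hji, this]
    · have hiff : j - Pi.single i 1 = k ↔ j = k + Pi.single i 1 := by
        constructor
        · rintro rfl; exact (sub_single_add_single hji).symm
        · rintro rfl; simp
      simp only [hiff]
      split_ifs with h
      · rw [multiFactorial_add_single, h]; simp
      · simp

lemma thorinFactor_pos (k : Fin d → ℕ) : 0 < thorinFactor k := by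
  unfold thorinFactor; positivity

variable (I : Finset (Fin d → ℕ))

/-- The polynomial `∑_{j ∈ I} τ_j (|j| - 1)! / j! (t + 1)^j`. As a cumulant generating function, it
has the Thorin moments `τ`. -/
def cgfPoly (τ : I → ℝ) (t : Fin d → ℝ) : ℝ :=
  ∑ j : I, τ j * thorinFactor j.1 / (∏ i, ((j.1 i)! : ℝ)) * ∏ i, (t i + 1) ^ j.1 i

lemma contDiff_cgfPoly_uncurry :
    ContDiff ℝ ∞ fun p : (I → ℝ) × (Fin d → ℝ) => cgfPoly I p.1 p.2 := by
  unfold cgfPoly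
  fun_prop

lemma contDiff_cgfPoly (τ : I → ℝ) : ContDiff ℝ ∞ (cgfPoly I τ) := by
  unfold cgfPoly
  fun_prop

lemma mixedDeriv_cgfPoly (τ : I → ℝ) (k : I) :
    mixedDeriv k.1 (cgfPoly I τ) (-1) = τ k * thorinFactor k.1 := by
  have h := multiDeriv_sum (e := fun i : Fin d => Pi.single i (1 : ℝ)) isOpen_univ
      (s := (Finset.univ : Finset I)) (c := fun j => τ j * thorinFactor j.1 / multiFactorial j.1)
      (F := fun j => shiftedMonomial j.1)
      (fun _ _ => (contDiff_shiftedMonomial _).contDiffOn) k.1 (mem_univ (-1))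
  change multiDeriv _ k.1 (cgfPoly I τ) (-1) = _ at h
  rw [mixedDeriv_eq_multiDeriv, h]
  simp only [← mixedDeriv_eq_multiDeriv, mixedDeriv_shiftedMonomial]
  rw [Finset.sum_eq_single k]
  · simp [(multiFactorial_pos k.1).ne']
  · intro j _ hj
    rw [if_neg (fun h => hj (Subtype.ext h)), mul_zero]
  · simp

lemma B_apply (τ : I → ℝ) (k : I) :
    B I τ k = mixedDeriv k.1 (fun t => Real.exp (cgfPoly I τ t)) (-1) := rfl

variable {I}

/-- Shifted moments may be computed from any smooth cumulant generating function that has the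
prescribed derivatives at `-1`. -/
lemma B_eq_mixedDeriv_exp (hI : IsLowerSet (I : Set (Fin d → ℕ))) {U : Set (Fin d → ℝ)}
    (hU : IsOpen U) (h1 : -1 ∈ U) {f : (Fin d → ℝ) → ℝ} (hf : ContDiffOn ℝ ∞ f U) (k : I) :
    B I (fun k => mixedDeriv k.1 f (-1) / thorinFactor k.1) k =
      mixedDeriv k.1 (fun t => Real.exp (f t)) (-1) := by
  rw [B_apply]
  refine JetEq.exp (k := k.1) hU h1 (contDiff_cgfPoly I _).contDiffOn hf ?_ k.1 le_rfl
  intro j hj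
  have := mixedDeriv_cgfPoly I (fun k => mixedDeriv k.1 f (-1) / thorinFactor k.1)
    ⟨j, hI hj k.2⟩
  rw [div_mul_cancel₀ _ (thorinFactor_pos _).ne'] at this
  exact this

lemma eq_of_jetEq_cgfPoly {τ τ' : I → ℝ}
    (h : ∀ k : I, JetEq (fun i : Fin d => Pi.single i (1 : ℝ)) (-1) k.1
      (cgfPoly I τ) (cgfPoly I τ')) : τ = τ' := by
  funext k
  have h1 := mixedDeriv_cgfPoly I τ k
  have h2 := mixedDeriv_cgfPoly I τ' k
  have h3 := h k k.1 le_rfl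
  rw [← mixedDeriv_eq_multiDeriv, ← mixedDeriv_eq_multiDeriv, h1, h2] at h3
  exact mul_right_cancel₀ (thorinFactor_pos _).ne' h3

/-- `B` is injective because `exp` is injective on jets. The index set has to be downward closed for
its moments to determine jets. -/
lemma B_injective (hI : IsLowerSet (I : Set (Fin d → ℕ))) : Function.Injective (B I) := by
  intro τ τ' h
  refine eq_of_jetEq_cgfPoly fun k => JetEq.of_exp isOpen_univ (mem_univ _)
    (contDiff_cgfPoly I _).contDiffOn (contDiff_cgfPoly I _).contDiffOn fun j hj => ?_
  exact congrFun h ⟨j, hI hj k.2⟩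

/-- Derivatives in the second variable, computed on the product space. -/
lemma multiDeriv_prod_eq {E W : Type*} [NormedAddCommGroup E] [NormedSpace ℝ E]
    [NormedAddCommGroup W] [NormedSpace ℝ W] (e : Fin d → W) (k : Fin d → ℕ) (F : E × W → ℝ)
    (τ : E) : multiDeriv e k (fun t => F (τ, t)) =
      fun t => multiDeriv (fun i => ((0 : E), e i)) k F (τ, t) := by
  have step : ∀ (i : Fin d) (F : E × W → ℝ), dirDeriv (e i) (fun t => F (τ, t)) =
      fun t => dirDeriv ((0 : E), e i) F (τ, t) := by
    intro i F
    funext t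
    simp [dirDeriv, lineDeriv]
  have iter : ∀ (i : Fin d) (n : ℕ) (F : E × W → ℝ), (dirDeriv (e i))^[n] (fun t => F (τ, t)) =
      fun t => (dirDeriv ((0 : E), e i))^[n] F (τ, t) := by
    intro i n F
    induction n generalizing F with
    | zero => rfl
    | succ n ih => rw [Function.iterate_succ_apply, step, ih]; rfl
  suffices H : ∀ l : List (Fin d), listDeriv e l k (fun t => F (τ, t)) =
      fun t => listDeriv (fun i => ((0 : E), e i)) l k F (τ, t) from H _
  intro l
  induction l with
  | nil => rfl
  | cons i l ih =>
    simp only [listDeriv, List.foldr_cons] at ih ⊢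
    rw [ih, iter]

variable (I)

/-- `exp` of the polynomial cumulant generating function, as a function of the coefficients and the
argument jointly. -/
def expCgfPoly (p : (I → ℝ) × (Fin d → ℝ)) : ℝ := Real.exp (cgfPoly I p.1 p.2)

lemma contDiff_expCgfPoly : ContDiff ℝ ∞ (expCgfPoly I) := (contDiff_cgfPoly_uncurry I).exp

lemma B_eq_multiDeriv (τ : I → ℝ) (k : I) : B I τ k =
    multiDeriv (fun i => ((0 : I → ℝ), Pi.single i (1 : ℝ))) k.1 (expCgfPoly I) (τ, -1) :=
  congrFun (multiDeriv_prod_eq (fun i => Pi.single i (1 : ℝ)) k.1 (expCgfPoly I) τ) (-1)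

lemma contDiff_multiDeriv_expCgfPoly (k : Fin d → ℕ) : ContDiff ℝ ∞
    (multiDeriv (fun i => ((0 : I → ℝ), Pi.single i (1 : ℝ))) k (expCgfPoly I)) :=
  contDiffOn_univ.1 (ContDiffOn.multiDeriv isOpen_univ _ (contDiff_expCgfPoly I).contDiffOn)

lemma contDiff_B : ContDiff ℝ ∞ (B I) := by
  refine contDiff_pi.2 fun k => ?_
  simp only [B_eq_multiDeriv]
  exact (contDiff_multiDeriv_expCgfPoly I k.1).comp (contDiff_id.prodMk contDiff_const)

lemma cgfPoly_add_smul (τ v : I → ℝ) (s : ℝ) (t : Fin d → ℝ) :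
    cgfPoly I (τ + s • v) t = cgfPoly I τ t + s * cgfPoly I v t := by
  simp only [cgfPoly, Finset.mul_sum, ← Finset.sum_add_distrib]
  refine Finset.sum_congr rfl fun j _ => ?_
  simp only [Pi.add_apply, Pi.smul_apply, smul_eq_mul]
  ring

/-- The derivative of `B` in the direction `v` consists of the derivatives of
`M · ∂_v K`. -/
lemma fderiv_B_apply (τ v : I → ℝ) (k : I) : fderiv ℝ (B I) τ v k =
    mixedDeriv k.1 (fun t => cgfPoly I v t * Real.exp (cgfPoly I τ t)) (-1) := by
  have hd : DifferentiableAt ℝ (B I) τ := (contDiff_B I).differentiable (by simp) τ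
  have hline := (hd.hasFDerivAt.hasLineDerivAt v)
  rw [HasLineDerivAt] at hline
  have hk := (hasDerivAt_pi.1 hline k).deriv
  rw [← hk]
  have h1 : (fun s : ℝ => B I (τ + s • v) k) = fun s : ℝ =>
      multiDeriv (fun i => ((0 : I → ℝ), Pi.single i (1 : ℝ))) k.1 (expCgfPoly I)
        ((τ, -1) + s • (v, 0)) := by
    funext s
    rw [B_eq_multiDeriv]
    simp
  rw [h1]
  change dirDeriv (v, 0) _ (τ, -1) = _
  rw [dirDeriv_multiDeriv_comm isOpen_univ k.1 (contDiff_expCgfPoly I).contDiffOn (mem_univ _)]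
  have h2 : dirDeriv (v, 0) (expCgfPoly I) = fun p => cgfPoly I v p.2 * expCgfPoly I p := by
    funext p
    have h3 : (fun s : ℝ => expCgfPoly I (p + s • (v, 0))) =
        fun s : ℝ => Real.exp (cgfPoly I p.1 p.2 + s * cgfPoly I v p.2) := by
      funext s
      simp [expCgfPoly, cgfPoly_add_smul]
    have h4 : HasDerivAt (fun s : ℝ => Real.exp (cgfPoly I p.1 p.2 + s * cgfPoly I v p.2))
        (Real.exp (cgfPoly I p.1 p.2 + 0 * cgfPoly I v p.2) * (1 * cgfPoly I v p.2)) 0 :=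
      (((hasDerivAt_id (0 : ℝ)).mul_const _).const_add _).exp
    rw [dirDeriv, lineDeriv, h3, h4.deriv, expCgfPoly]
    ring_nf
  rw [h2]
  exact (congrFun (multiDeriv_prod_eq (fun i => Pi.single i (1 : ℝ)) k.1
    (fun p : (I → ℝ) × (Fin d → ℝ) => cgfPoly I v p.2 * expCgfPoly I p) τ) (-1)).symm

variable {I}

lemma multiDeriv_const_zero {W : Type*} [NormedAddCommGroup W] [NormedSpace ℝ W]
    (e : Fin d → W) (k : Fin d → ℕ) (x : W) : multiDeriv e k (fun _ => (0 : ℝ)) x = 0 := by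
  have := multiDeriv_sum (e := e) isOpen_univ (s := (∅ : Finset (Fin 0))) (c := fun _ => 0)
    (F := fun _ _ => 0) (by simp) k (mem_univ x)
  simpa using this

lemma cgfPoly_zero (t : Fin d → ℝ) : cgfPoly I 0 t = 0 := by simp [cgfPoly]

/-- If `∂_v K · exp K` has vanishing derivatives at `-1`, so has its product `∂_v K` with
`exp (-K)`, and `∂_v K` is the polynomial with coefficients `v`. -/
lemma fderiv_B_injective (hI : IsLowerSet (I : Set (Fin d → ℕ))) (τ : I → ℝ) :
    Function.Injective (fderiv ℝ (B I) τ) := by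
  refine (injective_iff_map_eq_zero _).2 fun v hv => ?_
  refine eq_of_jetEq_cgfPoly fun k => ?_
  have hv' : ContDiffOn ℝ ∞ (cgfPoly I v) univ := (contDiff_cgfPoly I v).contDiffOn
  have hτ : ContDiffOn ℝ ∞ (cgfPoly I τ) univ := (contDiff_cgfPoly I τ).contDiffOn
  have h0 : JetEq (fun i : Fin d => Pi.single i (1 : ℝ)) (-1) k.1
      (fun t => cgfPoly I v t * Real.exp (cgfPoly I τ t)) (fun _ => 0) := by
    intro j hj
    rw [multiDeriv_const_zero, ← mixedDeriv_eq_multiDeriv,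
      ← fderiv_B_apply I τ v ⟨j, hI hj k.2⟩, hv]
    rfl
  have := h0.mul isOpen_univ (mem_univ _) (g := fun t => Real.exp (-cgfPoly I τ t))
    (g' := fun t => Real.exp (-cgfPoly I τ t)) (hv'.mul hτ.exp) hτ.neg.exp contDiffOn_const
    hτ.neg.exp (fun _ _ => rfl)
  simp only [mul_assoc, ← Real.exp_add, add_neg_cancel, Real.exp_zero, mul_one, zero_mul] at this
  rw [funext cgfPoly_zero (f := cgfPoly I 0)]
  exact this

/-- `A` is triangular with nonzero diagonal entries. -/
lemma A_mulVec_injective (I : Finset (Fin d → ℕ)) :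
    Function.Injective fun v : I → ℝ => A I *ᵥ v := by
  intro v w hvw
  suffices H : ∀ n : ℕ, ∀ k : I, ∑ i, k.1 i = n → v k = w k from funext fun k => H _ k rfl
  intro n
  induction n using Nat.strong_induction_on with
  | _ n ih =>
    intro k hk
    have h := congrFun hvw k
    simp only [Matrix.mulVec, dotProduct] at h
    rw [← Finset.add_sum_erase _ _ (Finset.mem_univ k),
      ← Finset.add_sum_erase (a := k) _ (fun j => A I k j * w j) (Finset.mem_univ k)] at h
    have hrest : ∑ j ∈ Finset.univ.erase k, A I k j * v j =
        ∑ j ∈ Finset.univ.erase k, A I k j * w j := by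
      refine Finset.sum_congr rfl fun j hj => ?_
      by_cases hjk : j.1 ≤ k.1
      · have hlt : j.1 < k.1 :=
          lt_of_le_of_ne hjk fun h => Finset.ne_of_mem_erase hj (Subtype.ext h)
        rw [ih _ _ j rfl]
        rw [← hk]
        obtain ⟨i, hi⟩ := (Pi.lt_def.1 hlt).2
        exact Finset.sum_lt_sum (fun i _ => hjk i) ⟨i, Finset.mem_univ i, hi⟩
      · obtain ⟨i, hi⟩ : ∃ i, k.1 i < j.1 i := by
          by_contra! h
          exact hjk h
        have : A I k j = 0 := by
          simp only [A, Matrix.of_apply]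
          rw [Finset.prod_eq_zero (Finset.mem_univ i) (by simp [Nat.choose_eq_zero_of_lt hi])]
          simp
        simp [this]
    rw [hrest, add_left_inj] at h
    refine mul_left_cancel₀ ?_ h
    simp only [A, Matrix.of_apply, Nat.choose_self, Nat.cast_one, Finset.prod_const_one, mul_one]
    have := multiFactorial_pos k.1
    rw [multiFactorial] at this
    positivity

end MomentMap

/-! ### Finitely atomic Thorin measures and their Thorin moments -/

section Atomic

open Set
open scoped ContDiff

variable {d : ℕ}

/-- `ν = ∑_{x ∈ S} a x δ_x` with positive masses at distinct nonzero points of `ℝ_+^d` that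
span `ℝ^d`. -/
structure IsAtomic (ν : Measure (Fin d → ℝ)) (S : Finset (Fin d → ℝ)) (a : (Fin d → ℝ) → ℝ) :
    Prop where
  pos : ∀ x ∈ S, 0 < a x
  nonneg : ∀ x ∈ S, 0 ≤ x
  ne_zero : ∀ x ∈ S, x ≠ 0
  eq_sum : ν = ∑ x ∈ S, ENNReal.ofReal (a x) • Measure.dirac x
  span_eq_top : Submodule.span ℝ (S : Set (Fin d → ℝ)) = ⊤

lemma span_eq_top_of_forall_dotProduct {T : Set (Fin d → ℝ)}
    (h : ∀ y : Fin d → ℝ, (∀ x ∈ T, ∑ j, x j * y j = 0) → y = 0) : Submodule.span ℝ T = ⊤ := by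
  by_contra hne
  obtain ⟨f, hf, hle⟩ := Submodule.exists_le_ker_of_lt_top _ (lt_top_iff_ne_top.2 hne)
  have hfx : ∀ x, f x = ∑ j, x j * f (Pi.single j 1) := by
    intro x
    conv_lhs => rw [← Finset.univ_sum_single x, map_sum]
    refine Finset.sum_congr rfl fun j _ => ?_
    rw [← smul_eq_mul, ← map_smul]
    congr 1
    ext l
    by_cases hl : l = j
    · subst hl; simp
    · simp [hl]
  refine hf (LinearMap.ext fun x => ?_)
  have h0 := h (fun j => f (Pi.single j 1)) fun x hx => by
    rw [← hfx]
    exact hle (Submodule.subset_span hx)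
  rw [hfx]
  simp [fun j => congrFun h0 j]

/-- Atoms that coincide are merged. They span `ℝ^d` by the kernel condition for the family of all
atoms, whose rays carry the whole, positive, mass. -/
lemma IsWellBehaved.exists_isAtomic {ν : Measure (Fin d → ℝ)} (hν : IsWellBehaved ν) :
    ∃ S a, IsAtomic ν S a := by
  classical
  obtain ⟨n, α, s, hα, hs, rfl, h1, hJ⟩ := hν
  refine ⟨Finset.univ.image s, fun x => ∑ i with s i = x, α i, ⟨?_, ?_, ?_, ?_, ?_⟩⟩
  · intro x hx
    obtain ⟨i, -, rfl⟩ := Finset.mem_image.1 hx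
    exact Finset.sum_pos (fun j _ => hα j) ⟨i, by simp⟩
  · intro x hx
    obtain ⟨i, -, rfl⟩ := Finset.mem_image.1 hx
    exact (hs i).1
  · intro x hx
    obtain ⟨i, -, rfl⟩ := Finset.mem_image.1 hx
    exact (hs i).2
  · rw [← Finset.sum_fiberwise_of_maps_to (s := Finset.univ) (t := Finset.univ.image s) (g := s)
      (fun i hi => Finset.mem_image_of_mem s hi)]
    refine Finset.sum_congr rfl fun x _ => ?_
    rw [ENNReal.ofReal_sum_of_nonneg fun i _ => (hα i).le, Finset.sum_smul]
    refine Finset.sum_congr rfl fun i hi => ?_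
    rw [(Finset.mem_filter.1 hi).2]
  · refine span_eq_top_of_forall_dotProduct fun y hy => hJ Finset.univ ?_ y ?_
    · simp only [Finset.compl_univ, Finset.notMem_empty, iUnion_of_empty, iUnion_empty,
        measure_empty, Finset.mem_univ, iUnion_true]
      have hn : Nonempty (Fin n) := by
        by_contra hn
        rw [not_nonempty_iff] at hn
        simp at h1
        linarith
      obtain ⟨i⟩ := hn
      refine lt_of_lt_of_le (ENNReal.ofReal_pos.2 (hα i)) ?_
      have hmem : s i ∈ ⋃ i, ray (s i) := mem_iUnion.2 ⟨i, 1, zero_le_one, (one_smul _ _).symm⟩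
      calc ENNReal.ofReal (α i)
          = (ENNReal.ofReal (α i) • Measure.dirac (s i)) (⋃ i, ray (s i)) := by
            rw [Measure.smul_apply, Measure.dirac_apply_of_mem hmem]; simp
        _ ≤ _ := by
            rw [Measure.finsetSum_apply]
            exact Finset.single_le_sum
              (f := fun j => (ENNReal.ofReal (α j) • Measure.dirac (s j)) (⋃ i, ray (s i)))
              (fun _ _ => zero_le) (Finset.mem_univ i)
    · intro i _
      exact hy _ (Finset.mem_coe.2 (Finset.mem_image_of_mem s (Finset.mem_univ i)))

variable {ν : Measure (Fin d → ℝ)} {S : Finset (Fin d → ℝ)} {a : (Fin d → ℝ) → ℝ}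

lemma IsAtomic.integrable {E : Type*} [NormedAddCommGroup E] (h : IsAtomic ν S a)
    (g : (Fin d → ℝ) → E) : Integrable g ν := by
  rw [h.eq_sum]
  refine integrable_finsetSum_measure.2 fun x _ => ?_
  exact (integrable_dirac (by simp)).smul_measure ENNReal.ofReal_ne_top

lemma IsAtomic.integral_eq {E : Type*} [NormedAddCommGroup E] [NormedSpace ℝ E] [CompleteSpace E]
    (h : IsAtomic ν S a) (g : (Fin d → ℝ) → E) : ∫ x, g x ∂ν = ∑ x ∈ S, a x • g x := by
  rw [h.eq_sum, integral_finsetSum_measure fun x _ =>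
    (integrable_dirac (by simp)).smul_measure ENNReal.ofReal_ne_top]
  refine Finset.sum_congr rfl fun x hx => ?_
  rw [integral_smul_measure, integral_dirac, ENNReal.toReal_ofReal (h.pos x hx).le]

lemma IsAtomic.cgf_eq (h : IsAtomic ν S a) (t : Fin d → ℂ) :
    cgf ν t = -∑ x ∈ S, (a x : ℂ) * Complex.log (1 - ∑ i, t i * (x i : ℂ)) := by
  rw [cgf, h.integral_eq]
  simp

/-- The real cumulant generating function of an atomic Thorin measure. -/
def realCgf (S : Finset (Fin d → ℝ)) (a : (Fin d → ℝ) → ℝ) (t : Fin d → ℝ) : ℝ :=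
  -∑ x ∈ S, a x * Real.log (1 - ∑ i, t i * x i)

/-- The open negative orthant. -/
def negOrthant (d : ℕ) : Set (Fin d → ℝ) := {t | ∀ i, t i < 0}

lemma isOpen_negOrthant : IsOpen (negOrthant d) := by
  simp only [negOrthant, ← Set.iInter_ofPred]
  exact isOpen_iInter_of_finite fun i => isOpen_lt (continuous_apply i) continuous_const

lemma neg_one_mem_negOrthant : (-1 : Fin d → ℝ) ∈ negOrthant d := fun i => by simp

lemma one_sub_pos {t x : Fin d → ℝ} (ht : t ∈ negOrthant d) (hx : 0 ≤ x) :
    0 < 1 - ∑ i, t i * x i := by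
  have : ∑ i, t i * x i ≤ 0 :=
    Finset.sum_nonpos fun i _ => mul_nonpos_of_nonpos_of_nonneg (ht i).le (hx i)
  linarith

lemma IsAtomic.cgf_re (h : IsAtomic ν S a) (t : Fin d → ℝ) :
    (cgf ν fun i => (t i : ℂ)).re = realCgf S a t := by
  rw [h.cgf_eq, realCgf, Complex.neg_re, Complex.re_sum]
  congr 1
  refine Finset.sum_congr rfl fun x _ => ?_
  rw [Complex.re_ofReal_mul]
  congr 1
  have : (1 - ∑ i, (t i : ℂ) * (x i : ℂ)) = ((1 - ∑ i, t i * x i : ℝ) : ℂ) := by push_cast; rfl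
  rw [this, Complex.log_ofReal_re]

lemma contDiffOn_realCgf (hS : ∀ x ∈ S, 0 ≤ x) : ContDiffOn ℝ ∞ (realCgf S a) (negOrthant d) := by
  refine ContDiffOn.neg (ContDiffOn.sum fun x hx => contDiffOn_const.mul (ContDiffOn.log ?_ ?_))
  · fun_prop
  · exact fun t ht => (one_sub_pos ht (hS x hx)).ne'

lemma IsAtomic.thorinMoment_eq (h : IsAtomic ν S a) (I : Finset (Fin d → ℕ)) :
    thorinMoment I ν = fun k : I => mixedDeriv k.1 (realCgf S a) (-1) / thorinFactor k.1 := by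
  funext k
  rw [thorinMoment]
  simp only [h.cgf_re]

/-- The derivative of `1 - ⟨t, x⟩` along a coordinate axis. -/
lemma hasDerivAt_one_sub (t x : Fin d → ℝ) (i : Fin d) :
    HasDerivAt (fun s : ℝ => 1 - ∑ l, (t + s • (Pi.single i 1 : Fin d → ℝ)) l * x l) (-x i) 0 := by
  have h : (fun s : ℝ => 1 - ∑ l, (t + s • (Pi.single i 1 : Fin d → ℝ)) l * x l) =
      fun s : ℝ => (1 - ∑ l, t l * x l) - s * x i := by
    funext s
    simp only [Pi.add_apply, Pi.smul_apply, smul_eq_mul, add_mul, Finset.sum_add_distrib,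
      sub_add_eq_sub_sub]
    congr 1
    rw [Finset.sum_eq_single i]
    · simp
    · intro l _ hl; simp [hl]
    · simp
  rw [h]
  simpa using ((hasDerivAt_id (0 : ℝ)).mul_const (x i)).const_sub (1 - ∑ l, t l * x l)

/-- The derivatives of `K` of positive order, as explicit sums over the atoms. -/
lemma mixedDeriv_realCgf (hS : ∀ x ∈ S, 0 ≤ x) (k : Fin d → ℕ) (hk : k ≠ 0) :
    EqOn (mixedDeriv k (realCgf S a))
      (fun t => ∑ x ∈ S, a x * (thorinFactor k * (∏ i, x i ^ k i) /
        (1 - ∑ i, t i * x i) ^ (∑ i, k i))) (negOrthant d) := by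
  induction k using multiIndex_induction with
  | zero => exact absurd rfl hk
  | add_single k i ih =>
    intro t ht
    rw [mixedDeriv_eq_multiDeriv, multiDeriv_add_single' isOpen_negOrthant k i
      (contDiffOn_realCgf hS) ht]
    have hpos : ∀ x ∈ S, 1 - ∑ l, (t + (0 : ℝ) • (Pi.single i 1 : Fin d → ℝ)) l * x l ≠ 0 := by
      intro x hx
      simpa using (one_sub_pos ht (hS x hx)).ne'
    have hprod : ∀ x : Fin d → ℝ, ∏ l, x l ^ (k + Pi.single i 1 : Fin d → ℕ) l =
        x i * ∏ l, x l ^ k l := by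
      intro x
      simp only [Pi.add_apply, pow_add, Finset.prod_mul_distrib]
      rw [mul_comm,
        Finset.prod_eq_single (a := i) (f := fun l => x l ^ (Pi.single i 1 : Fin d → ℕ) l)]
      · simp
      · intro l _ hl; simp [hl]
      · simp
    have hsum : ∑ l, (k + Pi.single i 1 : Fin d → ℕ) l = ∑ l, k l + 1 := by
      simp [Finset.sum_add_distrib]
    by_cases hk0 : k = 0
    · subst hk0
      rw [multiDeriv_zero]
      have hd : HasDerivAt (fun s : ℝ => realCgf S a (t + s • Pi.single i 1)) (-∑ x ∈ S, a x *
          (-x i / (1 - ∑ l, (t + (0 : ℝ) • (Pi.single i 1 : Fin d → ℝ)) l * x l))) 0 :=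
        (HasDerivAt.fun_sum fun x hx =>
          ((hasDerivAt_one_sub t x i).log (hpos x hx)).const_mul (a x)).neg
      rw [dirDeriv, lineDeriv, hd.deriv, ← Finset.sum_neg_distrib]
      refine Finset.sum_congr rfl fun x _ => ?_
      rw [hprod, hsum]
      simp [thorinFactor]
      ring
    · have hn : ∑ l, k l ≠ 0 := by
        intro h
        refine hk0 (funext fun l => ?_)
        simpa using (Finset.sum_eq_zero_iff.1 h) l (Finset.mem_univ l)
      rw [← mixedDeriv_eq_multiDeriv, dirDeriv_congr isOpen_negOrthant (ih hk0) ht]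
      have hd : HasDerivAt (fun s : ℝ => ∑ x ∈ S, a x * (thorinFactor k * (∏ i, x i ^ k i) /
          (1 - ∑ l, (t + s • (Pi.single i 1 : Fin d → ℝ)) l * x l) ^ (∑ i, k i)))
          (∑ x ∈ S, a x * ((0 * (1 - ∑ l, (t + (0 : ℝ) • (Pi.single i 1 : Fin d → ℝ)) l * x l)
              ^ (∑ i, k i) - thorinFactor k * (∏ i, x i ^ k i) *
            (((∑ i, k i : ℕ) : ℝ) * (1 - ∑ l, (t + (0 : ℝ) • (Pi.single i 1 : Fin d → ℝ)) l * x l)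
              ^ (∑ i, k i - 1) * -x i)) /
          ((1 - ∑ l, (t + (0 : ℝ) • (Pi.single i 1 : Fin d → ℝ)) l * x l) ^ (∑ i, k i)) ^ 2)) 0 :=
        HasDerivAt.fun_sum fun x hx => ((hasDerivAt_const (0 : ℝ) _).div
          ((hasDerivAt_one_sub t x i).pow _) (pow_ne_zero _ (hpos x hx))).const_mul (a x)
      rw [dirDeriv, lineDeriv, hd.deriv]
      refine Finset.sum_congr rfl fun x hx => ?_
      have hpx := hpos x hx
      simp only [zero_smul, add_zero] at hpx ⊢
      rw [hprod, hsum]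
      obtain ⟨n, hn'⟩ := Nat.exists_eq_succ_of_ne_zero hn
      have hfac : thorinFactor (k + Pi.single i 1) = (n + 1 : ℝ) * thorinFactor k := by
        simp only [thorinFactor, hsum, hn']
        simp [Nat.factorial_succ]
      rw [hfac, hn']
      simp only [Nat.succ_eq_add_one, add_tsub_cancel_right]
      field_simp
      push_cast
      ring

/-- The Thorin moments of positive order are the moments of the atoms in the bounded coordinates
`x / (1 + |x|)`. -/
lemma IsAtomic.thorinMoment_apply (h : IsAtomic ν S a) {I : Finset (Fin d → ℕ)} (k : I)
    (hk : k.1 ≠ 0) : thorinMoment I ν k =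
      ∑ x ∈ S, a x * ∏ i, (x i / (1 + ∑ l, x l)) ^ k.1 i := by
  rw [h.thorinMoment_eq]
  simp only
  rw [mixedDeriv_realCgf h.nonneg k.1 hk neg_one_mem_negOrthant, Finset.sum_div]
  refine Finset.sum_congr rfl fun x _ => ?_
  have := (thorinFactor_pos k.1).ne'
  simp only [Pi.neg_apply, Pi.one_apply, neg_mul, one_mul, Finset.sum_neg_distrib, sub_neg_eq_add,
    div_pow, Finset.prod_div_distrib, Finset.prod_pow_eq_pow_sum]
  field_simp

lemma IsAtomic.thorinMoment_zero (h : IsAtomic ν S a) {I : Finset (Fin d → ℕ)} (k : I)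
    (hk : k.1 = 0) : thorinMoment I ν k = -∑ x ∈ S, a x * Real.log (1 + ∑ l, x l) := by
  rw [h.thorinMoment_eq]
  simp only [hk, mixedDeriv_eq_multiDeriv, multiDeriv_zero, realCgf]
  simp [thorinFactor]

end Atomic

/-! ### Shifted moments of a gamma convolution -/

section ShiftedMoments

open Set
open scoped ContDiff

variable {d : ℕ}

/-- The function `x^k e^{⟨t, x⟩}`, whose integral is the `k`-th derivative of the moment generating
function at `t`. -/
def expMonomial (k : Fin d → ℕ) (t x : Fin d → ℝ) : ℝ :=
  (∏ i, x i ^ k i) * Real.exp (∑ i, t i * x i)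

lemma measurable_expMonomial (k : Fin d → ℕ) (t : Fin d → ℝ) : Measurable (expMonomial k t) := by
  have : Continuous (expMonomial k t) := by unfold expMonomial; fun_prop
  exact this.measurable

lemma expMonomial_nonneg {x : Fin d → ℝ} (hx : 0 ≤ x) (k : Fin d → ℕ) (t : Fin d → ℝ) :
    0 ≤ expMonomial k t x :=
  mul_nonneg (Finset.prod_nonneg fun i _ => pow_nonneg (hx i) _) (Real.exp_nonneg _)

lemma integrable_expMonomial {P : Measure (Fin d → ℝ)} [IsFiniteMeasure P]
    (hP : ∀ᵐ x ∂P, 0 ≤ x) (k : Fin d → ℕ) {t : Fin d → ℝ} (ht : t ∈ negOrthant d) :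
    Integrable (expMonomial k t) P := by
  refine Integrable.of_bound (measurable_expMonomial k t).aestronglyMeasurable
    (∏ i, ((k i)! / (-t i) ^ k i : ℝ)) ?_
  filter_upwards [hP] with x hx
  rw [Real.norm_of_nonneg (expMonomial_nonneg hx k t), expMonomial, Real.exp_sum,
    ← Finset.prod_mul_distrib]
  refine Finset.prod_le_prod (fun i _ => mul_nonneg (pow_nonneg (hx i) _) (Real.exp_nonneg _))
    fun i _ => ?_
  have hti : 0 < -t i := neg_pos.2 (ht i)
  have h := Real.pow_div_factorial_le_exp (x := -t i * x i) (mul_nonneg hti.le (hx i)) (k i)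
  have hfac : (0 : ℝ) < (k i)! := by positivity
  have he : Real.exp (t i * x i) = (Real.exp (-t i * x i))⁻¹ := by rw [← Real.exp_neg]; ring_nf
  rw [he, ← div_eq_mul_inv, div_le_div_iff₀ (Real.exp_pos _) (pow_pos hti _), ← mul_pow]
  rw [div_le_iff₀ hfac] at h
  calc (x i * -t i) ^ k i = (-t i * x i) ^ k i := by ring
    _ ≤ _ := h
    _ = _ := mul_comm _ _

lemma expMonomial_add_single (k : Fin d → ℕ) (i : Fin d) (t x : Fin d → ℝ) :
    expMonomial (k + Pi.single i 1) t x = x i * expMonomial k t x := by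
  simp only [expMonomial, Pi.add_apply, pow_add, Finset.prod_mul_distrib]
  rw [Finset.prod_eq_single (a := i) (f := fun l => x l ^ (Pi.single i 1 : Fin d → ℕ) l)]
  · simp; ring
  · intro l _ hl; simp [hl]
  · simp

lemma sum_add_smul_single_mul (t x : Fin d → ℝ) (i : Fin d) (s : ℝ) :
    ∑ l, (t + s • (Pi.single i 1 : Fin d → ℝ)) l * x l = ∑ l, t l * x l + s * x i := by
  simp only [Pi.add_apply, Pi.smul_apply, smul_eq_mul, add_mul, Finset.sum_add_distrib]
  congr 1
  rw [Finset.sum_eq_single i]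
  · simp
  · intro l _ hl; simp [hl]
  · simp

/-- Differentiation under the integral sign. The integrands increase with `t`, so near `t` they are
dominated by the integrand at a slightly larger point of the orthant. -/
lemma dirDeriv_integral_expMonomial {P : Measure (Fin d → ℝ)} [IsFiniteMeasure P]
    (hP : ∀ᵐ x ∂P, 0 ≤ x) (k : Fin d → ℕ) (i : Fin d) :
    EqOn (dirDeriv (Pi.single i 1) fun t => ∫ x, expMonomial k t x ∂P)
      (fun t => ∫ x, expMonomial (k + Pi.single i 1) t x ∂P) (negOrthant d) := by
  intro t ht
  obtain ⟨ε, hε0, hε⟩ : ∃ ε > 0, t i + ε < 0 := ⟨-t i / 2, by have := ht i; linarith,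
    by have := ht i; linarith⟩
  have ht' : t + ε • (Pi.single i 1 : Fin d → ℝ) ∈ negOrthant d := by
    intro l
    have := ht l
    by_cases hl : l = i
    · subst hl
      simpa using hε
    · simpa [hl] using this
  have hbound : ∀ᵐ x ∂P, ∀ s ∈ Iio ε,
      ‖expMonomial (k + Pi.single i 1) (t + s • (Pi.single i 1 : Fin d → ℝ)) x‖ ≤
        expMonomial (k + Pi.single i 1) (t + ε • (Pi.single i 1 : Fin d → ℝ)) x := by
    filter_upwards [hP] with x hx s hs
    rw [Real.norm_of_nonneg (expMonomial_nonneg hx _ _)]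
    refine mul_le_mul_of_nonneg_left (Real.exp_le_exp.2 ?_)
      (Finset.prod_nonneg fun i _ => pow_nonneg (hx i) _)
    rw [sum_add_smul_single_mul, sum_add_smul_single_mul]
    have := mul_le_mul_of_nonneg_right (le_of_lt hs) (hx i)
    linarith
  have hdiff : ∀ x : Fin d → ℝ, ∀ s : ℝ,
      HasDerivAt (fun s => expMonomial k (t + s • (Pi.single i 1 : Fin d → ℝ)) x)
        (expMonomial (k + Pi.single i 1) (t + s • (Pi.single i 1 : Fin d → ℝ)) x) s := by
    intro x s
    rw [expMonomial_add_single]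
    simp only [expMonomial, sum_add_smul_single_mul]
    have hd : HasDerivAt (fun s : ℝ => ∑ l, t l * x l + s * x i) (1 * x i) s :=
      ((hasDerivAt_id s).mul_const (x i)).const_add _
    have h := hd.exp.const_mul (∏ i, x i ^ k i)
    rwa [one_mul, mul_comm _ (x i), mul_left_comm] at h
  have hint : Integrable (expMonomial k (t + (0 : ℝ) • (Pi.single i 1 : Fin d → ℝ))) P := by
    rw [zero_smul, add_zero]
    exact integrable_expMonomial hP k ht
  have h := (hasDerivAt_integral_of_dominated_loc_of_deriv_le
    (F := fun s x => expMonomial k (t + s • (Pi.single i 1 : Fin d → ℝ)) x) (Iio_mem_nhds hε0)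
    (Eventually.of_forall fun s => (measurable_expMonomial _ _).aestronglyMeasurable)
    hint (measurable_expMonomial _ _).aestronglyMeasurable hbound
    (integrable_expMonomial hP _ ht') (Eventually.of_forall fun x s _ => hdiff x s)).2.deriv
  rw [zero_smul, add_zero] at h
  exact h

variable {ν P : Measure (Fin d → ℝ)} {S : Finset (Fin d → ℝ)} {a : (Fin d → ℝ) → ℝ}

lemma IsGammaConvolution.integral_exp (h : IsGammaConvolution P ν) (hν : IsAtomic ν S a) :
    EqOn (fun t => ∫ x, expMonomial 0 t x ∂P) (fun t => Real.exp (realCgf S a t))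
      (negOrthant d) := by
  intro t ht
  have h1 := h.laplace (fun i => (t i : ℂ)) fun i => by simpa using (ht i).le
  have h2 : ∀ x : Fin d → ℝ, Complex.exp (∑ i, (t i : ℂ) * (x i : ℂ)) =
      ((expMonomial 0 t x : ℝ) : ℂ) := by
    intro x
    simp [expMonomial]
  have h3 : cgf ν (fun i => (t i : ℂ)) = ((realCgf S a t : ℝ) : ℂ) := by
    rw [hν.cgf_eq, realCgf]
    push_cast
    congr 1
    refine Finset.sum_congr rfl fun x hx => ?_
    congr 1
    rw [Complex.ofReal_log (one_sub_pos ht (hν.nonneg x hx)).le]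
    push_cast
    rfl
  simp only [h2] at h1
  rw [integral_complex_ofReal, h3, ← Complex.ofReal_exp] at h1
  exact Complex.ofReal_injective h1

lemma IsGammaConvolution.mixedDeriv_exp_realCgf (h : IsGammaConvolution P ν)
    (hν : IsAtomic ν S a) (k : Fin d → ℕ) :
    EqOn (mixedDeriv k fun t => Real.exp (realCgf S a t)) (fun t => ∫ x, expMonomial k t x ∂P)
      (negOrthant d) := by
  have := h.isProbabilityMeasure
  induction k using multiIndex_induction with
  | zero => rw [mixedDeriv_eq_multiDeriv, multiDeriv_zero]; exact (h.integral_exp hν).symm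
  | add_single k i ih =>
    exact ((multiDeriv_add_single' isOpen_negOrthant k i (contDiffOn_realCgf hν.nonneg).exp).trans
      (dirDeriv_congr isOpen_negOrthant ih)).trans (dirDeriv_integral_expMonomial h.nonneg k i)

/-- `B` maps the Thorin moments of a gamma convolution to its shifted moments. -/
lemma IsGammaConvolution.B_thorinMoment (h : IsGammaConvolution P ν) (hν : IsAtomic ν S a)
    {I : Finset (Fin d → ℕ)} (hI : IsLowerSet (I : Set (Fin d → ℕ))) :
    B I (thorinMoment I ν) = fun k => ∫ x, expMonomial k.1 (-1) x ∂P := by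
  funext k
  rw [hν.thorinMoment_eq, B_eq_mixedDeriv_exp hI isOpen_negOrthant neg_one_mem_negOrthant
    (contDiffOn_realCgf hν.nonneg), h.mixedDeriv_exp_realCgf hν k.1 neg_one_mem_negOrthant]

end ShiftedMoments

/-! ### Minimizers of the linearized loss have convergent Thorin moments -/

section Loss

open scoped ContDiff

variable {d : ℕ} {I : Finset (Fin d → ℕ)}

lemma contDiff_A_mulVec_B (I : Finset (Fin d → ℕ)) : ContDiff ℝ ∞ fun τ => A I *ᵥ B I τ :=
  (Matrix.mulVecLin (A I)).toContinuousLinearMap.contDiff.comp (contDiff_B I)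

lemma fderiv_A_mulVec_B_injective (hI : IsLowerSet (I : Set (Fin d → ℕ))) (τ : I → ℝ) :
    Function.Injective (fderiv ℝ (fun τ => A I *ᵥ B I τ) τ) := by
  have h := ((Matrix.mulVecLin (A I)).toContinuousLinearMap.hasFDerivAt (x := B I τ)).comp τ
    ((contDiff_B I).differentiable (by simp) τ).hasFDerivAt
  have h' : fderiv ℝ (fun τ => A I *ᵥ B I τ) τ =
    (Matrix.mulVecLin (A I)).toContinuousLinearMap.comp (fderiv ℝ (B I) τ) := h.fderiv
  rw [h']
  exact (A_mulVec_injective I).comp (fderiv_B_injective hI τ)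

/-- `B⁻¹` is continuous on the image of `B`, by the inverse function theorem. -/
lemma tendsto_invFun_B (hI : IsLowerSet (I : Set (Fin d → ℕ))) (τ : I → ℝ) :
    Tendsto (Function.invFun (B I)) (𝓝 (B I τ)) (𝓝 τ) := by
  have hs : HasStrictFDerivAt (B I) (fderiv ℝ (B I) τ) τ :=
    (contDiff_B I).contDiffAt.hasStrictFDerivAt (by simp)
  have hinj := fderiv_B_injective hI τ
  have hker : (fderiv ℝ (B I) τ).ker = ⊥ := LinearMap.ker_eq_bot.2 hinj
  have hrange : (fderiv ℝ (B I) τ).range = ⊤ :=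
    LinearMap.range_eq_top.2 (LinearMap.surjective_of_injective hinj)
  have hs' : HasStrictFDerivAt (B I)
      (ContinuousLinearEquiv.ofBijective (fderiv ℝ (B I) τ) hker hrange :
        (I → ℝ) →L[ℝ] (I → ℝ)) τ := by
    exact hs
  rw [← hs'.map_nhds_eq_of_equiv, tendsto_map'_iff]
  rw [show Function.invFun (B I) ∘ B I = id from
    (Function.leftInverse_invFun (B_injective hI)).comp_eq_id]
  exact tendsto_id

/-- If the empirical moments are close to those with Thorin moments `τ(ν)`, then every global
minimizer of the linearized loss has Thorin moments close to `τ(ν)`: the loss at `ν` is small,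
and the Jacobian stays bounded below. -/
lemma eventually_thorinMoment_minimizer (hI : IsLowerSet (I : Set (Fin d → ℕ)))
    {ν : Measure (Fin d → ℝ)} (hν : IsWellBehaved ν) {δ : ℝ} (hδ : 0 < δ) :
    ∀ᶠ y in 𝓝 (B I (thorinMoment I ν)), ∀ (N : ℕ) (x : Fin N → Fin d → ℝ),
      empiricalMoment I x = y → ∀ ν', IsGlobalMinimizer I x ν' →
        ∀ k : I, |thorinMoment I ν' k - thorinMoment I ν k| < δ := by
  set τ₀ := thorinMoment I ν with hτ₀
  set J : (I → ℝ) → ((I → ℝ) →L[ℝ] (I → ℝ)) := fderiv ℝ (fun τ => A I *ᵥ B I τ) with hJ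
  have hJc : Continuous J := (contDiff_A_mulVec_B I).continuous_fderiv (by simp)
  obtain ⟨K, hK0, hK⟩ := LinearMap.exists_antilipschitzWith (J τ₀ : (I → ℝ) →ₗ[ℝ] (I → ℝ))
    (LinearMap.ker_eq_bot.2 (fderiv_A_mulVec_B_injective hI τ₀))
  have hK0' : (0 : ℝ) < K := hK0
  set c : ℝ := (K : ℝ)⁻¹ with hc
  have hc0 : 0 < c := inv_pos.2 hK0'
  have hlow : ∀ v, c * ‖v‖ ≤ ‖J τ₀ v‖ := by
    intro v
    have h1 := hK.le_mul_dist v 0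
    simp only [dist_zero_right, ContinuousLinearMap.coe_coe, map_zero] at h1
    rw [hc, inv_mul_le_iff₀ hK0']
    exact h1
  have hev1 : ∀ᶠ τ in 𝓝 τ₀, ‖J τ - J τ₀‖ < c / 2 := by
    have h : Tendsto (fun τ => ‖J τ - J τ₀‖) (𝓝 τ₀) (𝓝 ‖J τ₀ - J τ₀‖) :=
      (hJc.sub continuous_const).norm.tendsto τ₀
    rw [sub_self, norm_zero] at h
    exact h.eventually_lt_const (by positivity)
  have hev2 : ∀ᶠ τ in 𝓝 τ₀, ∑ k, (J τ (τ - τ₀) k) ^ 2 < (c / 2 * (δ / 2)) ^ 2 := by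
    have hcont : Continuous fun τ => ∑ k, (J τ (τ - τ₀) k) ^ 2 := by
      refine continuous_finsetSum _ fun k _ => ?_
      exact ((continuous_apply k).comp (hJc.clm_apply (continuous_id.sub continuous_const))).pow 2
    have h := hcont.tendsto τ₀
    simp only [sub_self, map_zero, Pi.zero_apply] at h
    refine h.eventually_lt_const ?_
    simp only [ne_eq, OfNat.ofNat_ne_zero, not_false_eq_true, zero_pow, Finset.sum_const_zero]
    positivity
  have hev3 : ∀ᶠ τ in 𝓝 τ₀, ‖τ - τ₀‖ < δ / 2 := by
    have h : Tendsto (fun τ => ‖τ - τ₀‖) (𝓝 τ₀) (𝓝 ‖τ₀ - τ₀‖) :=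
      (continuous_id.sub continuous_const).norm.tendsto τ₀
    rw [sub_self, norm_zero] at h
    exact h.eventually_lt_const (by positivity)
  filter_upwards [(tendsto_invFun_B hI τ₀).eventually (hev1.and (hev2.and hev3))]
  rintro y ⟨h1, h2, h3⟩ N x rfl ν' hν' k
  have hle := hν'.2 ν hν
  simp only [linearizedLoss, jacobian, ← hJ] at hle
  change ∑ k, (J (empiricalThorinMoment I x) _ k) ^ 2 < _ at h2
  change ‖J (empiricalThorinMoment I x) - _‖ < _ at h1
  change ‖empiricalThorinMoment I x - _‖ < _ at h3
  set τ := empiricalThorinMoment I x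
  -- the sup norm is dominated by the Euclidean one
  have hsq : ∀ w : I → ℝ, ‖w‖ ^ 2 ≤ ∑ k, w k ^ 2 := by
    intro w
    rw [← Real.sqrt_le_sqrt_iff (Finset.sum_nonneg fun _ _ => sq_nonneg _),
      Real.sqrt_sq (norm_nonneg _)]
    refine (pi_norm_le_iff_of_nonneg (Real.sqrt_nonneg _)).2 fun k => Real.le_sqrt_of_sq_le ?_
    rw [Real.norm_eq_abs, sq_abs]
    exact Finset.single_le_sum (f := fun k => w k ^ 2) (fun _ _ => sq_nonneg _) (Finset.mem_univ k)
  -- near `τ₀` the Jacobian inherits the lower bound `c` up to a factor `2`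
  have hlow' : c / 2 * ‖τ - thorinMoment I ν'‖ ≤ ‖J τ (τ - thorinMoment I ν')‖ := by
    set v := τ - thorinMoment I ν'
    have h4 := hlow v
    have h5 : ‖(J τ - J τ₀) v‖ ≤ c / 2 * ‖v‖ :=
      ((J τ - J τ₀).le_opNorm v).trans (by gcongr)
    have h6 : ‖J τ₀ v‖ ≤ ‖J τ v‖ + ‖(J τ - J τ₀) v‖ := by
      have : J τ₀ v = J τ v - (J τ - J τ₀) v := by simp
      rw [this]
      exact norm_sub_le _ _
    linarith
  have hfin : ‖τ - thorinMoment I ν'‖ < δ / 2 := by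
    have h7 : (c / 2 * ‖τ - thorinMoment I ν'‖) ^ 2 < (c / 2 * (δ / 2)) ^ 2 :=
      calc _ ≤ ‖J τ (τ - thorinMoment I ν')‖ ^ 2 := by gcongr
        _ ≤ _ := hsq _
        _ ≤ _ := hle
        _ < _ := h2
    have h8 := lt_of_pow_lt_pow_left₀ 2 (by positivity) h7
    exact lt_of_mul_lt_mul_left h8 (by positivity)
  calc |thorinMoment I ν' k - τ₀ k|
      ≤ ‖thorinMoment I ν' - τ₀‖ := by
        rw [← Pi.sub_apply, ← Real.norm_eq_abs]; exact norm_le_pi_norm _ k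
    _ = ‖(τ - τ₀) - (τ - thorinMoment I ν')‖ := by congr 1; abel
    _ ≤ ‖τ - τ₀‖ + ‖τ - thorinMoment I ν'‖ := norm_sub_le _ _
    _ < δ := by linarith

end Loss

/-! ### Gamma convolutions with spanning atomic Thorin measure have a density -/

section Density

open Set

lemma mgf_gammaMeasure {α r : ℝ} (hα : 0 < α) (hr : r < 1) :
    mgf id (gammaMeasure α 1) r = Real.exp (-(α * Real.log (1 - r))) := by
  have hr' : 0 < 1 - r := by linarith
  have h1 : mgf id (gammaMeasure α 1) r = ∫ x, gammaPDFReal α 1 x * Real.exp (r * x) := by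
    rw [mgf, gammaMeasure, integral_withDensity_eq_integral_toReal_smul]
    · refine integral_congr_ae (Eventually.of_forall fun x => ?_)
      simp only [gammaPDF, id, smul_eq_mul]
      rw [ENNReal.toReal_ofReal (gammaPDFReal_nonneg hα one_pos x)]
    · exact (measurable_gammaPDFReal α 1).ennreal_ofReal
    · exact Eventually.of_forall fun x => by simp [gammaPDF]
  have h2 : ∫ x, gammaPDFReal α 1 x * Real.exp (r * x) =
      ∫ x in Ioi 0, (Real.Gamma α)⁻¹ * (x ^ (α - 1) * Real.exp (-((1 - r) * x))) := by
    rw [← integral_indicator measurableSet_Ioi]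
    refine integral_congr_ae ?_
    filter_upwards [compl_mem_ae_iff.2 (measure_singleton (0 : ℝ))] with x hx
    by_cases hx0 : 0 < x
    · rw [indicator_of_mem (mem_Ioi.2 hx0), gammaPDFReal, if_pos hx0.le,
        show -((1 - r) * x) = -(1 * x) + r * x by ring, Real.exp_add]
      simp
      ring
    · rw [indicator_of_notMem (by simpa using hx0), gammaPDFReal, if_neg, zero_mul]
      exact fun h => hx (le_antisymm (not_lt.1 hx0) h)
  rw [h1, h2, integral_const_mul, Real.integral_rpow_mul_exp_neg_mul_Ioi hα hr']
  have hG := (Real.Gamma_pos_of_pos hα).ne'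
  rw [one_div, Real.inv_rpow hr'.le, Real.rpow_def_of_pos hr', ← Real.exp_neg]
  field_simp

lemma Iio_subset_integrableExpSet_gammaMeasure {α : ℝ} (hα : 0 < α) :
    Iio 1 ⊆ integrableExpSet id (gammaMeasure α 1) := by
  intro r hr
  by_contra h
  -- otherwise the Bochner integral would be `0`, but its value is positive
  have := mgf_gammaMeasure hα hr
  rw [mgf, integral_undef h] at this
  exact (Real.exp_pos _).ne this

/-- The Laplace transform of the standard gamma law on the half plane `re z < 1`, by analytic
continuation from the real axis. -/
lemma integral_exp_gammaMeasure {α : ℝ} (hα : 0 < α) {z : ℂ} (hz : z.re < 1) :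
    ∫ x, Complex.exp (z * (x : ℂ)) ∂(gammaMeasure α 1) =
      Complex.exp (-((α : ℂ) * Complex.log (1 - z))) := by
  have hsub : Iio 1 ⊆ interior (integrableExpSet id (gammaMeasure α 1)) :=
    (isOpen_Iio.subset_interior_iff).2 (Iio_subset_integrableExpSet_gammaMeasure hα)
  have hopen : IsOpen {z : ℂ | z.re < 1} := isOpen_lt Complex.continuous_re continuous_const
  have hf : AnalyticOnNhd ℂ (complexMGF id (gammaMeasure α 1)) {z : ℂ | z.re < 1} :=
    fun z hz => analyticOnNhd_complexMGF z (hsub hz)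
  have hg : AnalyticOnNhd ℂ (fun z => Complex.exp (-((α : ℂ) * Complex.log (1 - z))))
      {z : ℂ | z.re < 1} := by
    refine DifferentiableOn.analyticOnNhd (fun z hz => ?_) hopen
    have hsl : 1 - z ∈ Complex.slitPlane := Or.inl (by simpa using hz)
    exact
      ((((differentiableAt_id.const_sub 1).clog hsl).const_mul _).neg.cexp).differentiableWithinAt
  have hconv : IsPreconnected {z : ℂ | z.re < 1} :=
    (convex_halfSpace_re_lt 1).isPreconnected
  have hreal : ∀ r : ℝ, r < 1 → complexMGF id (gammaMeasure α 1) (r : ℂ) =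
      Complex.exp (-((α : ℂ) * Complex.log (1 - r))) := by
    intro r hr
    rw [complexMGF_ofReal, mgf_gammaMeasure hα hr]
    push_cast
    rw [Complex.ofReal_log (by linarith)]
    push_cast
    rfl
  -- the two sides agree along the negative reals, which accumulate at `0`
  have hfreq : ∃ᶠ z in 𝓝[≠] (0 : ℂ), complexMGF id (gammaMeasure α 1) z =
      Complex.exp (-((α : ℂ) * Complex.log (1 - z))) := by
    have ht : Tendsto (fun n : ℕ => (((-(1 / ((n : ℝ) + 1)) : ℝ)) : ℂ)) atTop (𝓝[≠] (0 : ℂ)) := by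
      refine tendsto_nhdsWithin_iff.2 ⟨?_, Eventually.of_forall fun n => ?_⟩
      · have h0 := (tendsto_one_div_add_atTop_nhds_zero_nat (𝕜 := ℝ)).neg
        rw [neg_zero] at h0
        exact (Complex.continuous_ofReal.tendsto' 0 0 Complex.ofReal_zero).comp h0
      · have : (0 : ℝ) < 1 / ((n : ℝ) + 1) := by positivity
        simpa using (by positivity : (n : ℝ) + 1 ≠ 0) |> fun h => by exact_mod_cast h
    refine ht.frequently (Eventually.of_forall fun n => hreal _ ?_).frequently
    have : (0 : ℝ) < 1 / ((n : ℝ) + 1) := by positivity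
    linarith
  have := hf.eqOn_of_preconnected_of_frequently_eq hg hconv (by simp : (0 : ℂ) ∈ {z : ℂ | z.re < 1})
    hfreq hz
  simpa [complexMGF] using this

lemma ae_nonneg_gammaMeasure (α : ℝ) : ∀ᵐ x ∂(gammaMeasure α 1), 0 ≤ x := by
  have hm : Measurable (gammaPDF α 1) := (measurable_gammaPDFReal α 1).ennreal_ofReal
  rw [gammaMeasure, ae_withDensity_iff hm]
  refine Eventually.of_forall fun x hx => ?_
  by_contra h
  exact hx (gammaPDF_of_neg (not_le.1 h))

lemma absolutelyContinuous_pi {n : ℕ} {μ ν : Fin n → Measure ℝ} [∀ i, SigmaFinite (μ i)]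
    [∀ i, SigmaFinite (ν i)] (h : ∀ i, μ i ≪ ν i) : Measure.pi μ ≪ Measure.pi ν := by
  induction n with
  | zero =>
    rw [Measure.pi_of_empty μ, Measure.pi_of_empty ν]
  | succ n ih =>
    have h1 := measurePreserving_piFinSuccAbove μ 0
    have h2 := measurePreserving_piFinSuccAbove ν 0
    have h3 := (h 0).prod (ih fun i => h (Fin.succAbove 0 i))
    have h4 := h3.map h1.symm.measurable
    rwa [h1.symm.map_eq, h2.symm.map_eq] at h4

variable {d : ℕ} {ν : Measure (Fin d → ℝ)} {S : Finset (Fin d → ℝ)} {a : (Fin d → ℝ) → ℝ}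

/-- The gamma convolution is the law of `∑_{x ∈ S} γ_x x` for independent standard gamma variables
`γ_x` of shape `a x`; it has a density because the atoms span. -/
lemma IsAtomic.exists_density (h : IsAtomic ν S a) : ∃ g, IsGammaConvolutionDensity g ν := by
  classical
  set e := S.equivFin with he
  set n := S.card
  set x : Fin n → Fin d → ℝ := fun i => (e.symm i : Fin d → ℝ) with hx
  have hxS : ∀ i, x i ∈ S := fun i => (e.symm i).2
  have hpos : ∀ i, 0 < a (x i) := fun i => h.pos _ (hxS i)
  have hprob : ∀ i, IsProbabilityMeasure (gammaMeasure (a (x i)) 1) :=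
    fun i => isProbabilityMeasure_gammaMeasure (hpos i) one_pos
  have hsum : ∀ F : (Fin d → ℝ) → ℂ, ∑ y ∈ S, F y = ∑ i, F (x i) := by
    intro F
    rw [← Finset.sum_coe_sort S F, ← e.symm.sum_comp]
  let T : (Fin n → ℝ) →ₗ[ℝ] (Fin d → ℝ) := Fintype.linearCombination ℝ x
  have hT : ∀ g, T g = ∑ i, g i • x i := fun g => Fintype.linearCombination_apply ℝ x g
  have hTsurj : Function.Surjective T := by
    rw [← LinearMap.range_eq_top, Fintype.range_linearCombination]
    convert h.span_eq_top
    ext y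
    constructor
    · rintro ⟨i, rfl⟩; exact hxS i
    · intro hy; exact ⟨e ⟨y, hy⟩, by simp [hx]⟩
  have hTm : Measurable T := T.continuous_of_finiteDimensional.measurable
  set μ := Measure.pi fun i => gammaMeasure (a (x i)) 1 with hμ
  have hac : μ ≪ volume := by
    rw [volume_pi]
    exact absolutelyContinuous_pi fun i => withDensity_absolutelyContinuous _ _
  have hPac : μ.map T ≪ volume := by
    refine Measure.AbsolutelyContinuous.mk fun s hs h0 => ?_
    rw [Measure.map_apply hTm hs]
    refine hac ?_
    have := (ae_comp_linearMap_mem_iff T (volume : Measure (Fin n → ℝ))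
      (volume : Measure (Fin d → ℝ)) hTsurj hs.compl).2 (compl_mem_ae_iff.2 h0)
    rw [ae_iff] at this
    simpa [preimage] using this
  have hPprob : IsProbabilityMeasure (μ.map T) := Measure.isProbabilityMeasure_map hTm.aemeasurable
  have hdens : volume.withDensity (fun y => ENNReal.ofReal
      (((μ.map T).rnDeriv volume y).toReal)) = μ.map T := by
    rw [← Measure.withDensity_rnDeriv_eq _ _ hPac]
    refine withDensity_congr_ae ?_
    rw [Measure.withDensity_rnDeriv_eq _ _ hPac]
    filter_upwards [Measure.rnDeriv_lt_top (μ.map T) volume] with y hy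
    exact ENNReal.ofReal_toReal hy.ne
  refine ⟨fun y => ((μ.map T).rnDeriv volume y).toReal,
    (Measure.measurable_rnDeriv _ _).ennreal_toReal.aemeasurable,
    Eventually.of_forall fun y => ENNReal.toReal_nonneg, ?_⟩
  rw [hdens]
  refine ⟨hPprob, ?_, ?_, fun t _ => h.integrable _, ?_⟩
  · rw [ae_map_iff hTm.aemeasurable measurableSet_Ici]
    have : ∀ i, ∀ᵐ g ∂μ, 0 ≤ g i := fun i =>
      (measurePreserving_eval (fun i => gammaMeasure (a (x i)) 1) i).quasiMeasurePreserving.ae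
        (ae_nonneg_gammaMeasure _)
    filter_upwards [ae_all_iff.2 this] with g hg
    change 0 ≤ T g
    rw [hT]
    exact Finset.sum_nonneg fun i _ => smul_nonneg (hg i) (h.nonneg _ (hxS i))
  · rw [h.eq_sum]
    refine (ae_finsetSum_measure_iff).2 fun y hy => ?_
    exact Measure.ae_smul_measure ((ae_dirac_iff measurableSet_Ici).2 (h.nonneg y hy)) _
  · intro t ht
    rw [integral_map hTm.aemeasurable
      (by fun_prop : Continuous fun y : Fin d → ℝ =>
        Complex.exp (∑ i, t i * (y i : ℂ))).aestronglyMeasurable]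
    have hz : ∀ g : Fin n → ℝ, Complex.exp (∑ j, t j * ((T g j : ℝ) : ℂ)) =
        ∏ i, Complex.exp ((∑ j, t j * ((x i j : ℝ) : ℂ)) * (g i : ℂ)) := by
      intro g
      rw [← Complex.exp_sum, hT]
      congr 1
      simp only [Finset.sum_apply, Pi.smul_apply, smul_eq_mul, Complex.ofReal_sum,
        Complex.ofReal_mul, Finset.mul_sum, Finset.sum_mul]
      rw [Finset.sum_comm]
      exact Finset.sum_congr rfl fun i _ => Finset.sum_congr rfl fun j _ => by ring
    simp only [hz]
    rw [integral_fintype_prod_eq_prod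
      (fun i (r : ℝ) => Complex.exp ((∑ j, t j * ((x i j : ℝ) : ℂ)) * (r : ℂ))), h.cgf_eq, hsum,
      ← Finset.sum_neg_distrib, Complex.exp_sum]
    refine Finset.prod_congr rfl fun i _ => integral_exp_gammaMeasure (hpos i) ?_
    rw [Complex.re_sum]
    refine lt_of_le_of_lt (Finset.sum_nonpos fun j _ => ?_) one_pos
    rw [Complex.re_mul_ofReal]
    exact mul_nonpos_of_nonpos_of_nonneg (ht j) (h.nonneg _ (hxS i) j)

end Density

/-! ### Plancherel's identity for integrable functions -/

section Plancherel

open Set SchwartzMap FourierTransform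
open scoped ContDiff

section Euclidean

variable {E : Type*} [NormedAddCommGroup E] [InnerProductSpace ℝ E] [FiniteDimensional ℝ E]
  [MeasurableSpace E] [BorelSpace E]

/-- Locally integrable functions are determined by their integrals against Schwartz functions. -/
lemma ae_eq_of_integral_schwartz {f g : E → ℂ} (hf : LocallyIntegrable f volume)
    (hg : LocallyIntegrable g volume)
    (h : ∀ u : 𝓢(E, ℂ), ∫ x, u x • f x = ∫ x, u x • g x) : f =ᵐ[volume] g := by
  refine ae_eq_of_integral_contDiff_smul_eq hf hg fun u hu hc => ?_
  have hc' : HasCompactSupport (fun x => (u x : ℂ)) := hc.comp_left Complex.ofReal_zero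
  have := h (hc'.toSchwartzMap (Complex.ofRealCLM.contDiff.comp hu))
  exact this

lemma integral_schwartz_smul_fourier {f : E → ℂ} (hf : Integrable f) (u : 𝓢(E, ℂ)) :
    ∫ x, u x • 𝓕 f x = ∫ x, (𝓕 u) x • f x := by
  have h := VectorFourier.integral_fourierIntegral_smul_eq_flip (μ := volume) (ν := volume)
    (L := innerₗ E) (f := (u : E → ℂ)) (g := f) Real.continuous_fourierChar continuous_inner
    u.integrable hf
  rw [flip_innerₗ] at h
  exact h.symm

/-- An integrable function and its Fourier transform have the same, possibly infinite, `L²` norm.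
The Fourier integral is identified with the `L²` Fourier transform by testing against Schwartz
functions. -/
theorem eLpNorm_fourier_eq {f : E → ℂ} (hf : Integrable f) : eLpNorm (𝓕 f) 2 = eLpNorm f 2 := by
  have hcont : Continuous (𝓕 f) :=
    VectorFourier.fourierIntegral_continuous Real.continuous_fourierChar continuous_inner hf
  have loc : ∀ F : Lp (α := E) ℂ 2, LocallyIntegrable (F : E → ℂ) volume := fun F =>
    (Lp.memLp F).locallyIntegrable (by norm_num)
  by_cases h2 : eLpNorm f 2 = ⊤
  · rw [h2]
    by_contra hne
    have hm : MemLp (𝓕 f) 2 := ⟨hcont.aestronglyMeasurable, lt_top_iff_ne_top.2 hne⟩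
    let F : Lp (α := E) ℂ 2 := hm.toLp (𝓕 f)
    have hG : (𝓕⁻ F : Lp (α := E) ℂ 2 volume) =ᵐ[volume] f := by
      refine ae_eq_of_integral_schwartz (loc _) hf.locallyIntegrable fun u => ?_
      have e := Lp.toTemperedDistribution_apply (𝓕⁻ F : Lp (α := E) ℂ 2 volume) u
      rw [← e, ← Lp.fourierInv_toTemperedDistribution_eq,
        TemperedDistribution.fourierInv_apply, Lp.toTemperedDistribution_apply]
      have h1 : ∫ x, (𝓕⁻ u) x • (F : E → ℂ) x = ∫ x, (𝓕⁻ u) x • 𝓕 f x := by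
        refine integral_congr_ae ?_
        filter_upwards [hm.coeFn_toLp] with x hx
        rw [hx]
      rw [h1, integral_schwartz_smul_fourier hf, FourierTransform.fourier_fourierInv_eq]
    have h3 := eLpNorm_congr_ae (p := 2) hG
    rw [h2] at h3
    exact (Lp.memLp _).2.ne h3
  · have hm : MemLp f 2 := ⟨hf.1, lt_top_iff_ne_top.2 h2⟩
    let F : Lp (α := E) ℂ 2 := hm.toLp f
    have hG : (𝓕 F : Lp (α := E) ℂ 2 volume) =ᵐ[volume] 𝓕 f := by
      refine ae_eq_of_integral_schwartz (loc _) hcont.locallyIntegrable fun u => ?_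
      have e := Lp.toTemperedDistribution_apply (𝓕 F : Lp (α := E) ℂ 2 volume) u
      rw [← e, ← Lp.fourier_toTemperedDistribution_eq,
        TemperedDistribution.fourier_apply, Lp.toTemperedDistribution_apply,
        integral_schwartz_smul_fourier hf]
      refine integral_congr_ae ?_
      filter_upwards [hm.coeFn_toLp] with x hx
      rw [hx]
    rw [← eLpNorm_congr_ae hG, ← eLpNorm_congr_ae hm.coeFn_toLp]
    have := Lp.norm_fourier_eq F
    rw [Lp.norm_def, Lp.norm_def] at this
    exact (ENNReal.toReal_eq_toReal_iff' (Lp.memLp _).2.ne (Lp.memLp _).2.ne).1 this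

end Euclidean

variable {d : ℕ}

/-- The characteristic function `∫ e^{i ⟨θ, x⟩} h(x) dx`. -/
def charInt (h : (Fin d → ℝ) → ℝ) (θ : Fin d → ℝ) : ℂ :=
  ∫ x, Complex.exp (∑ i, (θ i * Complex.I) * (x i : ℂ)) * (h x : ℂ)

/-- Mathlib's Fourier transform lives on `EuclideanSpace` and has the kernel `e^{-2πi ⟨v, w⟩}`. -/
lemma fourier_toLp_eq_charInt (h : (Fin d → ℝ) → ℝ) (w : EuclideanSpace ℝ (Fin d)) :
    𝓕 (fun v : EuclideanSpace ℝ (Fin d) => (h (WithLp.ofLp v) : ℂ)) w =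
      charInt h ((-2 * Real.pi) • WithLp.ofLp w) := by
  rw [Real.fourier_eq', charInt, ← (PiLp.volume_preserving_ofLp (Fin d)).integral_comp
    (MeasurableEquiv.toLp 2 (Fin d → ℝ)).symm.measurableEmbedding]
  refine integral_congr_ae (Eventually.of_forall fun v => ?_)
  simp only [smul_eq_mul]
  congr 2
  simp only [PiLp.inner_apply, RCLike.inner_apply, conj_trivial, Pi.smul_apply, smul_eq_mul]
  push_cast
  rw [Finset.mul_sum, Finset.sum_mul]
  exact Finset.sum_congr rfl fun i _ => by ring

/-- Plancherel's identity on `ℝ^d`, with the normalizing constant left implicit. -/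
lemma exists_lintegral_sq_charInt (d : ℕ) : ∃ C : ℝ≥0∞, C ≠ 0 ∧ C ≠ ⊤ ∧
    ∀ h : (Fin d → ℝ) → ℝ, Integrable h →
      eLpNorm h 2 volume ^ 2 = C * ∫⁻ θ, ‖charInt h θ‖ₑ ^ 2 := by
  have hr : (-2 * Real.pi) ≠ 0 := by simp [Real.pi_ne_zero]
  refine ⟨ENNReal.ofReal |((-2 * Real.pi) ^ Module.finrank ℝ (Fin d → ℝ))⁻¹|, ?_,
    ENNReal.ofReal_ne_top, fun h hh => ?_⟩
  · rw [ne_eq, ENNReal.ofReal_eq_zero, not_le]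
    positivity
  have hmp := PiLp.volume_preserving_ofLp (Fin d)
  have hme : MeasurableEmbedding (@WithLp.ofLp 2 (Fin d → ℝ)) :=
    (MeasurableEquiv.toLp 2 (Fin d → ℝ)).symm.measurableEmbedding
  have hh' : Integrable (fun v : EuclideanSpace ℝ (Fin d) => (h (WithLp.ofLp v) : ℂ)) :=
    ((hmp.integrable_comp_emb hme).2 hh).ofReal
  have hP := eLpNorm_fourier_eq hh'
  have sq : ∀ {α F : Type} [MeasurableSpace α] [NormedAddCommGroup F] (μ : Measure α) (g : α → F),
      eLpNorm g 2 μ ^ 2 = ∫⁻ x, ‖g x‖ₑ ^ 2 ∂μ := by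
    intro α F _ _ μ g
    have := eLpNorm_nnreal_pow_eq_lintegral (f := g) (μ := μ) (p := 2) (by norm_num)
    simpa using this
  have h1 : eLpNorm h 2 volume ^ 2 =
      eLpNorm (fun v : EuclideanSpace ℝ (Fin d) => (h (WithLp.ofLp v) : ℂ)) 2 ^ 2 := by
    rw [sq, sq, ← hmp.lintegral_comp_emb hme]
    refine lintegral_congr fun v => ?_
    rw [← ofReal_norm, ← ofReal_norm, Complex.norm_real]
  rw [h1, ← hP, sq]
  simp only [fourier_toLp_eq_charInt]
  rw [hmp.lintegral_comp_emb hme (fun θ => ‖charInt h ((-2 * Real.pi) • θ)‖ₑ ^ 2)]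
  have hme2 : MeasurableEmbedding fun θ : Fin d → ℝ => (-2 * Real.pi) • θ :=
    (Homeomorph.smulOfNeZero _ hr).measurableEmbedding
  rw [← hme2.lintegral_map (fun θ => ‖charInt h θ‖ₑ ^ 2), Measure.map_addHaar_smul _ hr,
    lintegral_smul_measure, smul_eq_mul]

end Plancherel

/-! ### Bases of minimal weight -/

section Greedy

open Set

variable {d : ℕ}

/-- The total mass of the points of `S` outside the span of `b`. -/
def massOffSpan (S : Finset (Fin d → ℝ)) (a : (Fin d → ℝ) → ℝ) (b : Finset (Fin d → ℝ)) : ℝ :=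
  open scoped Classical in
  ∑ y ∈ S with y ∉ Submodule.span ℝ (b : Set (Fin d → ℝ)), a y

lemma card_le_of_linearIndepOn {b : Finset (Fin d → ℝ)}
    (hb : LinearIndepOn ℝ id (b : Set (Fin d → ℝ))) : b.card ≤ d := by
  have := LinearIndependent.fintype_card_le_finrank
    (b := fun x : b => (x : Fin d → ℝ)) hb
  simpa using this

/-- The greedy algorithm for weighted matroids: if outside the span of every independent subset
of `S` the mass of `a` is at least `Λ` times the codimension of the span, then every independent `b`
extends to a basis whose additional `w`-weight, times `Λ`, is at most the integral of `w` against
`a` outside the span of `b`. The induction adds the lightest vector outside the span and lowers all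
weights by its weight. -/
lemma exists_basis_mul_sum_le {S : Finset (Fin d → ℝ)} {a : (Fin d → ℝ) → ℝ} {Λ : ℝ} (hΛ : 0 < Λ)
    (ha : ∀ y ∈ S, 0 ≤ a y)
    (hS : ∀ b ⊆ S, LinearIndepOn ℝ id (b : Set (Fin d → ℝ)) → b.card < d →
      Λ * ((d : ℝ) - b.card) ≤ massOffSpan S a b)
    (b : Finset (Fin d → ℝ)) (hbS : b ⊆ S) (hb : LinearIndepOn ℝ id (b : Set (Fin d → ℝ)))
    (w : (Fin d → ℝ) → ℝ)
    (hw : ∀ y ∈ S, y ∉ Submodule.span ℝ (b : Set (Fin d → ℝ)) → 0 ≤ w y) :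
    ∃ b' ⊆ S, b ⊆ b' ∧ LinearIndepOn ℝ id (b' : Set (Fin d → ℝ)) ∧ b'.card = d ∧
      Λ * ∑ y ∈ b' \ b, w y ≤ massOffSpan S (fun y => a y * w y) b := by
  classical
  induction hn : d - b.card generalizing b w with
  | zero =>
    refine ⟨b, hbS, subset_rfl, hb, le_antisymm (card_le_of_linearIndepOn hb) (by omega), ?_⟩
    simp only [Finset.sdiff_self, Finset.sum_empty, mul_zero]
    refine Finset.sum_nonneg fun y hy => ?_
    obtain ⟨h1, h2⟩ := Finset.mem_filter.1 hy
    exact mul_nonneg (ha y h1) (hw y h1 h2)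
  | succ n ih =>
    have hcard : b.card < d := by omega
    have hmass := hS b hbS hb hcard
    have hgap : (0 : ℝ) < (d : ℝ) - b.card := by
      have : (b.card : ℝ) < d := by exact_mod_cast hcard
      linarith
    set Q := S.filter fun y => y ∉ Submodule.span ℝ (b : Set (Fin d → ℝ)) with hQ
    have hne : Q.Nonempty := by
      by_contra h
      rw [Finset.not_nonempty_iff_eq_empty] at h
      have h0 : massOffSpan S a b = 0 := by
        unfold massOffSpan
        convert Finset.sum_empty
      rw [h0] at hmass
      exact absurd (mul_pos hΛ hgap) (not_lt.2 hmass)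
    obtain ⟨j, hjQ, hjmin⟩ := Q.exists_min_image w hne
    obtain ⟨hjS, hjb⟩ := Finset.mem_filter.1 hjQ
    have hjnb : j ∉ b := fun h => hjb (Submodule.subset_span h)
    have hins : LinearIndepOn ℝ id ((insert j b : Finset (Fin d → ℝ)) : Set (Fin d → ℝ)) := by
      rw [Finset.coe_insert]; exact hb.id_insert hjb
    have hle : Submodule.span ℝ (b : Set (Fin d → ℝ)) ≤
        Submodule.span ℝ ((insert j b : Finset (Fin d → ℝ)) : Set (Fin d → ℝ)) :=
      Submodule.span_mono (by simp)
    obtain ⟨b', hb'S, hbb', hb'li, hb'c, hb'⟩ := ih (insert j b)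
      (Finset.insert_subset hjS hbS) hins (fun y => w y - w j)
      (fun y hy hyb => sub_nonneg.2 (hjmin y (Finset.mem_filter.2 ⟨hy, fun h => hyb (hle h)⟩)))
      (by rw [Finset.card_insert_of_notMem hjnb]; omega)
    refine ⟨b', hb'S, (Finset.subset_insert j b).trans hbb', hb'li, hb'c, ?_⟩
    have hwj : 0 ≤ w j := hw j hjS hjb
    -- lowering the weights by `w j` costs `w j` times the mass outside the span of `b`
    have h1 : massOffSpan S (fun y => a y * w y) b =
        massOffSpan S (fun y => a y * (w y - w j)) b + w j * massOffSpan S a b := by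
      unfold massOffSpan
      rw [Finset.mul_sum, ← Finset.sum_add_distrib]
      exact Finset.sum_congr rfl fun y _ => by ring
    have h2 : massOffSpan S (fun y => a y * (w y - w j)) (insert j b) ≤
        massOffSpan S (fun y => a y * (w y - w j)) b := by
      unfold massOffSpan
      refine Finset.sum_le_sum_of_subset_of_nonneg ?_ ?_
      · intro y hy
        obtain ⟨hy1, hy2⟩ := Finset.mem_filter.1 hy
        exact Finset.mem_filter.2 ⟨hy1, fun h => hy2 (hle h)⟩
      · intro y hy _
        obtain ⟨hy1, hy2⟩ := Finset.mem_filter.1 hy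
        exact mul_nonneg (ha y hy1) (sub_nonneg.2 (hjmin y (Finset.mem_filter.2 ⟨hy1, hy2⟩)))
    have hjb' : j ∈ b' := hbb' (Finset.mem_insert_self j b)
    -- and it saves `w j` for each of the `d - |b|` vectors that complete the basis
    have h3 : ∑ y ∈ b' \ insert j b, (w y - w j) =
        ∑ y ∈ b' \ b, w y - w j * ((d : ℝ) - b.card) := by
      have hsd : b' \ b = insert j (b' \ insert j b) := by
        ext y
        simp only [Finset.mem_sdiff, Finset.mem_insert, not_or]
        constructor
        · rintro ⟨h, h'⟩
          by_cases hyj : y = j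
          · exact Or.inl hyj
          · exact Or.inr ⟨h, hyj, h'⟩
        · rintro (rfl | ⟨h, -, h'⟩)
          · exact ⟨hjb', hjnb⟩
          · exact ⟨h, h'⟩
      have hc : ((b' \ insert j b).card : ℝ) = (d : ℝ) - b.card - 1 := by
        rw [Finset.card_sdiff_of_subset hbb', hb'c, Finset.card_insert_of_notMem hjnb,
          Nat.cast_sub hcard]
        push_cast
        ring
      rw [hsd, Finset.sum_insert (by simp), Finset.sum_sub_distrib, Finset.sum_const, nsmul_eq_mul,
        hc]
      ring
    rw [h3] at hb'
    have h4 := mul_le_mul_of_nonneg_left hmass hwj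
    rw [h1]
    linarith [h2, hb']

end Greedy

/-! ### Square integrability forces mass off every proper subspace -/

section Necessary

open Set

variable {d : ℕ}

/-- `-2` times the real part of the cumulant generating function on the imaginary axis:
the characteristic function of the gamma convolution has absolute square `exp (-logMod S a t)`. -/
def logMod (S : Finset (Fin d → ℝ)) (a : (Fin d → ℝ) → ℝ) (t : Fin d → ℝ) : ℝ :=
  ∑ x ∈ S, a x * Real.log (1 + (x ⬝ᵥ t) ^ 2)

lemma log_one_add_sq_nonneg (r : ℝ) : 0 ≤ Real.log (1 + r ^ 2) :=
  Real.log_nonneg (by nlinarith [sq_nonneg r])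

lemma continuous_logMod (S : Finset (Fin d → ℝ)) (a : (Fin d → ℝ) → ℝ) :
    Continuous (logMod S a) := by
  unfold logMod dotProduct
  refine continuous_finsetSum _ fun x _ => continuous_const.mul (Continuous.log (by fun_prop) ?_)
  intro t
  positivity

/-- If the squared characteristic function is integrable, then outside the span of `b` the mass
exceeds half the codimension: otherwise the integrals over the regions where `⟨y, t⟩` lies in
`[0, 1]` for `y ∈ b` and in `[R, 2R]` for the other members of a basis that extends `b` do not
vanish as `R → ∞`. -/
lemma lt_massOffSpan {S : Finset (Fin d → ℝ)} {a : (Fin d → ℝ) → ℝ} (ha : ∀ y ∈ S, 0 ≤ a y)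
    (hint : ∫⁻ t, ENNReal.ofReal (Real.exp (-logMod S a t)) ≠ ⊤)
    {b : Finset (Fin d → ℝ)} (hb : LinearIndepOn ℝ id (b : Set (Fin d → ℝ))) (hbd : b.card < d) :
    ((d : ℝ) - b.card) / 2 < massOffSpan S a b := by
  classical
  by_contra hcon
  rw [not_lt] at hcon
  let ι := hb.extend (subset_univ (b : Set (Fin d → ℝ)))
  let e : Module.Basis ι ℝ (Fin d → ℝ) := Module.Basis.extend hb
  have : Finite ι := Module.Finite.finite_basis e
  have : Fintype ι := Fintype.ofFinite ι
  have hcardι : Fintype.card ι = d := by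
    rw [← Module.finrank_eq_card_basis e]; simp
  have heval : ∀ j : ι, e j = (j : Fin d → ℝ) := Module.Basis.extend_apply_self hb
  -- the coordinates of `t` are its pairings with the basis vectors
  let T : (Fin d → ℝ) →ₗ[ℝ] (ι → ℝ) := LinearMap.pi fun j => dotProductBilin ℝ ℝ (e j)
  have hT : ∀ t j, T t j = e j ⬝ᵥ t := fun t j => rfl
  have hexp : ∀ x t : Fin d → ℝ, x ⬝ᵥ t = ∑ j, e.repr x j * T t j := by
    intro x t
    conv_lhs => rw [← e.sum_repr x, sum_dotProduct]
    exact Finset.sum_congr rfl fun j _ => by rw [smul_dotProduct, smul_eq_mul, hT]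
  have hTinj : Function.Injective T := by
    refine (injective_iff_map_eq_zero T).2 fun t ht => ?_
    refine dotProduct_eq_zero t fun x => ?_
    rw [dotProduct_comm, hexp]
    simp [ht]
  have hTsurj : Function.Surjective T := by
    refine (LinearMap.injective_iff_surjective_of_finrank_eq_finrank ?_).1 hTinj
    simp [hcardι]
  set H : (ι → ℝ) → ℝ := fun y =>
    Real.exp (-∑ x ∈ S, a x * Real.log (1 + (∑ j, e.repr x j * y j) ^ 2)) with hH
  have hHc : Continuous H := by
    refine Real.continuous_exp.comp (Continuous.neg (continuous_finsetSum _ fun x _ =>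
      continuous_const.mul (Continuous.log (by fun_prop) ?_)))
    intro t
    positivity
  have hHT : ∀ t, Real.exp (-logMod S a t) = H (T t) := by
    intro t
    simp only [hH, logMod, hexp]
  have hHfin : ∫⁻ y, ENNReal.ofReal (H y) ≠ ⊤ := by
    obtain ⟨c, hc0, hc⟩ := T.exists_map_addHaar_eq_smul_addHaar
      (volume : Measure (Fin d → ℝ)) (volume : Measure (ι → ℝ)) hTsurj
    have h1 : ∫⁻ t, ENNReal.ofReal (Real.exp (-logMod S a t)) =
        c * ∫⁻ y, ENNReal.ofReal (H y) := by
      simp only [hHT]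
      rw [← smul_eq_mul, ← lintegral_smul_measure, ← hc, lintegral_map
        hHc.measurable.ennreal_ofReal T.continuous_of_finiteDimensional.measurable]
    intro htop
    rw [h1, htop, ENNReal.mul_top hc0.ne'] at hint
    exact hint rfl
  set F := Submodule.span ℝ (b : Set (Fin d → ℝ))
  have hrepr : ∀ x ∈ F, ∀ j : ι, (j : Fin d → ℝ) ∉ b → e.repr x j = 0 := by
    intro x hx j hj
    have himg : (b : Set (Fin d → ℝ)) = e '' {j | (j : Fin d → ℝ) ∈ b} := by
      ext z
      constructor
      · intro hz
        exact ⟨⟨z, hb.subset_extend _ hz⟩, hz, heval _⟩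
      · rintro ⟨j, hj, rfl⟩
        rw [heval]
        exact hj
    have hx' : x ∈ Submodule.span ℝ (e '' {j | (j : Fin d → ℝ) ∈ b}) := by rwa [← himg]
    rw [Module.Basis.mem_span_image] at hx'
    by_contra hne
    exact hj (hx' (Finsupp.mem_support_iff.2 hne))
  set C : ℝ := ∑ x ∈ S, ∑ j, |e.repr x j| with hC
  have hC0 : 0 ≤ C := Finset.sum_nonneg fun _ _ => Finset.sum_nonneg fun _ _ => abs_nonneg _
  have hCx : ∀ x ∈ S, ∑ j, |e.repr x j| ≤ C := fun x hx =>
    Finset.single_le_sum (f := fun x => ∑ j, |e.repr x j|)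
      (fun _ _ => Finset.sum_nonneg fun _ _ => abs_nonneg _) hx
  -- the boxes are indexed by `n`, with `R = n + 1`
  set lo : ℕ → ι → ℝ := fun n j => if (j : Fin d → ℝ) ∈ b then 0 else n + 1 with hlo
  set hi : ℕ → ι → ℝ := fun n j => if (j : Fin d → ℝ) ∈ b then 1 else 2 * (n + 1) with hhi
  set m := massOffSpan S a b with hm
  set A : ℝ := ∑ x ∈ S, a x with hA
  set κ : ℝ := Real.exp (-(A * Real.log (1 + 4 * C ^ 2))) with hκ
  have hlow : ∀ n : ℕ, ∀ y ∈ Icc (lo n) (hi n), κ * ((n : ℝ) + 1) ^ (-(2 * m)) ≤ H y := by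
    intro n y hy
    have hn : (1 : ℝ) ≤ (n : ℝ) + 1 := by linarith [Nat.cast_nonneg (α := ℝ) n]
    have hn0 : (0 : ℝ) < (n : ℝ) + 1 := by linarith
    rw [hκ, Real.rpow_def_of_pos hn0, ← Real.exp_add]
    refine Real.exp_le_exp.2 ?_
    have hterm : ∀ x ∈ S, a x * Real.log (1 + (∑ j, e.repr x j * y j) ^ 2) ≤
        a x * Real.log (1 + 4 * C ^ 2) +
          if x ∉ F then a x * (2 * Real.log ((n : ℝ) + 1)) else 0 := by
      intro x hx
      have hyj : ∀ j, |y j| ≤ 2 * ((n : ℝ) + 1) := by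
        intro j
        have h1 := hy.1 j
        have h2 := hy.2 j
        simp only [hlo, hhi] at h1 h2
        rw [abs_le]
        split_ifs at h1 h2 <;> constructor <;> linarith
      have hb1 : |∑ j, e.repr x j * y j| ≤ 2 * C * ((n : ℝ) + 1) := by
        calc |∑ j, e.repr x j * y j| ≤ ∑ j, |e.repr x j * y j| := Finset.abs_sum_le_sum_abs _ _
          _ ≤ ∑ j, |e.repr x j| * (2 * ((n : ℝ) + 1)) := by
            refine Finset.sum_le_sum fun j _ => ?_
            rw [abs_mul]
            exact mul_le_mul_of_nonneg_left (hyj j) (abs_nonneg _)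
          _ = (∑ j, |e.repr x j|) * (2 * ((n : ℝ) + 1)) := by rw [Finset.sum_mul]
          _ ≤ C * (2 * ((n : ℝ) + 1)) := by gcongr; exact hCx x hx
          _ = _ := by ring
      -- off the span of `b`, `⟨x, t⟩` may grow like `R`; on the span it stays bounded
      by_cases hxF : x ∉ F
      · rw [if_pos hxF, ← mul_add]
        refine mul_le_mul_of_nonneg_left ?_ (ha x hx)
        have hsq : (∑ j, e.repr x j * y j) ^ 2 ≤ (2 * C * ((n : ℝ) + 1)) ^ 2 :=
          sq_le_sq' (abs_le.1 hb1).1 (abs_le.1 hb1).2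
        have h2 : 2 * Real.log ((n : ℝ) + 1) = Real.log (((n : ℝ) + 1) ^ 2) := by
          rw [Real.log_pow]; norm_num
        rw [h2, ← Real.log_mul (by positivity) (by positivity)]
        refine Real.log_le_log (by positivity) ?_
        nlinarith [one_le_pow₀ (n := 2) hn]
      · rw [if_neg hxF, add_zero]
        refine mul_le_mul_of_nonneg_left (Real.log_le_log (by positivity) ?_) (ha x hx)
        have hb2 : |∑ j, e.repr x j * y j| ≤ C := by
          calc |∑ j, e.repr x j * y j| ≤ ∑ j, |e.repr x j * y j| := Finset.abs_sum_le_sum_abs _ _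
            _ ≤ ∑ j, |e.repr x j| := by
              refine Finset.sum_le_sum fun j _ => ?_
              by_cases hj : (j : Fin d → ℝ) ∈ b
              · have h1 := hy.1 j
                have h2 := hy.2 j
                simp only [hlo, hhi, hj, if_true] at h1 h2
                rw [abs_mul]
                exact mul_le_of_le_one_right (abs_nonneg _) (abs_le.2 ⟨by linarith, h2⟩)
              · rw [hrepr x (not_not.1 hxF) j hj]; simp
            _ ≤ C := hCx x hx
        have hsq : (∑ j, e.repr x j * y j) ^ 2 ≤ C ^ 2 :=
          sq_le_sq' (abs_le.1 hb2).1 (abs_le.1 hb2).2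
        nlinarith [sq_nonneg C]
    have hsum := Finset.sum_le_sum hterm
    rw [Finset.sum_add_distrib, ← Finset.sum_mul, ← Finset.sum_filter, ← Finset.sum_mul] at hsum
    have hm' : ∑ x ∈ S with x ∉ F, a x = m := by
      rw [hm, massOffSpan]
    rw [hm'] at hsum
    linarith
  -- the volume of the box
  have hvol : ∀ n : ℕ,
      volume (Icc (lo n) (hi n)) = ENNReal.ofReal (((n : ℝ) + 1) ^ (d - b.card)) := by
    intro n
    have hn0 : (0 : ℝ) ≤ (n : ℝ) + 1 := by positivity
    rw [Real.volume_Icc_pi, ← ENNReal.ofReal_prod_of_nonneg]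
    · congr 1
      have h1 : ∀ j : ι, hi n j - lo n j = if (j : Fin d → ℝ) ∈ b then 1 else (n : ℝ) + 1 := by
        intro j
        simp only [hlo, hhi]
        split_ifs <;> ring
      simp only [h1]
      rw [Finset.prod_ite, Finset.prod_const_one, one_mul, Finset.prod_const]
      congr 1
      have h2 : (Finset.univ.filter fun j : ι => (j : Fin d → ℝ) ∈ b).card = b.card := by
        refine Finset.card_bij (fun j _ => (j : Fin d → ℝ)) (fun j hj => (Finset.mem_filter.1 hj).2)
          (fun _ _ _ _ h => Subtype.ext h) fun z hz => ?_
        exact ⟨⟨z, hb.subset_extend _ hz⟩, Finset.mem_filter.2 ⟨Finset.mem_univ _, hz⟩, rfl⟩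
      have h3 := Finset.card_filter_add_card_filter_not (s := (Finset.univ : Finset ι))
        (fun j : ι => (j : Fin d → ℝ) ∈ b)
      rw [h2, Finset.card_univ, hcardι] at h3
      omega
    · intro j _
      simp only [hlo, hhi]
      split_ifs <;> linarith
  have hbig : ∀ n : ℕ, ENNReal.ofReal κ ≤
      ∫⁻ y in Icc (lo n) (hi n), ENNReal.ofReal (H y) := by
    intro n
    have hn : (1 : ℝ) ≤ (n : ℝ) + 1 := by linarith [Nat.cast_nonneg (α := ℝ) n]
    have hn0 : (0 : ℝ) < (n : ℝ) + 1 := by linarith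
    calc ENNReal.ofReal κ ≤ ENNReal.ofReal
          ((κ * ((n : ℝ) + 1) ^ (-(2 * m))) * ((n : ℝ) + 1) ^ (d - b.card)) := by
          refine ENNReal.ofReal_le_ofReal ?_
          rw [mul_assoc, ← Real.rpow_natCast, ← Real.rpow_add hn0, Nat.cast_sub hbd.le]
          exact le_mul_of_one_le_right (Real.exp_nonneg _)
            (Real.one_le_rpow hn (by linarith))
      _ = ENNReal.ofReal (κ * ((n : ℝ) + 1) ^ (-(2 * m))) * volume (Icc (lo n) (hi n)) := by
          rw [hvol, ENNReal.ofReal_mul (mul_nonneg (Real.exp_nonneg _) (Real.rpow_nonneg hn0.le _))]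
      _ = ∫⁻ y in Icc (lo n) (hi n), ENNReal.ofReal (κ * ((n : ℝ) + 1) ^ (-(2 * m))) := by
          rw [setLIntegral_const]
      _ ≤ _ := setLIntegral_mono' measurableSet_Icc fun y hy =>
          ENNReal.ofReal_le_ofReal (hlow n y hy)
  obtain ⟨j₀, hj₀⟩ : ∃ j : ι, (j : Fin d → ℝ) ∉ b := by
    by_contra! hall
    have : Fintype.card ι ≤ b.card := by
      rw [← Fintype.card_coe]
      exact Fintype.card_le_of_injective (fun j : ι => (⟨j, hall j⟩ : b))
        fun _ _ h => Subtype.ext (congrArg (fun z : b => (z : Fin d → ℝ)) h)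
    omega
  -- as `b` is not a basis, each point lies in finitely many boxes only
  have hlim : Tendsto (fun n : ℕ => ∫⁻ y in Icc (lo n) (hi n), ENNReal.ofReal (H y)) atTop
      (𝓝 (∫⁻ _ : ι → ℝ, 0)) := by
    have hind : (fun n : ℕ => ∫⁻ y in Icc (lo n) (hi n), ENNReal.ofReal (H y)) =
        fun n : ℕ => ∫⁻ y, (Icc (lo n) (hi n)).indicator (fun y => ENNReal.ofReal (H y)) y := by
      funext n
      rw [lintegral_indicator measurableSet_Icc]
    rw [hind]
    refine tendsto_lintegral_of_dominated_convergence (fun y => ENNReal.ofReal (H y))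
      (fun n => hHc.measurable.ennreal_ofReal.indicator measurableSet_Icc)
      (fun n => Eventually.of_forall fun y => indicator_le_self _ _ _) hHfin
      (Eventually.of_forall fun y => ?_)
    obtain ⟨N, hN⟩ := exists_nat_gt (y j₀)
    refine tendsto_const_nhds.congr' ?_
    filter_upwards [eventually_ge_atTop N] with n hn
    rw [indicator_of_notMem]
    intro hy
    have h1 := hy.1 j₀
    simp only [hlo, hj₀, if_false] at h1
    have h2 : (N : ℝ) ≤ n := by exact_mod_cast hn
    linarith
  rw [lintegral_zero] at hlim
  have := ge_of_tendsto' hlim hbig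
  rw [nonpos_iff_eq_zero, ENNReal.ofReal_eq_zero, not_lt.symm] at this
  exact this (Real.exp_pos _)

end Necessary

/-! ### A weighted `L²` bound that is stable under perturbation of the atoms -/

section UniformBound

open Set

variable {d : ℕ}

lemma one_add_sq_pos (r : ℝ) : 0 < 1 + r ^ 2 := by positivity

/-- The one-dimensional integral `∫ (1 + y²)^{-Λ} dy`. -/
def rpowIntegral (Λ : ℝ) : ℝ := ∫ y : ℝ, (1 + y ^ 2) ^ (-Λ)

lemma integrable_one_add_sq_rpow {Λ : ℝ} (hΛ : 1 / 2 < Λ) :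
    Integrable fun y : ℝ => (1 + y ^ 2) ^ (-Λ) := by
  have := integrable_rpow_neg_one_add_norm_sq (E := ℝ) (μ := volume) (r := 2 * Λ)
    (by simp; linarith)
  convert this using 2 with y
  rw [Real.norm_eq_abs, sq_abs]
  congr 1
  ring

lemma lintegral_prod_one_add_sq_rpow {v : Fin d → Fin d → ℝ} (hv : (Matrix.of v).det ≠ 0) {Λ : ℝ}
    (hΛ : 1 / 2 < Λ) :
    ∫⁻ t, ENNReal.ofReal (∏ i, (1 + (v i ⬝ᵥ t) ^ 2) ^ (-Λ)) =
      ENNReal.ofReal |(Matrix.of v).det⁻¹| * ENNReal.ofReal (rpowIntegral Λ ^ d) := by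
  have hc : Continuous fun y : Fin d → ℝ => ∏ i, (1 + (y i) ^ 2) ^ (-Λ) :=
    continuous_finsetProd _ fun i _ => Continuous.rpow_const (by fun_prop)
      fun y => Or.inl (one_add_sq_pos _).ne'
  have h1 : ∫⁻ y : Fin d → ℝ, ENNReal.ofReal (∏ i, (1 + (y i) ^ 2) ^ (-Λ)) =
      ENNReal.ofReal (rpowIntegral Λ ^ d) := by
    rw [← ofReal_integral_eq_lintegral_ofReal]
    · congr 1
      rw [integral_fintype_prod_volume_eq_pow (fun y : ℝ => (1 + y ^ 2) ^ (-Λ)), Fintype.card_fin,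
        rpowIntegral]
    · exact Integrable.fintype_prod (f := fun (_ : Fin d) (y : ℝ) => (1 + y ^ 2) ^ (-Λ))
        fun _ => integrable_one_add_sq_rpow hΛ
    · exact Eventually.of_forall fun y => Finset.prod_nonneg fun i _ =>
        Real.rpow_nonneg (one_add_sq_pos _).le _
  have h2 := Real.map_matrix_volume_pi_eq_smul_volume_pi hv
  rw [← h1, ← smul_eq_mul, ← lintegral_smul_measure, ← h2,
    lintegral_map hc.measurable.ennreal_ofReal
      (LinearMap.continuous_of_finiteDimensional _).measurable]
  rfl

/-- Families close to a basis have determinants bounded below and are uniformly coercive. -/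
lemma eventually_perturbed_basis {v₀ : Fin d → Fin d → ℝ} (hv₀ : LinearIndependent ℝ v₀) :
    ∀ᶠ δ in 𝓝[>] (0 : ℝ), ∀ v : Fin d → Fin d → ℝ, (∀ i, dist (v i) (v₀ i) < δ) →
      δ ≤ |(Matrix.of v).det| ∧ ∀ t, δ * ‖t‖ ≤ ‖fun i => v i ⬝ᵥ t‖ := by
  have hunit : IsUnit (Matrix.of v₀) := Matrix.linearIndependent_rows_iff_isUnit.1 hv₀
  have hdet : (Matrix.of v₀).det ≠ 0 := ((Matrix.isUnit_iff_isUnit_det _).1 hunit).ne_zero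
  have hinj : Function.Injective (Matrix.mulVecLin (Matrix.of v₀)) :=
    Matrix.mulVec_injective_of_isUnit hunit
  obtain ⟨K, hK0, hK⟩ := LinearMap.exists_antilipschitzWith (Matrix.mulVecLin (Matrix.of v₀))
    (LinearMap.ker_eq_bot.2 hinj)
  have hK0' : (0 : ℝ) < K := hK0
  have hlow : ∀ t : Fin d → ℝ, (K : ℝ)⁻¹ * ‖t‖ ≤ ‖fun i => v₀ i ⬝ᵥ t‖ := by
    intro t
    have h1 := hK.le_mul_dist t 0
    simp only [dist_zero_right, map_zero] at h1
    rw [inv_mul_le_iff₀ hK0']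
    exact h1
  have hcont : Continuous fun v : Fin d → Fin d → ℝ => |(Matrix.of v).det| := by
    refine continuous_abs.comp (Continuous.matrix_det ?_)
    exact continuous_id
  have hev := (hcont.tendsto v₀).eventually_const_lt
    (show |(Matrix.of v₀).det| / 2 < |(Matrix.of v₀).det| by
      have := abs_pos.2 hdet; linarith)
  obtain ⟨r, hr0, hr⟩ := Metric.eventually_nhds_iff.1 hev
  set m := min r (min (|(Matrix.of v₀).det| / 2) ((K : ℝ)⁻¹ / (d + 1))) with hm
  have hm0 : 0 < m := lt_min hr0 (lt_min (by have := abs_pos.2 hdet; linarith) (by positivity))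
  filter_upwards [Ioo_mem_nhdsGT hm0] with δ hδ v hv
  have hδr : δ < r := hδ.2.trans_le (min_le_left _ _)
  have hδd : δ < |(Matrix.of v₀).det| / 2 :=
    hδ.2.trans_le ((min_le_right _ _).trans (min_le_left _ _))
  have hδK : δ < (K : ℝ)⁻¹ / (d + 1) :=
    hδ.2.trans_le ((min_le_right _ _).trans (min_le_right _ _))
  constructor
  · have : dist v v₀ < r := (dist_pi_lt_iff hr0).2 fun i => (hv i).trans hδr
    exact hδd.le.trans (hr this).le
  · intro t
    have hdiff : ‖fun i => (v i - v₀ i) ⬝ᵥ t‖ ≤ d * δ * ‖t‖ := by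
      refine (pi_norm_le_iff_of_nonneg (by have := hδ.1.le; positivity)).2 fun i => ?_
      rw [Real.norm_eq_abs, dotProduct]
      refine (Finset.abs_sum_le_sum_abs _ _).trans ?_
      calc ∑ j, |(v i - v₀ i) j * t j| ≤ ∑ _j : Fin d, δ * ‖t‖ := by
            refine Finset.sum_le_sum fun j _ => ?_
            rw [abs_mul]
            have h1 : |(v i - v₀ i) j| ≤ δ := by
              have := norm_le_pi_norm (v i - v₀ i) j
              rw [← dist_eq_norm] at this
              exact this.trans (hv i).le
            have h2 : |t j| ≤ ‖t‖ := norm_le_pi_norm t j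
            exact mul_le_mul h1 h2 (abs_nonneg _) hδ.1.le
        _ = d * δ * ‖t‖ := by
            rw [Finset.sum_const, Finset.card_univ, Fintype.card_fin, nsmul_eq_mul]; ring
    have htri : ‖fun i => v₀ i ⬝ᵥ t‖ ≤ ‖fun i => v i ⬝ᵥ t‖ + ‖fun i => (v i - v₀ i) ⬝ᵥ t‖ := by
      have : (fun i => v₀ i ⬝ᵥ t) = (fun i => v i ⬝ᵥ t) - fun i => (v i - v₀ i) ⬝ᵥ t := by
        funext i
        simp [sub_dotProduct]
      rw [this]
      exact norm_sub_le _ _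
    have h1 := hlow t
    have h2 : δ * (d + 1) ≤ (K : ℝ)⁻¹ := by
      rw [lt_div_iff₀ (by positivity)] at hδK
      exact hδK.le
    have h3 := mul_le_mul_of_nonneg_right h2 (norm_nonneg t)
    nlinarith

lemma one_add_norm_sq_le_prod (z : Fin d → ℝ) : 1 + ‖z‖ ^ 2 ≤ ∏ i, (1 + z i ^ 2) := by
  have hge : ∀ i, 1 ≤ 1 + z i ^ 2 := fun i => by nlinarith [sq_nonneg (z i)]
  have h0 : ∀ s : Finset (Fin d), 1 ≤ ∏ i ∈ s, (1 + z i ^ 2) := fun s => by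
    simpa using Finset.prod_le_prod (s := s) (f := fun _ => (1 : ℝ)) (fun _ _ => zero_le_one)
      fun i _ => hge i
  have h1 : ∀ i, 1 + z i ^ 2 ≤ ∏ i, (1 + z i ^ 2) := fun i => by
    rw [← Finset.mul_prod_erase _ _ (Finset.mem_univ i)]
    exact le_mul_of_one_le_right (one_add_sq_pos _).le (h0 _)
  have h2 : ‖z‖ ≤ √(∏ i, (1 + z i ^ 2) - 1) := by
    refine (pi_norm_le_iff_of_nonneg (Real.sqrt_nonneg _)).2 fun i => ?_
    refine Real.le_sqrt_of_sq_le ?_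
    rw [Real.norm_eq_abs, sq_abs]
    linarith [h1 i]
  have h3 := pow_le_pow_left₀ (norm_nonneg z) h2 2
  rw [Real.sq_sqrt (by linarith [h0 Finset.univ])] at h3
  linarith

/-- The ordered bases of `ℝ^d` with members in `S`. -/
def orderedBases (S : Finset (Fin d → ℝ)) : Finset (Fin d → Fin d → ℝ) :=
  open scoped Classical in
  (Fintype.piFinset fun _ => S).filter fun v => LinearIndependent ℝ v

lemma mem_orderedBases {S : Finset (Fin d → ℝ)} {v : Fin d → Fin d → ℝ} :
    v ∈ orderedBases S ↔ (∀ i, v i ∈ S) ∧ LinearIndependent ℝ v := by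
  simp [orderedBases]

/-- The points of `S'` at distance less than `ε` from `y`, in the sup norm. -/
def nearPoints (S' : Finset (Fin d → ℝ)) (ε : ℝ) (y : Fin d → ℝ) : Finset (Fin d → ℝ) :=
  open scoped Classical in
  S'.filter fun x => dist x y < ε

lemma mem_nearPoints {S' : Finset (Fin d → ℝ)} {ε : ℝ} {x y : Fin d → ℝ} :
    x ∈ nearPoints S' ε y ↔ x ∈ S' ∧ dist x y < ε := by
  simp [nearPoints]

/-- Conditions on a small `ε` that make the weighted bound work for every atomic measure that is
`ε`-close to the one with atoms `S` and masses `a`: after the loss of `ε` from each mass, the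
hypothesis of the greedy algorithm holds with a constant larger than `1 / 2`; the `ε`-balls around
the atoms are disjoint; and bases of atoms remain bases, with uniform bounds, when their members
are moved by less than `ε`. -/
structure IsAdmissible (S : Finset (Fin d → ℝ)) (a : (Fin d → ℝ) → ℝ) (ε : ℝ) : Prop where
  pos : 0 < ε
  lt_mass : ∀ y ∈ S, ε < a y
  mass : ∀ b ⊆ S, LinearIndepOn ℝ id (b : Set (Fin d → ℝ)) → b.card < d →
    (1 / 2 + ε) * ((d : ℝ) - b.card) ≤ massOffSpan S (fun y => a y - ε) b
  separated : ∀ y ∈ S, ∀ z ∈ S, y ≠ z → 2 * ε ≤ dist y z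
  coercive : ∀ v₀ ∈ orderedBases S, ∀ v : Fin d → Fin d → ℝ, (∀ i, dist (v i) (v₀ i) < ε) →
    ε ≤ |(Matrix.of v).det| ∧ ∀ t, ε * ‖t‖ ≤ ‖fun i => v i ⬝ᵥ t‖

/-- The conditions are finite in number, and each of them holds for all small `ε > 0`. -/
lemma exists_isAdmissible {S : Finset (Fin d → ℝ)} {a : (Fin d → ℝ) → ℝ}
    (ha : ∀ y ∈ S, 0 < a y)
    (hS : ∀ b ⊆ S, LinearIndepOn ℝ id (b : Set (Fin d → ℝ)) → b.card < d →
      ((d : ℝ) - b.card) / 2 < massOffSpan S a b) : ∃ ε, IsAdmissible S a ε := by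
  have lt_of_continuous : ∀ {F G : ℝ → ℝ}, Continuous F → Continuous G → F 0 < G 0 →
      ∀ᶠ ε in 𝓝[>] (0 : ℝ), F ε < G ε := fun hF hG h =>
    ((hF.tendsto 0).eventually_lt (hG.tendsto 0) h).filter_mono nhdsWithin_le_nhds
  have e1 : ∀ᶠ ε in 𝓝[>] (0 : ℝ), ∀ y ∈ S, ε < a y :=
    (Filter.eventually_all_finset S).2 fun y hy =>
      lt_of_continuous continuous_id continuous_const (ha y hy)
  have e2 : ∀ᶠ ε in 𝓝[>] (0 : ℝ), ∀ b ∈ S.powerset, LinearIndepOn ℝ id (b : Set (Fin d → ℝ)) →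
      b.card < d → (1 / 2 + ε) * ((d : ℝ) - b.card) < massOffSpan S (fun y => a y - ε) b := by
    refine (Filter.eventually_all_finset _).2 fun b hb => ?_
    by_cases h : LinearIndepOn ℝ id (b : Set (Fin d → ℝ)) ∧ b.card < d
    · have hlt := hS b (Finset.mem_powerset.1 hb) h.1 h.2
      filter_upwards [lt_of_continuous (F := fun ε => (1 / 2 + ε) * ((d : ℝ) - b.card))
        (G := fun ε => massOffSpan S (fun y => a y - ε) b) (by fun_prop)
        (by unfold massOffSpan; fun_prop) (by simp only [add_zero, sub_zero]; linarith)] with ε hε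
      exact fun _ _ => hε
    · exact Eventually.of_forall fun ε h1 h2 => absurd ⟨h1, h2⟩ h
  have e3 : ∀ᶠ ε in 𝓝[>] (0 : ℝ), ∀ y ∈ S, ∀ z ∈ S, y ≠ z → 2 * ε < dist y z := by
    refine (Filter.eventually_all_finset S).2 fun y _ =>
      (Filter.eventually_all_finset S).2 fun z _ => ?_
    by_cases h : y = z
    · exact Eventually.of_forall fun ε h' => absurd h h'
    · filter_upwards [lt_of_continuous (F := fun ε => 2 * ε) (G := fun _ => dist y z)
        (by fun_prop) continuous_const (by simpa using h)] with ε hε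
      exact fun _ => hε
  have e4 := (Filter.eventually_all_finset (l := 𝓝[>] (0 : ℝ)) (orderedBases S)).2
    fun v₀ hv₀ => eventually_perturbed_basis (mem_orderedBases.1 hv₀).2
  obtain ⟨ε, h0, h1, h2, h3, h4⟩ :=
    (eventually_mem_nhdsWithin.and (e1.and (e2.and (e3.and e4)))).exists
  exact ⟨ε, h0, h1, fun b hb hli hc => (h2 b (Finset.mem_powerset.2 hb) hli hc).le,
    fun y hy z hz hyz => (h3 y hy z hz hyz).le, h4⟩

variable {S S' : Finset (Fin d → ℝ)} {a a' : (Fin d → ℝ) → ℝ} {ε : ℝ}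

/-- The mass of `a'` near `y`. -/
def nearMass (S' : Finset (Fin d → ℝ)) (a' : (Fin d → ℝ) → ℝ) (ε : ℝ) (y : Fin d → ℝ) : ℝ :=
  ∑ x ∈ nearPoints S' ε y, a' x

/-- The average of `log (1 + ⟨x, t⟩²)` over the points `x` near `y`. -/
def avgLog (S' : Finset (Fin d → ℝ)) (a' : (Fin d → ℝ) → ℝ) (ε : ℝ) (t y : Fin d → ℝ) : ℝ :=
  ∑ x ∈ nearPoints S' ε y, a' x / nearMass S' a' ε y * Real.log (1 + (x ⬝ᵥ t) ^ 2)

lemma nearMass_pos (hε : IsAdmissible S a ε)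
    (hclose : ∀ y ∈ S, a y - ε ≤ nearMass S' a' ε y) {y : Fin d → ℝ} (hy : y ∈ S) :
    0 < nearMass S' a' ε y := (sub_pos.2 (hε.lt_mass y hy)).trans_le (hclose y hy)

lemma nearPoints_weight_nonneg (hε : IsAdmissible S a ε) (ha' : ∀ x ∈ S', 0 ≤ a' x)
    (hclose : ∀ y ∈ S, a y - ε ≤ nearMass S' a' ε y) {x y : Fin d → ℝ} (hy : y ∈ S)
    (hx : x ∈ nearPoints S' ε y) : 0 ≤ a' x / nearMass S' a' ε y :=
  div_nonneg (ha' x (mem_nearPoints.1 hx).1) (nearMass_pos hε hclose hy).le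

lemma sum_nearPoints_weight (hε : IsAdmissible S a ε)
    (hclose : ∀ y ∈ S, a y - ε ≤ nearMass S' a' ε y) {y : Fin d → ℝ} (hy : y ∈ S) :
    ∑ x ∈ nearPoints S' ε y, a' x / nearMass S' a' ε y = 1 := by
  rw [← Finset.sum_div]
  exact div_self (nearMass_pos hε hclose hy).ne'

lemma avgLog_nonneg (hε : IsAdmissible S a ε) (ha' : ∀ x ∈ S', 0 ≤ a' x)
    (hclose : ∀ y ∈ S, a y - ε ≤ nearMass S' a' ε y) (t : Fin d → ℝ) {y : Fin d → ℝ}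
    (hy : y ∈ S) : 0 ≤ avgLog S' a' ε t y :=
  Finset.sum_nonneg fun _ hx => mul_nonneg (nearPoints_weight_nonneg hε ha' hclose hy hx)
    (log_one_add_sq_nonneg _)

/-- The balls around the atoms are disjoint, so that no point is counted twice. -/
lemma sum_mul_avgLog_le_logMod (hε : IsAdmissible S a ε) (ha' : ∀ x ∈ S', 0 ≤ a' x)
    (hclose : ∀ y ∈ S, a y - ε ≤ nearMass S' a' ε y) (t : Fin d → ℝ) :
    ∑ y ∈ S, (a y - ε) * avgLog S' a' ε t y ≤ logMod S' a' t := by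
  classical
  have hdisj : Set.PairwiseDisjoint (S : Set (Fin d → ℝ)) (nearPoints S' ε) := by
    intro y hy z hz hyz
    refine Finset.disjoint_left.2 fun x hxy hxz => ?_
    have h1 := (mem_nearPoints.1 hxy).2
    have h2 := (mem_nearPoints.1 hxz).2
    have h3 := hε.separated y hy z hz hyz
    have h4 := dist_triangle_left y z x
    linarith
  calc ∑ y ∈ S, (a y - ε) * avgLog S' a' ε t y
      ≤ ∑ y ∈ S, nearMass S' a' ε y * avgLog S' a' ε t y :=
        Finset.sum_le_sum fun y hy =>
          mul_le_mul_of_nonneg_right (hclose y hy) (avgLog_nonneg hε ha' hclose t hy)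
    _ = ∑ y ∈ S, ∑ x ∈ nearPoints S' ε y, a' x * Real.log (1 + (x ⬝ᵥ t) ^ 2) := by
        refine Finset.sum_congr rfl fun y hy => ?_
        rw [avgLog, Finset.mul_sum]
        refine Finset.sum_congr rfl fun x _ => ?_
        have := (nearMass_pos hε hclose hy).ne'
        field_simp
    _ = ∑ x ∈ S.biUnion (nearPoints S' ε), a' x * Real.log (1 + (x ⬝ᵥ t) ^ 2) :=
        (Finset.sum_biUnion hdisj).symm
    _ ≤ logMod S' a' t := by
        refine Finset.sum_le_sum_of_subset_of_nonneg ?_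
          fun x hx _ => mul_nonneg (ha' x hx) (log_one_add_sq_nonneg _)
        exact Finset.biUnion_subset.2 fun y _ x hx => (mem_nearPoints.1 hx).1

/-- Jensen's inequality for `exp` and the probability weights `a' x / nearMass S' a' ε y`. -/
lemma exp_neg_avgLog_le (hε : IsAdmissible S a ε) (ha' : ∀ x ∈ S', 0 ≤ a' x)
    (hclose : ∀ y ∈ S, a y - ε ≤ nearMass S' a' ε y) (t : Fin d → ℝ) {y : Fin d → ℝ}
    (hy : y ∈ S) (Λ : ℝ) : Real.exp (-(Λ * avgLog S' a' ε t y)) ≤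
      ∑ x ∈ nearPoints S' ε y, a' x / nearMass S' a' ε y * (1 + (x ⬝ᵥ t) ^ 2) ^ (-Λ) := by
  have h := convexOn_exp.map_sum_le (t := nearPoints S' ε y)
    (w := fun x => a' x / nearMass S' a' ε y)
    (p := fun x => -(Λ * Real.log (1 + (x ⬝ᵥ t) ^ 2)))
    (fun x hx => nearPoints_weight_nonneg hε ha' hclose hy hx)
    (sum_nearPoints_weight hε hclose hy) (fun _ _ => mem_univ _)
  simp only [smul_eq_mul] at h
  refine le_trans (le_of_eq ?_) (h.trans (le_of_eq ?_))
  · congr 1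
    rw [avgLog, Finset.mul_sum, ← Finset.sum_neg_distrib]
    exact Finset.sum_congr rfl fun x _ => by ring
  · refine Finset.sum_congr rfl fun x _ => ?_
    rw [Real.rpow_def_of_pos (one_add_sq_pos _)]
    congr 2
    ring

/-- The greedy algorithm, with `avgLog` as the weight of the atoms. -/
lemma exists_orderedBasis_exp_le (hε : IsAdmissible S a ε) (ha' : ∀ x ∈ S', 0 ≤ a' x)
    (hclose : ∀ y ∈ S, a y - ε ≤ nearMass S' a' ε y) (t : Fin d → ℝ) :
    ∃ v ∈ orderedBases S, Real.exp (-logMod S' a' t) ≤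
      ∏ i, Real.exp (-((1 / 2 + ε) * avgLog S' a' ε t (v i))) := by
  have hΛ : 0 < 1 / 2 + ε := by have := hε.pos; linarith
  have hA : ∀ y ∈ S, 0 ≤ a y - ε := fun y hy => (sub_pos.2 (hε.lt_mass y hy)).le
  obtain ⟨b, hbS, -, hbli, hbc, hb⟩ := exists_basis_mul_sum_le hΛ hA
    hε.mass ∅ (Finset.empty_subset _) (by simp) (avgLog S' a' ε t)
    (fun y hy _ => avgLog_nonneg hε ha' hclose t hy)
  have step : (1 / 2 + ε) * ∑ y ∈ b, avgLog S' a' ε t y ≤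
      ∑ y ∈ S, (a y - ε) * avgLog S' a' ε t y := by
    rw [Finset.sdiff_empty] at hb
    refine hb.trans ?_
    classical
    unfold massOffSpan
    exact Finset.sum_le_sum_of_subset_of_nonneg (fun y hy => (Finset.mem_filter.1 hy).1)
      fun y hy _ => mul_nonneg (hA y hy) (avgLog_nonneg hε ha' hclose t hy)
  refine ⟨fun i => (((b.equivFinOfCardEq hbc).symm i : b) : Fin d → ℝ),
    mem_orderedBases.2 ⟨fun i => hbS ((b.equivFinOfCardEq hbc).symm i).2, ?_⟩, ?_⟩
  · exact LinearIndependent.comp (v := fun x : b => (x : Fin d → ℝ)) hbli _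
      (b.equivFinOfCardEq hbc).symm.injective
  · rw [← Real.exp_sum]
    refine Real.exp_le_exp.2 ?_
    have hsum : ∑ y ∈ b, avgLog S' a' ε t y =
        ∑ i, avgLog S' a' ε t (((b.equivFinOfCardEq hbc).symm i : b) : Fin d → ℝ) := by
      rw [← Finset.sum_coe_sort b (avgLog S' a' ε t), ← (b.equivFinOfCardEq hbc).symm.sum_comp]
    rw [Finset.sum_neg_distrib, ← Finset.mul_sum, ← hsum]
    linarith [sum_mul_avgLog_le_logMod hε ha' hclose t]

/-- The pointwise bound behind the uniform integrability: after the greedy algorithm has selected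
`d` of the atoms of `ν`, the mass of `ν'` near each of them is averaged by Jensen's inequality. -/
lemma exp_neg_logMod_le (hε : IsAdmissible S a ε) (ha' : ∀ x ∈ S', 0 ≤ a' x)
    (hclose : ∀ y ∈ S, a y - ε ≤ nearMass S' a' ε y) (t : Fin d → ℝ) :
    Real.exp (-logMod S' a' t) ≤ ∑ v ∈ orderedBases S,
      ∑ x ∈ Fintype.piFinset fun i => nearPoints S' ε (v i),
        (∏ i, a' (x i) / nearMass S' a' ε (v i)) *
          ∏ i, (1 + (x i ⬝ᵥ t) ^ 2) ^ (-(1 / 2 + ε)) := by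
  obtain ⟨v₀, hv₀, hle⟩ := exists_orderedBasis_exp_le hε ha' hclose t
  have hv₀S := (mem_orderedBases.1 hv₀).1
  have h1 : ∏ i, Real.exp (-((1 / 2 + ε) * avgLog S' a' ε t (v₀ i))) ≤
      ∏ i, ∑ x ∈ nearPoints S' ε (v₀ i), a' x / nearMass S' a' ε (v₀ i) *
        (1 + (x ⬝ᵥ t) ^ 2) ^ (-(1 / 2 + ε)) :=
    Finset.prod_le_prod (fun i _ => Real.exp_nonneg _)
      fun i _ => exp_neg_avgLog_le hε ha' hclose t (hv₀S i) _
  rw [Finset.prod_univ_sum] at h1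
  simp only [Finset.prod_mul_distrib] at h1
  refine (hle.trans h1).trans ?_
  refine Finset.single_le_sum (f := fun v : Fin d → Fin d → ℝ =>
    ∑ x ∈ Fintype.piFinset fun i => nearPoints S' ε (v i),
      (∏ i, a' (x i) / nearMass S' a' ε (v i)) *
        ∏ i, (1 + (x i ⬝ᵥ t) ^ 2) ^ (-(1 / 2 + ε))) (fun v hv => ?_) hv₀
  refine Finset.sum_nonneg fun x hx => mul_nonneg (Finset.prod_nonneg fun i _ => ?_)
    (Finset.prod_nonneg fun i _ => Real.rpow_nonneg (one_add_sq_pos _).le _)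
  exact nearPoints_weight_nonneg hε ha' hclose ((mem_orderedBases.1 hv).1 i)
    (Fintype.mem_piFinset.1 hx i)

/-- Half of the surplus `ε` of the exponents over `1 / 2` pays for the weight, the other half for
integrability. -/
lemma weight_mul_prod_le (hε : 0 < ε) {x : Fin d → Fin d → ℝ} {t : Fin d → ℝ}
    (h : ε * ‖t‖ ≤ ‖fun i => x i ⬝ᵥ t‖) :
    (1 + (ε * ‖t‖) ^ 2) ^ (ε / 2) * ∏ i, (1 + (x i ⬝ᵥ t) ^ 2) ^ (-(1 / 2 + ε)) ≤
      ∏ i, (1 + (x i ⬝ᵥ t) ^ 2) ^ (-(1 / 2 + ε / 2)) := by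
  have h1 : (1 + (ε * ‖t‖) ^ 2) ^ (ε / 2) ≤ ∏ i, (1 + (x i ⬝ᵥ t) ^ 2) ^ (ε / 2) := by
    rw [Real.finsetProd_rpow _ _ fun i _ => (one_add_sq_pos _).le]
    refine Real.rpow_le_rpow (by positivity) ?_ (by positivity)
    refine le_trans ?_ (one_add_norm_sq_le_prod fun i => x i ⬝ᵥ t)
    have := pow_le_pow_left₀ (mul_nonneg hε.le (norm_nonneg t)) h 2
    linarith
  refine (mul_le_mul_of_nonneg_right h1 (Finset.prod_nonneg fun i _ =>
    Real.rpow_nonneg (one_add_sq_pos _).le _)).trans (le_of_eq ?_)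
  rw [← Finset.prod_mul_distrib]
  refine Finset.prod_congr rfl fun i _ => ?_
  rw [← Real.rpow_add (one_add_sq_pos _)]
  congr 1
  ring

/-- The constant of the uniform weighted bound. -/
def uniformConst (S : Finset (Fin d → ℝ)) (ε : ℝ) : ℝ≥0∞ :=
  (orderedBases S).card * (ENNReal.ofReal ε⁻¹ * ENNReal.ofReal (rpowIntegral (1 / 2 + ε / 2) ^ d))

lemma uniformConst_ne_top (S : Finset (Fin d → ℝ)) (ε : ℝ) : uniformConst S ε ≠ ⊤ :=
  ENNReal.mul_ne_top (ENNReal.natCast_ne_top _)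
    (ENNReal.mul_ne_top ENNReal.ofReal_ne_top ENNReal.ofReal_ne_top)

/-- A weighted `L¹` bound on the squared characteristic functions, uniform over all atomic Thorin
measures that carry enough mass near each atom of `ν`. -/
theorem lintegral_weight_mul_exp_neg_logMod_le (hε : IsAdmissible S a ε)
    (ha' : ∀ x ∈ S', 0 ≤ a' x)
    (hclose : ∀ y ∈ S, a y - ε ≤ nearMass S' a' ε y) :
    ∫⁻ t, ENNReal.ofReal ((1 + (ε * ‖t‖) ^ 2) ^ (ε / 2) * Real.exp (-logMod S' a' t)) ≤
      uniformConst S ε := by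
  set N := nearPoints S' ε with hN
  set W : (Fin d → Fin d → ℝ) → (Fin d → Fin d → ℝ) → ℝ :=
    fun v x => ∏ i, a' (x i) / nearMass S' a' ε (v i) with hW
  set G : (Fin d → Fin d → ℝ) → (Fin d → ℝ) → ℝ :=
    fun x t => ∏ i, (1 + (x i ⬝ᵥ t) ^ 2) ^ (-(1 / 2 + ε / 2)) with hG
  have hG0 : ∀ x t, 0 ≤ G x t := fun x t =>
    Finset.prod_nonneg fun i _ => Real.rpow_nonneg (one_add_sq_pos _).le _
  have hGm : ∀ x, Measurable (G x) := by
    intro x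
    refine Continuous.measurable (continuous_finsetProd _ fun i _ => ?_)
    refine Continuous.rpow_const ?_ fun y => Or.inl (one_add_sq_pos _).ne'
    unfold dotProduct
    fun_prop
  have hW0 : ∀ v ∈ orderedBases S, ∀ x ∈ Fintype.piFinset fun i => N (v i), 0 ≤ W v x :=
    fun v hv x hx => Finset.prod_nonneg fun i _ =>
      nearPoints_weight_nonneg hε ha' hclose ((mem_orderedBases.1 hv).1 i)
        (Fintype.mem_piFinset.1 hx i)
  have hnear : ∀ (v : Fin d → Fin d → ℝ), ∀ x ∈ Fintype.piFinset fun i => N (v i),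
      ∀ i, dist (x i) (v i) < ε := fun v x hx i =>
    (mem_nearPoints.1 (Fintype.mem_piFinset.1 hx i)).2
  have hpt : ∀ t, ENNReal.ofReal ((1 + (ε * ‖t‖) ^ 2) ^ (ε / 2) * Real.exp (-logMod S' a' t)) ≤
      ∑ v ∈ orderedBases S, ∑ x ∈ Fintype.piFinset fun i => N (v i),
        ENNReal.ofReal (W v x) * ENNReal.ofReal (G x t) := by
    intro t
    have hwt : (0 : ℝ) ≤ (1 + (ε * ‖t‖) ^ 2) ^ (ε / 2) := Real.rpow_nonneg (by positivity) _
    have h1 := mul_le_mul_of_nonneg_left (exp_neg_logMod_le hε ha' hclose t) hwt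
    have h2 : (1 + (ε * ‖t‖) ^ 2) ^ (ε / 2) * Real.exp (-logMod S' a' t) ≤
        ∑ v ∈ orderedBases S, ∑ x ∈ Fintype.piFinset fun i => N (v i), W v x * G x t := by
      refine h1.trans ?_
      rw [Finset.mul_sum]
      refine Finset.sum_le_sum fun v hv => ?_
      rw [Finset.mul_sum]
      refine Finset.sum_le_sum fun x hx => ?_
      rw [mul_left_comm]
      exact mul_le_mul_of_nonneg_left
        (weight_mul_prod_le hε.pos ((hε.coercive v hv x (hnear v x hx)).2 t)) (hW0 v hv x hx)
    refine (ENNReal.ofReal_le_ofReal h2).trans (le_of_eq ?_)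
    rw [ENNReal.ofReal_sum_of_nonneg fun v hv => Finset.sum_nonneg fun x hx =>
      mul_nonneg (hW0 v hv x hx) (hG0 x t)]
    refine Finset.sum_congr rfl fun v hv => ?_
    rw [ENNReal.ofReal_sum_of_nonneg fun x hx => mul_nonneg (hW0 v hv x hx) (hG0 x t)]
    exact Finset.sum_congr rfl fun x hx => ENNReal.ofReal_mul (hW0 v hv x hx)
  set c := ENNReal.ofReal ε⁻¹ * ENNReal.ofReal (rpowIntegral (1 / 2 + ε / 2) ^ d) with hc
  have hint : ∀ v ∈ orderedBases S, ∀ x ∈ Fintype.piFinset fun i => N (v i),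
      ∫⁻ t, ENNReal.ofReal (G x t) ≤ c := by
    intro v hv x hx
    have hdet := (hε.coercive v hv x (hnear v x hx)).1
    have hdet0 : 0 < |(Matrix.of x).det| := hε.pos.trans_le hdet
    rw [hG, lintegral_prod_one_add_sq_rpow (abs_pos.1 hdet0) (by have := hε.pos; linarith)]
    refine mul_le_mul_left (ENNReal.ofReal_le_ofReal ?_) _
    rw [abs_inv]
    exact inv_anti₀ hε.pos hdet
  have hWsum : ∀ v ∈ orderedBases S,
      ∑ x ∈ Fintype.piFinset fun i => N (v i), ENNReal.ofReal (W v x) = 1 := by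
    intro v hv
    rw [← ENNReal.ofReal_sum_of_nonneg (hW0 v hv), hW,
      ← Finset.prod_univ_sum (fun i => N (v i)) (fun i z => a' z / nearMass S' a' ε (v i))]
    rw [Finset.prod_eq_one, ENNReal.ofReal_one]
    exact fun i _ => sum_nearPoints_weight hε hclose ((mem_orderedBases.1 hv).1 i)
  calc _ ≤ ∫⁻ t, ∑ v ∈ orderedBases S, ∑ x ∈ Fintype.piFinset fun i => N (v i),
        ENNReal.ofReal (W v x) * ENNReal.ofReal (G x t) := lintegral_mono hpt
    _ = ∑ v ∈ orderedBases S, ∑ x ∈ Fintype.piFinset fun i => N (v i),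
        ENNReal.ofReal (W v x) * ∫⁻ t, ENNReal.ofReal (G x t) := by
        rw [lintegral_finsetSum _ fun v _ => Finset.measurable_sum _ fun x _ =>
          ((hGm x).ennreal_ofReal.const_mul _)]
        refine Finset.sum_congr rfl fun v _ => ?_
        rw [lintegral_finsetSum _ fun x _ => ((hGm x).ennreal_ofReal.const_mul _)]
        exact Finset.sum_congr rfl fun x _ => lintegral_const_mul _ (hGm x).ennreal_ofReal
    _ ≤ ∑ v ∈ orderedBases S, ∑ x ∈ Fintype.piFinset fun i => N (v i),
        ENNReal.ofReal (W v x) * c := Finset.sum_le_sum fun v hv => Finset.sum_le_sum fun x hx =>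
          mul_le_mul_right (hint v hv x hx) _
    _ = uniformConst S ε := by
        rw [Finset.sum_congr rfl fun v hv => by rw [← Finset.sum_mul, hWsum v hv, one_mul]]
        rw [Finset.sum_const, nsmul_eq_mul, uniformConst]

end UniformBound

/-! ### Convergence of Thorin moments -/

section Convergence

variable {d : ℕ}

/-- The bounded coordinates `x / (1 + |x|)`, `|x| = x₁ + ⋯ + x_d`, of a point of `ℝ_+^d`. -/
def simplexCoord (x : Fin d → ℝ) : Fin d → ℝ := fun i => x i / (1 + ∑ l, x l)

/-- The simplex `{u ≥ 0, u₁ + ⋯ + u_d ≤ 1}`. -/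
def solidSimplex (d : ℕ) : Set (Fin d → ℝ) := {u | 0 ≤ u ∧ ∑ i, u i ≤ 1}

lemma isCompact_solidSimplex (d : ℕ) : IsCompact (solidSimplex d) := by
  refine (isCompact_Icc (a := (0 : Fin d → ℝ)) (b := 1)).of_isClosed_subset ?_ ?_
  · exact (isClosed_Ici (a := (0 : Fin d → ℝ))).inter
      (isClosed_le (f := fun u : Fin d → ℝ => ∑ i, u i) (g := fun _ => (1 : ℝ))
        (by fun_prop) continuous_const)
  · rintro u ⟨h0, h1⟩
    exact ⟨h0, fun i => (Finset.single_le_sum (fun j _ => h0 j) (Finset.mem_univ i)).trans h1⟩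

lemma one_add_sum_pos {x : Fin d → ℝ} (hx : 0 ≤ x) : 0 < 1 + ∑ l, x l := by
  have := Finset.sum_nonneg fun l (_ : l ∈ Finset.univ) => hx l
  linarith

lemma sum_pos_of_ne_zero {x : Fin d → ℝ} (hx : 0 ≤ x) (h0 : x ≠ 0) : 0 < ∑ l, x l := by
  refine (Finset.sum_nonneg fun l _ => hx l).lt_of_ne fun h => h0 ?_
  funext i
  exact (Finset.sum_eq_zero_iff_of_nonneg fun l _ => hx l).1 h.symm i (Finset.mem_univ i)

lemma sum_simplexCoord (x : Fin d → ℝ) :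
    ∑ i, simplexCoord x i = (∑ l, x l) / (1 + ∑ l, x l) := by
  simp only [simplexCoord, Finset.sum_div]

lemma one_sub_sum_simplexCoord {x : Fin d → ℝ} (hx : 0 ≤ x) :
    1 - ∑ i, simplexCoord x i = (1 + ∑ l, x l)⁻¹ := by
  have := (one_add_sum_pos hx).ne'
  rw [sum_simplexCoord]
  field_simp
  ring

lemma simplexCoord_mem {x : Fin d → ℝ} (hx : 0 ≤ x) : simplexCoord x ∈ solidSimplex d := by
  refine ⟨fun i => div_nonneg (hx i) (one_add_sum_pos hx).le, ?_⟩
  have h := one_sub_sum_simplexCoord hx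
  have := inv_pos.2 (one_add_sum_pos hx)
  linarith

/-- `x` is recovered from `u = x / (1 + |x|)` as `u / (1 - |u|)`. -/
lemma inv_smul_simplexCoord {x : Fin d → ℝ} (hx : 0 ≤ x) :
    (1 - ∑ i, simplexCoord x i)⁻¹ • simplexCoord x = x := by
  have := (one_add_sum_pos hx).ne'
  rw [one_sub_sum_simplexCoord hx, inv_inv]
  funext i
  simp only [simplexCoord, Pi.smul_apply, smul_eq_mul]
  field_simp

/-- Convergence of all Thorin moments of a sequence of atomic measures, with atoms `Sm m` and
masses `am m`, to the Thorin moments of the measure with atoms `S` and masses `a`. -/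
structure ThorinTendsto (Sm : ℕ → Finset (Fin d → ℝ)) (am : ℕ → (Fin d → ℝ) → ℝ)
    (S : Finset (Fin d → ℝ)) (a : (Fin d → ℝ) → ℝ) : Prop where
  nonneg_seq : ∀ m, ∀ x ∈ Sm m, 0 ≤ x
  mass_seq : ∀ m, ∀ x ∈ Sm m, 0 ≤ am m x
  nonneg : ∀ x ∈ S, 0 ≤ x
  ne_zero : ∀ x ∈ S, x ≠ 0
  mass : ∀ x ∈ S, 0 ≤ a x
  moment : ∀ k : Fin d → ℕ, k ≠ 0 →
    Tendsto (fun m => ∑ x ∈ Sm m, am m x * ∏ i, simplexCoord x i ^ k i) atTop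
      (𝓝 (∑ x ∈ S, a x * ∏ i, simplexCoord x i ^ k i))
  log : Tendsto (fun m => ∑ x ∈ Sm m, am m x * Real.log (1 + ∑ l, x l)) atTop
    (𝓝 (∑ x ∈ S, a x * Real.log (1 + ∑ l, x l)))

variable {Sm : ℕ → Finset (Fin d → ℝ)} {am : ℕ → (Fin d → ℝ) → ℝ}
  {S : Finset (Fin d → ℝ)} {a : (Fin d → ℝ) → ℝ}

/-- The integral of `G` in simplex coordinates, against the measure with density `|u|`. The factor
`|u|` vanishes at the origin, where atoms may accumulate with infinite total mass. -/
def simplexSum (S : Finset (Fin d → ℝ)) (a : (Fin d → ℝ) → ℝ) (G : (Fin d → ℝ) → ℝ) : ℝ :=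
  ∑ x ∈ S, a x * ((∑ i, simplexCoord x i) * G (simplexCoord x))

/-- As `|u| = u₁ + ⋯ + u_d`, only moments of positive order occur. -/
lemma ThorinTendsto.simplexSum_polynomial (h : ThorinTendsto Sm am S a)
    (p : MvPolynomial (Fin d) ℝ) :
    Tendsto (fun m => simplexSum (Sm m) (am m) fun u => p.eval u) atTop
      (𝓝 (simplexSum S a fun u => p.eval u)) := by
  induction p using MvPolynomial.induction_on' with
  | monomial s c =>
    have key : ∀ (T : Finset (Fin d → ℝ)) (b : (Fin d → ℝ) → ℝ),
        simplexSum T b (fun u => (MvPolynomial.monomial s c).eval u) =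
          ∑ j, c * ∑ x ∈ T, b x *
            ∏ i, simplexCoord x i ^ (s + Finsupp.single j 1 : Fin d →₀ ℕ) i := by
      intro T b
      simp only [simplexSum, Finset.mul_sum, Finset.sum_mul]
      rw [Finset.sum_comm]
      refine Finset.sum_congr rfl fun j _ => Finset.sum_congr rfl fun x _ => ?_
      rw [MvPolynomial.eval_monomial, Finsupp.prod_fintype _ _ (by simp)]
      simp only [Finsupp.add_apply, pow_add, Finset.prod_mul_distrib]
      have : ∏ i, simplexCoord x i ^ (Finsupp.single j 1 : Fin d →₀ ℕ) i = simplexCoord x j := by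
        rw [Finset.prod_eq_single j]
        · simp
        · intro i _ hij
          simp [hij.symm]
        · simp
      rw [this]
      ring
    simp only [key]
    refine tendsto_finsetSum _ fun j _ => (h.moment _ fun h0 => ?_).const_mul c
    have := congrFun h0 j
    simp at this
  | add p q hp hq =>
    have key : ∀ (T : Finset (Fin d → ℝ)) (b : (Fin d → ℝ) → ℝ),
        simplexSum T b (fun u => (p + q).eval u) =
          simplexSum T b (fun u => p.eval u) + simplexSum T b (fun u => q.eval u) := by
      intro T b
      simp only [simplexSum, ← Finset.sum_add_distrib, map_add]
      exact Finset.sum_congr rfl fun x _ => by ring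
    simp only [key]
    exact hp.add hq

lemma exists_polynomial_near {G : (Fin d → ℝ) → ℝ} (hG : ContinuousOn G (solidSimplex d))
    {δ : ℝ} (hδ : 0 < δ) :
    ∃ p : MvPolynomial (Fin d) ℝ, ∀ u ∈ solidSimplex d, |G u - p.eval u| ≤ δ := by
  have := isCompact_iff_compactSpace.1 (isCompact_solidSimplex d)
  let coord : Fin d → C(solidSimplex d, ℝ) := fun i => 
    ⟨fun u => u.1 i, (continuous_apply i).comp continuous_subtype_val⟩
  let 𝒜 : Subalgebra ℝ C(solidSimplex d, ℝ) := (MvPolynomial.aeval coord).range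
  have hsep : 𝒜.SeparatesPoints := by
    intro u v huv
    obtain ⟨i, hi⟩ := Function.ne_iff.1 (fun e => huv (Subtype.ext e))
    exact ⟨coord i, ⟨coord i, ⟨MvPolynomial.X i, by simp⟩, rfl⟩, hi⟩
  obtain ⟨⟨g, p, hp⟩, hg⟩ := ContinuousMap.exists_mem_subalgebra_near_continuous_of_separatesPoints
    𝒜 hsep ((solidSimplex d).domRestrict G) (continuousOn_iff_continuous_domRestrict.1 hG) δ hδ
  refine ⟨p, fun u hu => ?_⟩
  have h1 := hg ⟨u, hu⟩
  have h2 : g ⟨u, hu⟩ = p.eval u := by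
    rw [← hp]
    have : ((ContinuousMap.evalAlgHom ℝ ℝ (⟨u, hu⟩ : solidSimplex d)).comp
        (MvPolynomial.aeval coord)) = MvPolynomial.aeval u := by
      ext i
      simp [coord]
    have := DFunLike.congr_fun this p
    simpa [MvPolynomial.aeval_eq_eval] using this
  rw [abs_sub_comm]
  change |g ⟨u, hu⟩ - G u| < δ at h1
  rw [h2] at h1
  exact h1.le

lemma abs_simplexSum_sub_le {T : Finset (Fin d → ℝ)} {b : (Fin d → ℝ) → ℝ}
    (hT : ∀ x ∈ T, 0 ≤ x) (hb : ∀ x ∈ T, 0 ≤ b x) {G H : (Fin d → ℝ) → ℝ} {δ : ℝ}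
    (hGH : ∀ u ∈ solidSimplex d, |G u - H u| ≤ δ) :
    |simplexSum T b G - simplexSum T b H| ≤ δ * simplexSum T b fun _ => 1 := by
  simp only [simplexSum]
  rw [← Finset.sum_sub_distrib, Finset.mul_sum]
  refine (Finset.abs_sum_le_sum_abs _ _).trans (Finset.sum_le_sum fun x hx => ?_)
  have hu := simplexCoord_mem (hT x hx)
  have h0 : 0 ≤ b x * ∑ i, simplexCoord x i :=
    mul_nonneg (hb x hx) (Finset.sum_nonneg fun i _ => hu.1 i)
  have : b x * ((∑ i, simplexCoord x i) * G (simplexCoord x)) -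
      b x * ((∑ i, simplexCoord x i) * H (simplexCoord x)) =
      (b x * ∑ i, simplexCoord x i) * (G (simplexCoord x) - H (simplexCoord x)) := by ring
  rw [this, abs_mul, abs_of_nonneg h0, mul_one, mul_comm δ]
  exact mul_le_mul_of_nonneg_left (hGH _ hu) h0

/-- By the Weierstrass theorem, convergence of the Thorin moments amounts to weak convergence of
the measures `|u| ν(du)` on the compact simplex. -/
lemma ThorinTendsto.simplexSum_tendsto (h : ThorinTendsto Sm am S a) {G : (Fin d → ℝ) → ℝ}
    (hG : ContinuousOn G (solidSimplex d)) :
    Tendsto (fun m => simplexSum (Sm m) (am m) G) atTop (𝓝 (simplexSum S a G)) := by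
  have h1 : Tendsto (fun m => simplexSum (Sm m) (am m) fun _ => 1) atTop
      (𝓝 (simplexSum S a fun _ => 1)) := by
    simpa using h.simplexSum_polynomial 1
  set M := simplexSum S a fun _ => 1 with hM
  have hM0 : 0 ≤ M := Finset.sum_nonneg fun x hx => mul_nonneg (h.mass x hx) <| by
    rw [mul_one]
    exact Finset.sum_nonneg fun i _ => (simplexCoord_mem (h.nonneg x hx)).1 i
  rw [Metric.tendsto_atTop']
  intro e he
  set δ := e / (3 * (M + 1)) with hδ
  have hδ0 : 0 < δ := by positivity
  have hδM : δ * (M + 1) = e / 3 := by rw [hδ]; field_simp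
  obtain ⟨p, hp⟩ := exists_polynomial_near hG hδ0
  have hev := (h1.eventually_lt_const (lt_add_one M)).and
    ((Metric.tendsto_nhds.1 (h.simplexSum_polynomial p)) (e / 3) (by positivity))
  obtain ⟨m₀, hm₀⟩ := eventually_atTop.1 hev
  refine ⟨m₀, fun m hm => ?_⟩
  obtain ⟨hm1, hm2⟩ := hm₀ m hm.le
  have b1 := abs_simplexSum_sub_le (h.nonneg_seq m) (h.mass_seq m) hp
  have b2 := abs_simplexSum_sub_le h.nonneg h.mass hp
  rw [Real.dist_eq] at hm2 ⊢
  have b3 : δ * simplexSum (Sm m) (am m) (fun _ => 1) < e / 3 := by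
    rw [← hδM]; exact mul_lt_mul_of_pos_left hm1 hδ0
  have b4 : δ * M < e / 3 := by
    rw [← hδM]; exact mul_lt_mul_of_pos_left (lt_add_one M) hδ0
  rw [abs_le] at b1 b2
  rw [abs_lt] at hm2 ⊢
  constructor <;> linarith [b1.1, b1.2, b2.1, b2.2, hm2.1, hm2.2]

/-- In the limit, the mass near each atom of `ν` is at least the mass of the atom. -/
lemma ThorinTendsto.eventually_nearMass (h : ThorinTendsto Sm am S a) {ε : ℝ} (hε : 0 < ε)
    {y : Fin d → ℝ} (hy : y ∈ S) :
    ∀ᶠ m in atTop, a y - ε ≤ nearMass (Sm m) (am m) ε y := by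
  set w := simplexCoord y with hw
  set s := ∑ i, w i with hs
  have hy0 := h.nonneg y hy
  have hspos : 0 < s := by
    rw [hs, sum_simplexCoord]
    exact div_pos (sum_pos_of_ne_zero hy0 (h.ne_zero y hy)) (one_add_sum_pos hy0)
  have hs1 : 1 - s ≠ 0 := by
    rw [hs, one_sub_sum_simplexCoord hy0]
    exact (inv_pos.2 (one_add_sum_pos hy0)).ne'
  have hcont : ContinuousAt (fun u : Fin d → ℝ => (1 - ∑ i, u i)⁻¹ • u) w :=
    ContinuousAt.smul (ContinuousAt.inv₀ (f := fun u : Fin d → ℝ => 1 - ∑ i, u i) (by fun_prop) hs1)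
      continuousAt_id
  obtain ⟨r, hr, hball⟩ := Metric.continuousAt_iff.1 hcont ε hε
  -- a bump function at `w`, divided by `|u|`; the maximum avoids a pole at the origin
  set G : (Fin d → ℝ) → ℝ := fun u => max 0 (1 - dist u w / r) / max (∑ i, u i) s with hG
  have hGc : Continuous G := by
    refine Continuous.div (by fun_prop) (by fun_prop) fun u => ?_
    exact (lt_max_of_lt_right hspos).ne'
  have hG0 : ∀ u, 0 ≤ G u := fun u =>
    div_nonneg (le_max_left _ _) (lt_max_of_lt_right hspos).le
  have hlim := h.simplexSum_tendsto hGc.continuousOn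
  have hlow : a y ≤ simplexSum S a G := by
    have : a y = a y * ((∑ i, simplexCoord y i) * G (simplexCoord y)) := by
      rw [← hw, ← hs, hG]
      simp only [dist_self, zero_div, sub_zero, ← hs, max_self]
      rw [max_eq_right zero_le_one]
      field_simp
    rw [this, simplexSum]
    refine Finset.single_le_sum
      (f := fun x => a x * ((∑ i, simplexCoord x i) * G (simplexCoord x))) (fun x hx => ?_) hy
    exact mul_nonneg (h.mass x hx) (mul_nonneg
      (Finset.sum_nonneg fun i _ => (simplexCoord_mem (h.nonneg x hx)).1 i) (hG0 _))
  filter_upwards [hlim.eventually_const_lt (u := a y - ε) (by linarith)] with m hm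
  refine hm.le.trans ?_
  rw [simplexSum, nearMass]
  have hsub : nearPoints (Sm m) ε y ⊆ Sm m := fun x hx => (mem_nearPoints.1 hx).1
  rw [← Finset.sum_subset hsub (f := fun x => am m x * ((∑ i, simplexCoord x i) *
    G (simplexCoord x)))]
  · refine Finset.sum_le_sum fun x hx => ?_
    have hxS := hsub hx
    refine mul_le_of_le_one_right (h.mass_seq m x hxS) ?_
    rw [hG]
    simp only
    rw [mul_div_assoc', div_le_one (lt_max_of_lt_right hspos)]
    have hu := simplexCoord_mem (h.nonneg_seq m x hxS)
    have h1 : max 0 (1 - dist (simplexCoord x) w / r) ≤ 1 :=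
      max_le zero_le_one (by have : 0 ≤ dist (simplexCoord x) w / r := by positivity
                             linarith)
    exact (mul_le_of_le_one_right (Finset.sum_nonneg fun i _ => hu.1 i) h1).trans (le_max_left _ _)
  · intro x hx hnear
    have hx0 := h.nonneg_seq m x hx
    have hd : r ≤ dist (simplexCoord x) w := by
      by_contra! hlt
      have := hball hlt
      rw [inv_smul_simplexCoord hx0, hw, inv_smul_simplexCoord hy0] at this
      exact hnear (mem_nearPoints.2 ⟨hx, this⟩)
    have : max 0 (1 - dist (simplexCoord x) w / r) = 0 := by
      refine max_eq_left ?_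
      have := (one_le_div hr).2 hd
      linarith
    rw [hG]
    simp [this]

/-- A trapezoidal cutoff function of `|u|`, equal to `1` on `[α, 1 - α]` and to `0` outside
`[α / 2, 1 - α / 2]`. -/
def cutoff (α : ℝ) (u : Fin d → ℝ) : ℝ :=
  max 0 (min 1 (2 * min (∑ i, u i) (1 - ∑ i, u i) / α - 1))

lemma cutoff_le_one (α : ℝ) (u : Fin d → ℝ) : cutoff α u ≤ 1 :=
  max_le zero_le_one (min_le_left _ _)

lemma cutoff_eq_one {α : ℝ} (hα : 0 < α) {u : Fin d → ℝ} (h0 : α ≤ ∑ i, u i)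
    (h1 : α ≤ 1 - ∑ i, u i) : cutoff α u = 1 := by
  have : 1 ≤ min (∑ i, u i) (1 - ∑ i, u i) / α := (one_le_div hα).2 (le_min h0 h1)
  rw [cutoff, mul_div_assoc, min_eq_left (by linarith), max_eq_right zero_le_one]

lemma of_cutoff_ne_zero {α : ℝ} (hα : 0 < α) {u : Fin d → ℝ} (h : cutoff α u ≠ 0) :
    α / 2 ≤ ∑ i, u i ∧ α / 2 ≤ 1 - ∑ i, u i := by
  rw [← le_min_iff]
  by_contra! hlt
  refine h (max_eq_left ((min_le_right _ _).trans ?_))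
  rw [sub_nonpos, div_le_one hα]
  linarith

lemma continuous_cutoff (α : ℝ) : Continuous (cutoff (d := d) α) := by
  unfold cutoff
  fun_prop

lemma ThorinTendsto.tendsto_sum_cutoff_mul (h : ThorinTendsto Sm am S a) {F : (Fin d → ℝ) → ℝ}
    (hF : ContinuousOn F (Set.Ici 0)) {α : ℝ} (hα : 0 < α) :
    Tendsto (fun m => ∑ x ∈ Sm m, am m x * (cutoff α (simplexCoord x) * F x)) atTop
      (𝓝 (∑ x ∈ S, a x * (cutoff α (simplexCoord x) * F x))) := by
  -- the maxima make `H` continuous up to the boundary and are inactive where `cutoff α u ≠ 0`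
  set H : (Fin d → ℝ) → ℝ := fun u => cutoff α u / max (∑ i, u i) (α / 2) *
    F ((max (1 - ∑ i, u i) (α / 2))⁻¹ • u) with hH
  have hpos : ∀ r : ℝ, 0 < max r (α / 2) := fun r => lt_max_of_lt_right (by positivity)
  have hHc : ContinuousOn H (solidSimplex d) := by
    refine ContinuousOn.mul (Continuous.continuousOn ?_) (hF.comp (Continuous.continuousOn ?_) ?_)
    · exact (continuous_cutoff α).div (by fun_prop) fun u => (hpos _).ne'
    · exact Continuous.smul (Continuous.inv₀ (by fun_prop) fun u => (hpos _).ne') continuous_id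
    · intro u hu i
      exact mul_nonneg (inv_nonneg.2 (hpos _).le) (hu.1 i)
  have key : ∀ x : Fin d → ℝ, 0 ≤ x →
      (∑ i, simplexCoord x i) * H (simplexCoord x) = cutoff α (simplexCoord x) * F x := by
    intro x hx
    simp only [hH]
    by_cases hc : cutoff α (simplexCoord x) = 0
    · simp [hc]
    obtain ⟨h1, h2⟩ := of_cutoff_ne_zero hα hc
    have : ∑ i, simplexCoord x i ≠ 0 := by linarith
    rw [max_eq_left h1, max_eq_left h2, inv_smul_simplexCoord hx]
    field_simp
  have := h.simplexSum_tendsto hHc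
  simp only [simplexSum] at this
  rw [Finset.sum_congr rfl fun x hx => by rw [key x (h.nonneg x hx)]] at this
  refine this.congr fun m => ?_
  exact Finset.sum_congr rfl fun x hx => by rw [key x (h.nonneg_seq m x hx)]

lemma ThorinTendsto.exists_cutoff (h : ThorinTendsto Sm am S a) :
    ∃ α > 0, ∀ x ∈ S, cutoff α (simplexCoord x) = 1 := by
  have hev : ∀ᶠ α in 𝓝[>] (0 : ℝ), ∀ x ∈ S,
      α ≤ ∑ i, simplexCoord x i ∧ α ≤ 1 - ∑ i, simplexCoord x i := by
    refine (Finset.eventually_all S).2 fun x hx => ?_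
    have hx0 := one_add_sum_pos (h.nonneg x hx)
    refine nhdsWithin_le_nhds ((eventually_le_nhds ?_).and (eventually_le_nhds ?_))
    · rw [sum_simplexCoord]
      exact div_pos (sum_pos_of_ne_zero (h.nonneg x hx) (h.ne_zero x hx)) hx0
    · rw [one_sub_sum_simplexCoord (h.nonneg x hx)]
      exact inv_pos.2 hx0
  obtain ⟨α, hα, hpos⟩ := (hev.and self_mem_nhdsWithin).exists
  exact ⟨α, hpos, fun x hx => cutoff_eq_one hpos (hα x hx).1 (hα x hx).2⟩

/-- Functions dominated by `log (1 + |x|)` integrate in the limit. No mass of `log (1 + |x|)` is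
lost near the origin or at infinity, because its total converges, as the Thorin moment of
order zero. -/
lemma ThorinTendsto.tendsto_sum (h : ThorinTendsto Sm am S a) {F : (Fin d → ℝ) → ℝ}
    (hF : ContinuousOn F (Set.Ici 0)) {C : ℝ}
    (hFC : ∀ x : Fin d → ℝ, 0 ≤ x → |F x| ≤ C * Real.log (1 + ∑ l, x l)) :
    Tendsto (fun m => ∑ x ∈ Sm m, am m x * F x) atTop (𝓝 (∑ x ∈ S, a x * F x)) := by
  obtain ⟨α, hα, hS⟩ := h.exists_cutoff
  have hlogc : ContinuousOn (fun x : Fin d → ℝ => Real.log (1 + ∑ l, x l)) (Set.Ici 0) :=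
    ContinuousOn.log (by fun_prop) fun x hx => (one_add_sum_pos hx).ne'
  have t1 := h.tendsto_sum_cutoff_mul hF hα
  have t2 := (h.log.sub (h.tendsto_sum_cutoff_mul hlogc hα)).const_mul C
  have e1 : ∀ g : (Fin d → ℝ) → ℝ,
      ∑ x ∈ S, a x * (cutoff α (simplexCoord x) * g x) = ∑ x ∈ S, a x * g x := fun g =>
    Finset.sum_congr rfl fun x hx => by rw [hS x hx, one_mul]
  rw [e1] at t1
  rw [e1 fun x => Real.log (1 + ∑ l, x l), sub_self, mul_zero] at t2
  have t3 : Tendsto (fun m => ∑ x ∈ Sm m, am m x * F x -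
      ∑ x ∈ Sm m, am m x * (cutoff α (simplexCoord x) * F x)) atTop (𝓝 0) := by
    refine squeeze_zero_norm (fun m => ?_) t2
    rw [Real.norm_eq_abs, ← Finset.sum_sub_distrib, ← Finset.sum_sub_distrib, Finset.mul_sum]
    refine (Finset.abs_sum_le_sum_abs _ _).trans (Finset.sum_le_sum fun x hx => ?_)
    have hc : 0 ≤ am m x * (1 - cutoff α (simplexCoord x)) :=
      mul_nonneg (h.mass_seq m x hx) (sub_nonneg.2 (cutoff_le_one _ _))
    have : am m x * F x - am m x * (cutoff α (simplexCoord x) * F x) =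
        am m x * (1 - cutoff α (simplexCoord x)) * F x := by ring
    rw [this, abs_mul, abs_of_nonneg hc]
    refine (mul_le_mul_of_nonneg_left (hFC x (h.nonneg_seq m x hx)) hc).trans (le_of_eq ?_)
    ring
  simpa using t3.add t1

lemma norm_log_one_sub_mul_I_le (y : ℝ) :
    ‖Complex.log (1 - y * Complex.I)‖ ≤ 4 * Real.log (1 + |y|) := by
  set z : ℂ := 1 - y * Complex.I with hz
  have hre : z.re = 1 := by simp [hz]
  have him : z.im = -y := by simp [hz]
  have hnorm : ‖z‖ ^ 2 = 1 + |y| ^ 2 := by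
    rw [← Complex.normSq_eq_norm_sq, Complex.normSq_apply, hre, him, sq_abs]
    ring
  have hy := abs_nonneg y
  have hz1 : 1 ≤ ‖z‖ := by nlinarith [norm_nonneg z]
  have hz2 : ‖z‖ ≤ 1 + |y| := by nlinarith [norm_nonneg z]
  have hz0 : 0 < ‖z‖ := by linarith
  have h1 : |(Complex.log z).re| ≤ Real.log (1 + |y|) := by
    rw [Complex.log_re, abs_of_nonneg (Real.log_nonneg hz1)]
    exact Real.log_le_log hz0 hz2
  have h2 : |(Complex.log z).im| ≤ 3 * Real.log (1 + |y|) := by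
    rw [Complex.log_im]
    have harg : |z.arg| ≤ Real.pi / 2 := Complex.abs_arg_le_pi_div_two_iff.2 (by rw [hre]; simp)
    -- Jordan's inequality `2 / π * |arg z| ≤ |sin (arg z)| = |y| / ‖z‖`
    have hsin := Real.mul_abs_le_abs_sin harg
    rw [Complex.sin_arg, him, abs_div, abs_neg, abs_norm, le_div_iff₀ hz0] at hsin
    have hlog := Real.one_sub_inv_le_log_of_pos (show 0 < 1 + |y| by linarith)
    refine le_trans ?_ (mul_le_mul_of_nonneg_left hlog (by norm_num))
    have e : 3 * (1 - (1 + |y|)⁻¹) = 3 * |y| / (1 + |y|) := by field_simp; ring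
    rw [e, le_div_iff₀ (by linarith)]
    have h3 : 1 + |y| ≤ 3 / 2 * ‖z‖ := by
      refine abs_le_of_sq_le_sq' ?_ (by positivity) |>.2
      nlinarith [sq_nonneg (1 - |y|)]
    have h4 : |z.arg| * ‖z‖ ≤ 2 * |y| := by
      have hpi := Real.pi_pos
      have : 2 / Real.pi * |z.arg| * ‖z‖ = 2 * (|z.arg| * ‖z‖) / Real.pi := by ring
      rw [this, div_le_iff₀ hpi] at hsin
      nlinarith [Real.pi_lt_four]
    calc |z.arg| * (1 + |y|) ≤ |z.arg| * (3 / 2 * ‖z‖) :=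
          mul_le_mul_of_nonneg_left h3 (abs_nonneg _)
      _ ≤ 3 * |y| := by linarith
  refine (Complex.norm_le_abs_re_add_abs_im _).trans ?_
  linarith

lemma one_sub_sum_mul_I (θ x : Fin d → ℝ) :
    1 - ∑ i, (θ i * Complex.I) * (x i : ℂ) = 1 - ((x ⬝ᵥ θ : ℝ) : ℂ) * Complex.I := by
  congr 1
  simp only [dotProduct, Complex.ofReal_sum, Complex.ofReal_mul, Finset.sum_mul]
  exact Finset.sum_congr rfl fun i _ => by ring

lemma norm_log_one_sub_sum_le (θ : Fin d → ℝ) {x : Fin d → ℝ} (hx : 0 ≤ x) :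
    ‖Complex.log (1 - ∑ i, (θ i * Complex.I) * (x i : ℂ))‖ ≤
      4 * (1 + ‖θ‖) * Real.log (1 + ∑ l, x l) := by
  rw [one_sub_sum_mul_I]
  refine (norm_log_one_sub_mul_I_le _).trans ?_
  rw [mul_assoc]
  refine mul_le_mul_of_nonneg_left ?_ (by norm_num)
  have hs : 0 ≤ ∑ l, x l := Finset.sum_nonneg fun l _ => hx l
  have h1 : |x ⬝ᵥ θ| ≤ (1 + ‖θ‖) * ∑ l, x l := by
    refine (Finset.abs_sum_le_sum_abs _ _).trans ?_
    rw [Finset.mul_sum]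
    refine Finset.sum_le_sum fun i _ => ?_
    rw [abs_mul, abs_of_nonneg (hx i), mul_comm]
    refine mul_le_mul_of_nonneg_right ?_ (hx i)
    have := norm_le_pi_norm θ i
    rw [Real.norm_eq_abs] at this
    linarith
  rw [← Real.log_rpow (by linarith)]
  refine Real.log_le_log (by positivity) ?_
  -- Bernoulli's inequality `1 + p s ≤ (1 + s) ^ p` with `p = 1 + ‖θ‖`
  refine le_trans ?_ (one_add_mul_self_le_rpow_one_add (by linarith)
    (le_add_of_nonneg_right (norm_nonneg θ)))
  linarith

/-- Pointwise convergence of the cumulant generating functions on the imaginary axis. -/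
lemma ThorinTendsto.tendsto_sum_log (h : ThorinTendsto Sm am S a) (θ : Fin d → ℝ) :
    Tendsto (fun m => ∑ x ∈ Sm m, (am m x : ℂ) *
        Complex.log (1 - ∑ i, (θ i * Complex.I) * (x i : ℂ))) atTop
      (𝓝 (∑ x ∈ S, (a x : ℂ) * Complex.log (1 - ∑ i, (θ i * Complex.I) * (x i : ℂ)))) := by
  set L : (Fin d → ℝ) → ℂ := fun x =>
    Complex.log (1 - ∑ i, (θ i * Complex.I) * (x i : ℂ)) with hL
  have hc : Continuous L := by
    refine Continuous.clog (by fun_prop) fun x => ?_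
    rw [one_sub_sum_mul_I]
    exact Or.inl (by simp)
  have hre := h.tendsto_sum (F := fun x => (L x).re)
    (Complex.continuous_re.comp hc).continuousOn
    fun x hx => (Complex.abs_re_le_norm _).trans (norm_log_one_sub_sum_le θ hx)
  have him := h.tendsto_sum (F := fun x => (L x).im)
    (Complex.continuous_im.comp hc).continuousOn
    fun x hx => (Complex.abs_im_le_norm _).trans (norm_log_one_sub_sum_le θ hx)
  have key : ∀ (T : Finset (Fin d → ℝ)) (b : (Fin d → ℝ) → ℝ),
      ∑ x ∈ T, (b x : ℂ) * L x =
        ((∑ x ∈ T, b x * (L x).re : ℝ) : ℂ) + ((∑ x ∈ T, b x * (L x).im : ℝ) : ℂ) * Complex.I := by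
    intro T b
    push_cast
    rw [Finset.sum_mul, ← Finset.sum_add_distrib]
    refine Finset.sum_congr rfl fun x _ => ?_
    conv_lhs => rw [← Complex.re_add_im (L x)]
    ring
  change Tendsto (fun m => ∑ x ∈ Sm m, (am m x : ℂ) * L x) atTop (𝓝 (∑ x ∈ S, (a x : ℂ) * L x))
  simp only [key]
  exact ((Complex.continuous_ofReal.tendsto _).comp hre).add
    (((Complex.continuous_ofReal.tendsto _).comp him).mul_const _)

end Convergence

/-! ### Convergence of densities in `L²` -/

section Density

variable {d : ℕ} {ν : Measure (Fin d → ℝ)} {S : Finset (Fin d → ℝ)} {a : (Fin d → ℝ) → ℝ}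
  {f g : (Fin d → ℝ) → ℝ}

/-- The characteristic function of the generalized Gamma convolution with atoms `S` and
masses `a`. -/
def gammaChar (S : Finset (Fin d → ℝ)) (a : (Fin d → ℝ) → ℝ) (θ : Fin d → ℝ) : ℂ :=
  Complex.exp (-∑ x ∈ S, (a x : ℂ) * Complex.log (1 - ∑ i, (θ i * Complex.I) * (x i : ℂ)))

lemma continuous_gammaChar (S : Finset (Fin d → ℝ)) (a : (Fin d → ℝ) → ℝ) :
    Continuous (gammaChar S a) := by
  refine Complex.continuous_exp.comp (Continuous.neg (continuous_finsetSum _ fun x _ => ?_))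
  refine continuous_const.mul (Continuous.clog (by fun_prop) fun θ => ?_)
  rw [one_sub_sum_mul_I]
  exact Or.inl (by simp)

lemma norm_gammaChar_sq (S : Finset (Fin d → ℝ)) (a : (Fin d → ℝ) → ℝ) (θ : Fin d → ℝ) :
    ‖gammaChar S a θ‖ ^ 2 = Real.exp (-logMod S a θ) := by
  rw [gammaChar, Complex.norm_exp, ← Real.exp_nat_mul]
  congr 1
  rw [Complex.neg_re, Complex.re_sum, logMod, mul_neg, Finset.mul_sum]
  congr 1
  refine Finset.sum_congr rfl fun x _ => ?_
  rw [Complex.re_ofReal_mul, Complex.log_re, one_sub_sum_mul_I]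
  have hsq : ‖1 - ((x ⬝ᵥ θ : ℝ) : ℂ) * Complex.I‖ ^ 2 = 1 + (x ⬝ᵥ θ) ^ 2 := by
    rw [← Complex.normSq_eq_norm_sq, Complex.normSq_apply]
    simp
    ring
  rw [← hsq, Real.log_pow]
  push_cast
  ring

lemma IsGammaConvolutionDensity.integrable (h : IsGammaConvolutionDensity g ν) :
    Integrable g := by
  have := h.isGammaConvolution.isProbabilityMeasure
  refine ⟨h.aemeasurable.aestronglyMeasurable, ?_⟩
  rw [hasFiniteIntegral_iff_ofReal h.nonneg, ← setLIntegral_univ, ← withDensity_apply _ .univ]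
  exact measure_lt_top _ _

lemma IsGammaConvolutionDensity.charInt_eq (h : IsGammaConvolutionDensity g ν)
    (hν : IsAtomic ν S a) (θ : Fin d → ℝ) : charInt g θ = gammaChar S a θ := by
  have hl := h.isGammaConvolution.laplace (fun i => θ i * Complex.I) (fun i => by simp)
  rw [hν.cgf_eq] at hl
  rw [gammaChar, ← hl, charInt, integral_withDensity_eq_integral_toReal_smul₀
    h.aemeasurable.ennreal_ofReal (by simp)]
  refine integral_congr_ae ?_
  filter_upwards [h.nonneg] with x hx
  rw [ENNReal.toReal_ofReal hx, Complex.real_smul, mul_comm]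

lemma enorm_gammaChar_sq (S : Finset (Fin d → ℝ)) (a : (Fin d → ℝ) → ℝ) (θ : Fin d → ℝ) :
    ‖gammaChar S a θ‖ₑ ^ 2 = ENNReal.ofReal (Real.exp (-logMod S a θ)) := by
  rw [← norm_gammaChar_sq, ENNReal.ofReal_pow (norm_nonneg _), ofReal_norm]

lemma IsGammaConvolutionDensity.lintegral_ne_top (h : IsGammaConvolutionDensity f ν)
    (hν : IsAtomic ν S a) (hf2 : MemLp f 2 volume) :
    ∫⁻ t, ENNReal.ofReal (Real.exp (-logMod S a t)) ≠ ⊤ := by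
  obtain ⟨C, hC0, -, hC⟩ := exists_lintegral_sq_charInt d
  have h1 := hC f h.integrable
  simp only [h.charInt_eq hν, enorm_gammaChar_sq] at h1
  intro htop
  rw [htop, ENNReal.mul_top hC0] at h1
  exact ENNReal.pow_ne_top hf2.2.ne h1

lemma charInt_sub (hf : Integrable f) (hg : Integrable g) (θ : Fin d → ℝ) :
    charInt (fun x => f x - g x) θ = charInt f θ - charInt g θ := by
  have key : ∀ {h : (Fin d → ℝ) → ℝ}, Integrable h →
      Integrable fun x : Fin d → ℝ =>
        Complex.exp (∑ i, (θ i * Complex.I) * (x i : ℂ)) * (h x : ℂ) := by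
    intro h hh
    refine hh.ofReal.bdd_mul (c := 1) (Continuous.aestronglyMeasurable (by fun_prop))
      (Eventually.of_forall fun x => ?_)
    rw [Complex.norm_exp]
    simp
  rw [charInt, charInt, charInt, ← integral_sub (key hf) (key hg)]
  refine integral_congr_ae (Eventually.of_forall fun x => ?_)
  simp only
  push_cast
  ring

variable {Sm : ℕ → Finset (Fin d → ℝ)} {am : ℕ → (Fin d → ℝ) → ℝ}

lemma ThorinTendsto.tendsto_gammaChar (h : ThorinTendsto Sm am S a) (θ : Fin d → ℝ) :
    Tendsto (fun m => gammaChar (Sm m) (am m) θ) atTop (𝓝 (gammaChar S a θ)) :=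
  (Complex.continuous_exp.tendsto _).comp (h.tendsto_sum_log θ).neg

lemma logMod_nonneg {T : Finset (Fin d → ℝ)} {b : (Fin d → ℝ) → ℝ} (hb : ∀ x ∈ T, 0 ≤ b x)
    (t : Fin d → ℝ) : 0 ≤ logMod T b t :=
  Finset.sum_nonneg fun x hx => mul_nonneg (hb x hx) (log_one_add_sq_nonneg _)

lemma nearMass_self_ge {ε : ℝ} (hε : 0 < ε) (ha : ∀ x ∈ S, 0 ≤ a x) {y : Fin d → ℝ}
    (hy : y ∈ S) : a y - ε ≤ nearMass S a ε y := by
  refine (sub_le_self _ hε.le).trans ?_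
  exact Finset.single_le_sum (f := a) (fun x hx => ha x (mem_nearPoints.1 hx).1)
    (mem_nearPoints.2 ⟨hy, by simpa using hε⟩)

lemma enorm_sub_sq_le (z w : ℂ) : ‖z - w‖ₑ ^ 2 ≤ 2 * (‖z‖ₑ ^ 2 + ‖w‖ₑ ^ 2) := by
  have h : ‖z - w‖ ^ 2 ≤ 2 * (‖z‖ ^ 2 + ‖w‖ ^ 2) := by
    have := norm_sub_le z w
    nlinarith [sq_nonneg (‖z‖ - ‖w‖), norm_nonneg (z - w), norm_nonneg z, norm_nonneg w]
  have h' := ENNReal.ofReal_le_ofReal h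
  rwa [ENNReal.ofReal_mul zero_le_two, ENNReal.ofReal_add (by positivity) (by positivity),
    ENNReal.ofReal_pow (norm_nonneg _), ENNReal.ofReal_pow (norm_nonneg _),
    ENNReal.ofReal_pow (norm_nonneg _), ofReal_norm, ofReal_norm, ofReal_norm,
    ENNReal.ofReal_ofNat] at h'

lemma exists_one_le_mul_weight {ε : ℝ} (hε : 0 < ε) {δ : ℝ} (hδ : 0 < δ) :
    ∃ R : ℝ, ∀ t : Fin d → ℝ, R ≤ ‖t‖ → 1 ≤ δ * (1 + (ε * ‖t‖) ^ 2) ^ (ε / 2) := by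
  have hlim : Tendsto (fun r : ℝ => (1 + (ε * r) ^ 2) ^ (ε / 2)) atTop atTop := by
    refine (tendsto_rpow_atTop (by positivity)).comp ?_
    refine tendsto_atTop_add_const_left _ _ ?_
    exact (tendsto_pow_atTop two_ne_zero).comp (tendsto_id.const_mul_atTop hε)
  obtain ⟨R, hR⟩ := eventually_atTop.1 (hlim.eventually_ge_atTop δ⁻¹)
  refine ⟨R, fun t ht => ?_⟩
  have := hR _ ht
  rwa [inv_le_iff_one_le_mul₀' hδ] at this

/-- Outside a large ball, the `L²` distance of the characteristic functions is controlled by the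
weighted bound. -/
lemma setLIntegral_compl_ball_le {S' : Finset (Fin d → ℝ)} {a' : (Fin d → ℝ) → ℝ} {ε : ℝ}
    (hε : IsAdmissible S a ε) (ha : ∀ x ∈ S, 0 ≤ a x) (ha' : ∀ x ∈ S', 0 ≤ a' x)
    (hclose : ∀ y ∈ S, a y - ε ≤ nearMass S' a' ε y) {δ R : ℝ} (hδ : 0 ≤ δ)
    (hR : ∀ t : Fin d → ℝ, R ≤ ‖t‖ → 1 ≤ δ * (1 + (ε * ‖t‖) ^ 2) ^ (ε / 2)) :
    ∫⁻ t in (Metric.ball 0 R)ᶜ, ‖gammaChar S a t - gammaChar S' a' t‖ₑ ^ 2 ≤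
      ENNReal.ofReal δ * (4 * uniformConst S ε) := by
  set H : Finset (Fin d → ℝ) → ((Fin d → ℝ) → ℝ) → (Fin d → ℝ) → ℝ≥0∞ := fun T b t =>
    ENNReal.ofReal ((1 + (ε * ‖t‖) ^ 2) ^ (ε / 2) * Real.exp (-logMod T b t)) with hH
  have hHm : ∀ T b, Measurable (H T b) := fun T b => by
    refine (Continuous.mul ?_ ?_).measurable.ennreal_ofReal
    · exact Continuous.rpow_const (by fun_prop) fun t => Or.inl (one_add_sq_pos _).ne'
    · exact Real.continuous_exp.comp (continuous_logMod T b).neg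
  have h1 : ∀ t ∈ (Metric.ball (0 : Fin d → ℝ) R)ᶜ,
      ‖gammaChar S a t - gammaChar S' a' t‖ₑ ^ 2 ≤
        ENNReal.ofReal δ * (2 * (H S a t + H S' a' t)) := by
    intro t ht
    have ht' : R ≤ ‖t‖ := by simpa using ht
    have key : ∀ T b, ‖gammaChar T b t‖ₑ ^ 2 ≤ ENNReal.ofReal δ * H T b t := by
      intro T b
      rw [enorm_gammaChar_sq, hH, ← ENNReal.ofReal_mul hδ]
      refine ENNReal.ofReal_le_ofReal ?_
      rw [← mul_assoc]
      exact le_mul_of_one_le_left (Real.exp_nonneg _) (hR t ht')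
    refine (enorm_sub_sq_le _ _).trans ?_
    calc 2 * (‖gammaChar S a t‖ₑ ^ 2 + ‖gammaChar S' a' t‖ₑ ^ 2)
        ≤ 2 * (ENNReal.ofReal δ * H S a t + ENNReal.ofReal δ * H S' a' t) := by
          gcongr <;> apply key
      _ = _ := by ring
  calc ∫⁻ t in (Metric.ball 0 R)ᶜ, ‖gammaChar S a t - gammaChar S' a' t‖ₑ ^ 2
      ≤ ∫⁻ t in (Metric.ball 0 R)ᶜ, ENNReal.ofReal δ * (2 * (H S a t + H S' a' t)) :=
        setLIntegral_mono' Metric.isOpen_ball.measurableSet.compl h1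
    _ ≤ ∫⁻ t, ENNReal.ofReal δ * (2 * (H S a t + H S' a' t)) := setLIntegral_le_lintegral _ _
    _ = ENNReal.ofReal δ * (2 * ((∫⁻ t, H S a t) + ∫⁻ t, H S' a' t)) := by
        rw [lintegral_const_mul' _ _ ENNReal.ofReal_ne_top,
          lintegral_const_mul' _ _ ENNReal.ofNat_ne_top, lintegral_add_left (hHm S a)]
    _ ≤ ENNReal.ofReal δ * (2 * (uniformConst S ε + uniformConst S ε)) := by
        gcongr
        · exact lintegral_weight_mul_exp_neg_logMod_le hε ha
            fun y hy => nearMass_self_ge hε.pos ha hy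
        · exact lintegral_weight_mul_exp_neg_logMod_le hε ha' hclose
    _ = _ := by ring

lemma ThorinTendsto.setLIntegral_ball_tendsto (h : ThorinTendsto Sm am S a) (R : ℝ) :
    Tendsto (fun m => ∫⁻ t in Metric.ball 0 R,
      ‖gammaChar S a t - gammaChar (Sm m) (am m) t‖ₑ ^ 2) atTop (𝓝 0) := by
  have hle : ∀ {T : Finset (Fin d → ℝ)} {b : (Fin d → ℝ) → ℝ}, (∀ x ∈ T, 0 ≤ b x) → ∀ t,
      ‖gammaChar T b t‖ₑ ^ 2 ≤ 1 := by
    intro T b hb t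
    rw [enorm_gammaChar_sq, ENNReal.ofReal_le_one, Real.exp_le_one_iff, neg_nonpos]
    exact logMod_nonneg hb t
  have hlim := tendsto_lintegral_of_dominated_convergence
    (μ := volume.restrict (Metric.ball (0 : Fin d → ℝ) R)) (f := fun _ => 0)
    (F := fun m t => ‖gammaChar S a t - gammaChar (Sm m) (am m) t‖ₑ ^ 2) (fun _ => 4)
    (fun m => (((continuous_gammaChar S a).sub
      (continuous_gammaChar _ _)).enorm.measurable.pow_const 2))
    (fun m => Eventually.of_forall fun t => ?_) ?_ (Eventually.of_forall fun t => ?_)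
  · simpa using hlim
  · refine (enorm_sub_sq_le _ _).trans ?_
    calc 2 * (‖gammaChar S a t‖ₑ ^ 2 + ‖gammaChar (Sm m) (am m) t‖ₑ ^ 2)
        ≤ 2 * (1 + 1) := by
          gcongr
          · exact hle h.mass t
          · exact hle (h.mass_seq m) t
      _ = 4 := by norm_num
  · rw [setLIntegral_const]
    exact ENNReal.mul_ne_top (by simp) measure_ball_lt_top.ne
  · have h1 : Tendsto (fun m => gammaChar S a t - gammaChar (Sm m) (am m) t) atTop (𝓝 0) := by
      simpa using (h.tendsto_gammaChar t).const_sub (gammaChar S a t)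
    have h2 := (ENNReal.continuous_pow 2).tendsto _ |>.comp h1.enorm
    simpa [Function.comp_def] using h2

/-- If the Thorin moments converge and the limit density is in `L²`, then the densities
converge in `L²`. -/
theorem ThorinTendsto.tendsto_eLpNorm (h : ThorinTendsto Sm am S a) (hν : IsAtomic ν S a)
    (hf : IsGammaConvolutionDensity f ν) (hf2 : MemLp f 2 volume)
    {νm : ℕ → Measure (Fin d → ℝ)} (hνm : ∀ m, IsAtomic (νm m) (Sm m) (am m))
    {gm : ℕ → (Fin d → ℝ) → ℝ} (hgm : ∀ m, IsGammaConvolutionDensity (gm m) (νm m)) :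
    Tendsto (fun m => eLpNorm (fun x => f x - gm m x) 2 volume ^ 2) atTop (𝓝 0) := by
  obtain ⟨C, -, hCtop, hC⟩ := exists_lintegral_sq_charInt d
  have heq : ∀ m, eLpNorm (fun x => f x - gm m x) 2 volume ^ 2 =
      C * ∫⁻ t, ‖gammaChar S a t - gammaChar (Sm m) (am m) t‖ₑ ^ 2 := fun m => by
    rw [hC (fun x => f x - gm m x) (hf.integrable.sub (hgm m).integrable)]
    simp only [charInt_sub hf.integrable (hgm m).integrable, hf.charInt_eq hν,
      (hgm m).charInt_eq (hνm m)]
  simp only [heq]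
  suffices Tendsto (fun m => ∫⁻ t, ‖gammaChar S a t - gammaChar (Sm m) (am m) t‖ₑ ^ 2) atTop
      (𝓝 0) by simpa using ENNReal.Tendsto.const_mul this (Or.inr hCtop)
  obtain ⟨ε, hε⟩ := exists_isAdmissible hν.pos fun b _ hb hbd =>
    lt_massOffSpan h.mass (hf.lintegral_ne_top hν hf2) hb hbd
  have hclose : ∀ᶠ m in atTop, ∀ y ∈ S, a y - ε ≤ nearMass (Sm m) (am m) ε y :=
    (Finset.eventually_all S).2 fun y hy => h.eventually_nearMass hε.pos hy
  rw [ENNReal.tendsto_nhds_zero]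
  intro η hη
  have hδ : ∃ δ : ℝ, 0 < δ ∧ ENNReal.ofReal δ * (4 * uniformConst S ε) ≤ η / 2 := by
    have h0 : Tendsto (fun δ : ℝ => ENNReal.ofReal δ * (4 * uniformConst S ε)) (𝓝[>] 0) (𝓝 0) := by
      have h1 : Tendsto ENNReal.ofReal (𝓝[>] 0) (𝓝 0) := by
        simpa using (ENNReal.continuous_ofReal.tendsto 0).mono_left nhdsWithin_le_nhds
      simpa using ENNReal.Tendsto.mul_const h1 (Or.inr
        (ENNReal.mul_ne_top (by simp) (uniformConst_ne_top S ε)))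
    obtain ⟨δ, h1, h2⟩ := ((ENNReal.tendsto_nhds_zero.1 h0 (η / 2)
      (ENNReal.half_pos hη.ne')).and self_mem_nhdsWithin).exists
    exact ⟨δ, h2, h1⟩
  obtain ⟨δ, hδ0, hδ⟩ := hδ
  obtain ⟨R, hR⟩ := exists_one_le_mul_weight (d := d) hε.pos hδ0
  filter_upwards [hclose, ENNReal.tendsto_nhds_zero.1 (h.setLIntegral_ball_tendsto R) (η / 2)
    (ENNReal.half_pos hη.ne')] with m hm1 hm2
  rw [← lintegral_add_compl _ (Metric.isOpen_ball (x := (0 : Fin d → ℝ)) (ε := R)).measurableSet]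
  calc _ ≤ η / 2 + η / 2 := add_le_add hm2 ((setLIntegral_compl_ball_le hε h.mass
        (h.mass_seq m) hm1 hδ0.le hR).trans hδ)
    _ = η := ENNReal.add_halves η

/-- The multi-indices with entries at most `m`. -/
def boxIndices (d m : ℕ) : Finset (Fin d → ℕ) := Fintype.piFinset fun _ => Finset.range (m + 1)

lemma eventually_mem_boxIndices (k : Fin d → ℕ) : ∀ᶠ m in atTop, k ∈ boxIndices d m := by
  simp only [boxIndices, Fintype.mem_piFinset, Finset.mem_range]
  exact eventually_all.2 fun i => (eventually_ge_atTop (k i)).mono fun m hm => by omega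

/-- Sequences of well-behaved measures whose Thorin moments converge converge in the sense of
`ThorinTendsto`. -/
lemma thorinTendsto_of_boxIndices (hν : IsAtomic ν S a) {νm : ℕ → Measure (Fin d → ℝ)}
    (hνm : ∀ m, IsAtomic (νm m) (Sm m) (am m))
    (hclose : ∀ m (k : boxIndices d m),
      |thorinMoment _ (νm m) k - thorinMoment _ ν k| < 1 / ((m : ℝ) + 1)) :
    ThorinTendsto Sm am S a := by
  have key : ∀ k : Fin d → ℕ, Tendsto (fun m => thorinMoment {k} (νm m) ⟨k, by simp⟩) atTop
      (𝓝 (thorinMoment {k} ν ⟨k, by simp⟩)) := by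
    intro k
    rw [tendsto_iff_dist_tendsto_zero]
    refine squeeze_zero' (Eventually.of_forall fun m => dist_nonneg) ?_
      tendsto_one_div_add_atTop_nhds_zero_nat
    filter_upwards [eventually_mem_boxIndices k] with m hm
    exact (hclose m ⟨k, hm⟩).le
  refine ⟨fun m => (hνm m).nonneg, fun m x hx => ((hνm m).pos x hx).le, hν.nonneg, hν.ne_zero,
    fun x hx => (hν.pos x hx).le, fun k hk => ?_, ?_⟩
  · have := key k
    simp only [fun m => (hνm m).thorinMoment_apply (I := {k}) ⟨k, by simp⟩ hk,
      hν.thorinMoment_apply (I := {k}) ⟨k, by simp⟩ hk] at this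
    exact this
  · have := (key 0).neg
    simp only [fun m => (hνm m).thorinMoment_zero (I := {0}) ⟨0, by simp⟩ rfl,
      hν.thorinMoment_zero (I := {0}) ⟨0, by simp⟩ rfl, neg_neg] at this
    exact this

/-- The density, as an element of `L²`, depends continuously on the Thorin moments at every
well-behaved measure with square integrable density. -/
theorem exists_boxIndices_forall_eLpNorm_le (hν : IsWellBehaved ν)
    (hf : IsGammaConvolutionDensity f ν) (hf2 : MemLp f 2 volume) {ε : ℝ≥0∞} (hε : 0 < ε) :
    ∃ m : ℕ, ∀ ν', IsWellBehaved ν' →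
      (∀ k : boxIndices d m, |thorinMoment _ ν' k - thorinMoment _ ν k| < 1 / ((m : ℝ) + 1)) →
      ∀ g, IsGammaConvolutionDensity g ν' → eLpNorm (fun x => f x - g x) 2 volume ^ 2 ≤ ε := by
  by_contra! hcon
  choose νm hwb hclose gm hgm hbig using hcon
  obtain ⟨S, a, hν⟩ := hν.exists_isAtomic
  choose Sm am hνm using fun m => (hwb m).exists_isAtomic
  have hlim := (thorinTendsto_of_boxIndices hν hνm hclose).tendsto_eLpNorm hν hf hf2 hνm hgm
  obtain ⟨m, hm⟩ := (ENNReal.tendsto_nhds_zero.1 hlim ε hε).exists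
  exact (hbig m).not_ge hm

end Density

/-! ### The strong law for the empirical moments -/

section StrongLaw

variable {d : ℕ} {Ω : Type*} [MeasurableSpace Ω] {P : Measure Ω}

lemma empiricalMoment_apply (I : Finset (Fin d → ℕ)) (x : ℕ → Fin d → ℝ) (N : ℕ) (k : I) :
    empiricalMoment I (fun n : Fin N => x n) k =
      (∑ n ∈ Finset.range N, expMonomial k.1 (-1) (x n)) / N := by
  rw [empiricalMoment, Fin.sum_univ_eq_sum_range
    (fun n => (∏ i, x n i ^ k.1 i) * Real.exp (-∑ i, x n i)), div_eq_inv_mul]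
  simp [expMonomial]

lemma ae_tendsto_empiricalMoment {X : ℕ → Ω → Fin d → ℝ} {μ : Measure (Fin d → ℝ)}
    [IsProbabilityMeasure μ] (hμ : ∀ᵐ x ∂μ, 0 ≤ x) (hX : ∀ n, Measurable (X n))
    (hindep : iIndepFun X P) (hlaw : ∀ n, P.map (X n) = μ) :
    ∀ᵐ ω ∂P, ∀ I : Finset (Fin d → ℕ),
      Tendsto (fun N => empiricalMoment I fun n : Fin N => X n ω) atTop
        (𝓝 fun k => ∫ x, expMonomial k.1 (-1) x ∂μ) := by
  have h : ∀ᵐ ω ∂P, ∀ k : Fin d → ℕ,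
      Tendsto (fun N : ℕ => (∑ n ∈ Finset.range N, expMonomial k (-1) (X n ω)) / N) atTop
        (𝓝 (∫ x, expMonomial k (-1) x ∂μ)) := by
    refine ae_all_iff.2 fun k => ?_
    have hm := measurable_expMonomial k (-1 : Fin d → ℝ)
    have hint := integrable_expMonomial hμ k neg_one_mem_negOrthant
    rw [← hlaw 0] at hint ⊢
    rw [integral_map (hX 0).aemeasurable hm.aestronglyMeasurable]
    exact strong_law_ae_real (fun n ω => expMonomial k (-1) (X n ω))
      (hint.comp_measurable (hX 0))
      (fun i j hij => (hindep.indepFun hij).comp hm hm)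
      fun n => (IdentDistrib.mk (hX n).aemeasurable (hX 0).aemeasurable
        ((hlaw n).trans (hlaw 0).symm)).comp hm
  filter_upwards [h] with ω hω I
  refine tendsto_pi_nhds.2 fun k => ?_
  simpa only [empiricalMoment_apply I (fun n => X n ω)] using hω k.1

end StrongLaw

end Thorin

end

/-! ### Consistency -/

theorem mainTheorem3 {d : ℕ} {Ω : Type*} [MeasurableSpace Ω] (P : Measure Ω)
    [IsProbabilityMeasure P]
    (f : (Fin d → ℝ) → ℝ) (ν : Measure (Fin d → ℝ))
    (hν : Thorin.IsWellBehaved ν) (hf : Thorin.IsGammaConvolutionDensity f ν)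
    (hf2 : MemLp f 2 volume)
    (X : ℕ → Ω → Fin d → ℝ) (hX : ∀ n, Measurable (X n)) (hindep : iIndepFun X P)
    (hlaw : ∀ n, P.map (X n) = volume.withDensity fun x => ENNReal.ofReal (f x)) :
    ∀ᵐ ω ∂P, ∀ ε : ℝ≥0∞, 0 < ε →
      ∃ I₀ : Finset (Fin d → ℕ), ∀ I : Finset (Fin d → ℕ), I₀ ⊆ I →
        IsLowerSet (I : Set (Fin d → ℕ)) → I.Nonempty →
        ∃ N₀ : ℕ, ∀ N ≥ N₀, ∀ νhat : Measure (Fin d → ℝ),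
          Thorin.IsGlobalMinimizer I (fun n : Fin N => X n ω) νhat →
          (∃ g, Thorin.IsGammaConvolutionDensity g νhat) ∧
          ∀ g, Thorin.IsGammaConvolutionDensity g νhat →
            eLpNorm (fun x => f x - g x) 2 volume ^ 2 ≤ ε := by
  have hlim := hf.isGammaConvolution
  have := hlim.isProbabilityMeasure
  obtain ⟨S, a, hatom⟩ := hν.exists_isAtomic
  filter_upwards [Thorin.ae_tendsto_empiricalMoment hlim.nonneg hX hindep hlaw] with ω hω ε hε
  obtain ⟨m, hm⟩ := Thorin.exists_boxIndices_forall_eLpNorm_le hν hf hf2 hε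
  refine ⟨Thorin.boxIndices d m, fun I hmI hI _ => ?_⟩
  have hω' := hω I
  rw [← hlim.B_thorinMoment hatom hI] at hω'
  obtain ⟨N₀, hN₀⟩ := eventually_atTop.1 (hω'.eventually
    (Thorin.eventually_thorinMoment_minimizer hI hν (δ := 1 / ((m : ℝ) + 1)) (by positivity)))
  refine ⟨N₀, fun N hN νhat hhat => ⟨?_, ?_⟩⟩
  · obtain ⟨S', a', hatom'⟩ := hhat.1.exists_isAtomic
    exact hatom'.exists_density
  · exact hm νhat hhat.1 fun k => hN₀ N hN N _ rfl νhat hhat ⟨k.1, hmI k.2⟩
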